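/- Let $\Bbbk$ be an algebraically closed field of characteristic $p>0$. For a projective variety $X\subset\mathbb P^N$ (irreducible, reduced) of dimension $n$, let $\gamma_X\colon X\dashrightarrow\mathbb G(n,\mathbb P^N)$ be its Gauss map, which sends a smooth point $x$ to the embedded tangent space $\mathbb T_xX$; let $\gamma_X(X)$ denote the closure of its image, and let $\operatorname{rank}\gamma_X$ be the rank of the differential $d_x\gamma_X$ between Zariski tangent spaces at a general point $x\in X$. For $y\in\gamma_X(X)$, let $\overline{\gamma_X^{-1}(y)}\subset\mathbb P^N$ be the (scheme-theoretic) closure of the scheme-theoretic fibre of $\gamma_X$ over $y$ on the smooth locus of $X$. A variety in $\mathbb P^N$ is non-degenerate if it is contained in no hyperplane. Let $X_1\subset\mathbb P^{N_1}$ be a non-degenerate projective variety, and let $N,r\ge 0$ be integers such that $(p,r)\ne(2,1)$ and $$N-N_1\ \ge\ \begin{cases} r+1 & \text{if } p\ge 3, \text{ or } p=2 \text{ and } r \text{ is even},\\ r+2 & \text{if } p=2 \text{ and } r \text{ is odd}.\end{cases}$$ If $r=0$, assume moreover that $X_1\neq\mathbb P^{N_1}$. Then there exist a non-degenerate projective variety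 $X\subset\mathbb P^N$ and a dominant rational map $\mu\colon\gamma_X(X)\dashrightarrow\gamma_{X_1}(X_1)$ such that $\operatorname{rank}\gamma_X=\operatorname{rank}\gamma_{X_1}+r$ and, for general $y\in\gamma_X(X)$, the closed subscheme $\overline{\gamma_X^{-1}(y)}\subset\mathbb P^N$ is projectively equivalent to $\overline{\gamma_{X_1}^{-1}(\mu(y))}\subset\mathbb P^{N_1}$, that is, it is the image of the latter under some linear embedding $\mathbb P^{N_1}\hookrightarrow\mathbb P^N$. -/

import Mathlib

open scoped LinearAlgebra.Projectivization

namespace GaussMaps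

universe u v w

/-- The projective space of lines in `σ → k`, with homogeneous coordinates indexed by `σ`.
So `PSpace k (Fin (N + 1))` is the set of closed points of `ℙ^N` over `k`. -/
abbrev PSpace (k : Type u) [Field k] (σ : Type v) : Type (max u v) := ℙ k (σ → k)

section

variable {k : Type u} [Field k] {σ : Type v} {τ : Type w}

/-- The Zariski topology: the sets `{F ≠ 0}`, `F` homogeneous, are a basis of the open sets. -/
instance zariski : TopologicalSpace (PSpace k σ) :=
  TopologicalSpace.generateFrom
    {D | ∃ (F : MvPolynomial σ k) (d : ℕ), F.IsHomogeneous d ∧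
      D = {x : PSpace k σ | MvPolynomial.eval x.rep F ≠ 0}}

/-- The ideal of all polynomials that vanish on the affine cone over `X`
(for infinite `k`, it is the homogeneous ideal `I(X)`). -/
def vanishingIdeal (X : Set (PSpace k σ)) : Ideal (MvPolynomial σ k) where
  carrier := {F | ∀ x ∈ X, ∀ a : k, MvPolynomial.eval (a • x.rep) F = 0}
  add_mem' := fun {F G} hF hG x hx a => by
    rw [map_add, hF x hx a, hG x hx a, add_zero]
  zero_mem' := fun x _ a => map_zero _
  smul_mem' := fun c F hF x hx a => by
    rw [smul_eq_mul, map_mul, hF x hx a, mul_zero]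

/-- A projective variety, as its set of closed points: closed and irreducible
(in particular non-empty), with the reduced structure. -/
structure IsProjectiveVariety (X : Set (PSpace k σ)) : Prop where
  isClosed : IsClosed X
  isIrreducible : IsIrreducible X

/-- The dimension of a projective variety: the transcendence degree of its homogeneous
coordinate ring, minus one. -/
noncomputable def dim (X : Set (PSpace k σ)) : ℕ :=
  Cardinal.toNat (Algebra.trdeg k (MvPolynomial σ k ⧸ vanishingIdeal X)) - 1

/-- `X` is not contained in any hyperplane. -/
def IsNondegenerate [Fintype σ] (X : Set (PSpace k σ)) : Prop :=
  ∀ c : σ → k, (∀ x ∈ X, ∑ i, c i * x.rep i = 0) → c = 0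

/-- The linear subspace of `σ → k` whose projectivization is the embedded tangent space
`𝕋_x X`: the common kernel of the differentials at `x` of the equations of `X`. -/
noncomputable def embTangent [Fintype σ] (X : Set (PSpace k σ)) (x : PSpace k σ) :
    Submodule k (σ → k) where
  carrier := {t | ∀ F ∈ vanishingIdeal X,
    ∑ i, MvPolynomial.eval x.rep (MvPolynomial.pderiv i F) * t i = 0}
  add_mem' := fun {s t} hs ht F hF => by
    simp only [Pi.add_apply, mul_add, Finset.sum_add_distrib, hs F hF, ht F hF, add_zero]
  zero_mem' := fun F _ => by simp
  smul_mem' := fun c t ht F hF => by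
    simp only [Pi.smul_apply, smul_eq_mul, mul_left_comm _ c, ← Finset.mul_sum, ht F hF, mul_zero]

/-- The set of smooth points of a projective variety. -/
def smoothLocus [Fintype σ] (X : Set (PSpace k σ)) : Set (PSpace k σ) :=
  {x | x ∈ X ∧ Module.finrank k (embTangent X x) = dim X + 1}

/-! ### Regular maps, rational maps, rank and fibres -/

/-- The map `f : U → ℙ(τ → k)` is given around the point `x` by the homogeneous polynomials
`P i` of one common degree: they do not all vanish at `x`, and `f = [P]` on `U ∩ {P ≠ 0}`. -/
structure IsLocalRep {U : Set (PSpace k σ)} (f : U → PSpace k τ) (x : U)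
    (P : τ → MvPolynomial σ k) : Prop where
  homogeneous : ∃ d : ℕ, ∀ i, (P i).IsHomogeneous d
  ne_zero : (fun i => MvPolynomial.eval x.1.rep (P i)) ≠ 0
  eq_mk : ∀ (u : U) (h : (fun i => MvPolynomial.eval u.1.rep (P i)) ≠ 0),
    f u = Projectivization.mk k (fun i => MvPolynomial.eval u.1.rep (P i)) h

/-- A rational map `X ⇢ Y`, for an irreducible `X`: a regular map to `Y` on a
non-empty open subset of `X`. -/
structure RationalMap (X : Set (PSpace k σ)) (Y : Set (PSpace k τ)) where
  dom : Set (PSpace k σ)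
  dom_open : ∃ O : Set (PSpace k σ), IsOpen O ∧ dom = O ∩ X
  dom_nonempty : dom.Nonempty
  toFun : dom → PSpace k τ
  mem : ∀ x, toFun x ∈ Y
  regular : ∀ x : dom, ∃ P, IsLocalRep toFun x P

/-- The image of the rational map is dense in the target. -/
def RationalMap.IsDominant {X : Set (PSpace k σ)} {Y : Set (PSpace k τ)}
    (μ : RationalMap X Y) : Prop :=
  Y ⊆ closure (Set.range μ.toFun)

/-- The differential at `x` of `f = [P]`, for `f` defined on a subset of a variety `X`.
If `x = [v]`, the Zariski tangent space `T_x X` is `embTangent X x / k v`, the tangent space of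
`ℙ(τ → k)` at `f x` is `(τ → k) / k P(v)`, and `d_x f` is induced by
`t ↦ (∑ j, ∂_j P_i (v) t_j)_i`, which by Euler's relation sends `v` to a multiple of `P(v)`. -/
noncomputable def differential [Fintype σ] (X : Set (PSpace k σ)) (P : τ → MvPolynomial σ k)
    (x : PSpace k σ) :
    embTangent X x →ₗ[k]
      ((τ → k) ⧸ Submodule.span k {fun i => MvPolynomial.eval x.rep (P i)}) :=
  (Submodule.mkQ _ ∘ₗ
    Matrix.mulVecLin (Matrix.of fun (i : τ) (j : σ) =>
      MvPolynomial.eval x.rep (MvPolynomial.pderiv j (P i)))) ∘ₗ (embTangent X x).subtype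

/-- The map `f : U → ℙ(τ → k)`, where `U` is an open subset of the variety `X`, has rank `ρ`:
for general `x`, it is regular at `x` and `d_x f` has rank `ρ`. -/
def HasRank [Fintype σ] (X : Set (PSpace k σ)) {U : Set (PSpace k σ)} (f : U → PSpace k τ)
    (ρ : ℕ) : Prop :=
  ∃ O : Set (PSpace k σ), IsOpen O ∧ (O ∩ U).Nonempty ∧
    ∀ x : U, x.1 ∈ O → ∃ P, IsLocalRep f x P ∧
      Module.finrank k (LinearMap.range (differential X P x.1)) = ρ

/-- The polynomials that lie in the ideal `J` locally at `x`, i.e. the preimage of the ideal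
generated by `J` in the localization of the polynomial ring at `x`. -/
def localPart (J : Ideal (MvPolynomial σ k)) (x : PSpace k σ) : Ideal (MvPolynomial σ k) where
  carrier := {G | ∃ H : MvPolynomial σ k, MvPolynomial.eval x.rep H ≠ 0 ∧ H * G ∈ J}
  add_mem' := by
    rintro F G ⟨A, hA, hAF⟩ ⟨B, hB, hBG⟩
    refine ⟨A * B, by rw [map_mul]; exact mul_ne_zero hA hB, ?_⟩
    have h1 : A * B * (F + G) = B * (A * F) + A * (B * G) := by ring
    rw [h1]
    exact J.add_mem (J.mul_mem_left _ hAF) (J.mul_mem_left _ hBG)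
  zero_mem' := ⟨1, by simp, by simp⟩
  smul_mem' := by
    rintro c G ⟨A, hA, hAG⟩
    refine ⟨A, hA, ?_⟩
    have h1 : A * (c • G) = c * (A * G) := by rw [smul_eq_mul]; ring
    rw [h1]
    exact J.mul_mem_left _ hAG

/-- The homogeneous (saturated) ideal of the closure in `ℙ(σ → k)` of the scheme-theoretic fibre
`f⁻¹(y)`, for a regular map `f` on an open subset `U` of the variety `X`. Where `f = [P]`, the
scheme `f⁻¹(y)` is cut out in `X` by the equations `y_i P_j = y_j P_i`; a form vanishes on the
closure if and only if it vanishes on this scheme locally at each of its points. -/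
noncomputable def fiberIdeal (X : Set (PSpace k σ)) {U : Set (PSpace k σ)} (f : U → PSpace k τ)
    (y : PSpace k τ) : Ideal (MvPolynomial σ k) :=
  ⨅ (x : U) (_ : f x = y) (P : τ → MvPolynomial σ k) (_ : IsLocalRep f x P),
    localPart (vanishingIdeal X ⊔ Ideal.span
      (Set.range fun ij : τ × τ =>
        MvPolynomial.C (y.rep ij.1) * P ij.2 - MvPolynomial.C (y.rep ij.2) * P ij.1)) x.1

/-- The closed subscheme of `ℙ(τ → k)` with homogeneous ideal `J` is projectively equivalent to
the closed subscheme of `ℙ(σ → k)` with homogeneous ideal `J₁`: it is its image under a linear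
embedding `ℙ(σ → k) → ℙ(τ → k)`. The ideal of the image is the preimage of `J₁` under the
substitution homomorphism. -/
def ProjEquiv [Fintype σ] (J₁ : Ideal (MvPolynomial σ k)) (J : Ideal (MvPolynomial τ k)) : Prop :=
  ∃ A : Matrix τ σ k, Function.Injective A.mulVec ∧
    J = J₁.comap (MvPolynomial.aeval (R := k)
      (fun j => ∑ i, MvPolynomial.C (A j i) * MvPolynomial.X i : τ → MvPolynomial σ k))

end

/-! ### Grassmannians and Gauss maps -/

section

variable {k : Type u} [Field k]

/-- The Grassmann variety `𝔾(n, ℙ^N)` of `n`-planes in `ℙ^N`. -/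
abbrev Gr (k : Type u) [Field k] (n N : ℕ) : Type u :=
  {V : Submodule k (Fin (N + 1) → k) // Module.finrank k V = n + 1}

/-- The maximal minors of a matrix. -/
def minors {n N : ℕ} (A : Matrix (Fin (n + 1)) (Fin (N + 1)) k)
    (s : Fin (n + 1) ↪o Fin (N + 1)) : k :=
  (A.submatrix id s).det

theorem minors_ne_zero {n N : ℕ} (A : Matrix (Fin (n + 1)) (Fin (N + 1)) k)
    (hA : LinearIndependent k A.row) : minors A ≠ 0 := by
  obtain ⟨κ, a, ha, hspan, hli⟩ := exists_linearIndependent' k A.col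
  have hrank : A.rank = n + 1 := by simpa using hA.rank_matrix
  have : Finite κ := Finite.of_injective a ha
  have : Fintype κ := Fintype.ofFinite κ
  have hcard : Fintype.card κ = n + 1 := by
    rw [← finrank_span_eq_card hli, hspan, ← Matrix.rank_eq_finrank_span_cols, hrank]
  classical
  have hs : (Finset.univ.image a).card = n + 1 := by
    rw [Finset.card_image_of_injective _ ha, Finset.card_univ, hcard]
  let s : Fin (n + 1) ↪o Fin (N + 1) := (Finset.univ.image a).orderEmbOfFin hs
  have hmem : ∀ j, ∃ c, a c = s j := fun j => by
    obtain ⟨c, -, hc⟩ := Finset.mem_image.mp (Finset.orderEmbOfFin_mem (Finset.univ.image a) hs j)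
    exact ⟨c, hc⟩
  choose b hb using hmem
  have hbinj : Function.Injective b := fun i j hij => s.injective (by rw [← hb, ← hb, hij])
  have hli2 : LinearIndependent k (A.submatrix id s).col := by
    have h2 := hli.comp b hbinj
    have h3 : (A.submatrix id s).col = (A.col ∘ a) ∘ b := by
      funext j
      simp only [Function.comp, hb]
      rfl
    rw [h3]
    exact h2
  intro h0
  have hdet : (A.submatrix id s).det = 0 := congrFun h0 s
  have hu := Matrix.linearIndependent_cols_iff_isUnit.mp hli2
  rw [Matrix.isUnit_iff_isUnit_det, hdet] at hu
  exact not_isUnit_zero hu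

/-- The Plücker embedding of `𝔾(n, ℙ^N)`: the maximal minors of a matrix whose rows are a basis
of the subspace. -/
noncomputable def plucker {n N : ℕ} (V : Gr k n N) :
    PSpace k (Fin (n + 1) ↪o Fin (N + 1)) :=
  Projectivization.mk k
    (minors (Matrix.of fun i => (Module.finBasisOfFinrankEq k V.1 V.2 i : Fin (N + 1) → k)))
    (minors_ne_zero _ ((Module.finBasisOfFinrankEq k V.1 V.2).linearIndependent.map'
      V.1.subtype (Submodule.ker_subtype _)))

/-- The Gauss map `γ_X` of `X ⊆ ℙ^N`: it maps each smooth point `x` to the embedded tangent space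
`𝕋_x X`, a point of `𝔾(dim X, ℙ^N)`, which is embedded by the Plücker embedding. -/
noncomputable def gaussMap {N : ℕ} (X : Set (PSpace k (Fin (N + 1)))) (x : smoothLocus X) :
    PSpace k (Fin (dim X + 1) ↪o Fin (N + 1)) :=
  plucker ⟨embTangent X x.1, x.2.2⟩

/-- The image `γ_X(X)` of the Gauss map, as a projective variety: the closure of the set of the
tangent spaces at smooth points. -/
def gaussImage {N : ℕ} (X : Set (PSpace k (Fin (N + 1)))) :
    Set (PSpace k (Fin (dim X + 1) ↪o Fin (N + 1))) :=
  closure (Set.range (gaussMap X))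

end

end GaussMaps

/-! Work on affine cones. On an open affine piece of the cone over `X₁`, with coordinate ring `B`,
the tangent spaces are the row spaces of a matrix `K` over `B` that contains an identity block, so
the entries of `K` are affine coordinates of the Gauss map. Choose an entry of `K`, let `θ` be its
`p`-th power, put `m = N - N₁ - r`, and let `X` be the closure of the set of points `(x, x₀ s, x₀
q(θ, s))` with `x` in the cone over `X₁`, `s` in affine `r`-space, and `q` a family of `m`
polynomials. Entries of `K` are invariant under scaling of `x` (`IsFrameChart.apply_eq_of_smul`),
hence `X` is again a cone.

Every derivation kills the `p`-th power `θ`, so the tangent spaces of `X` are spanned by the rows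
`(K i, 0, K i 0 (q - ∑ s_l ∂_l q))` and `(0, e_l, ∂_l q)` (`coneTangent_graph`). If each `s_l` is a
linear combination of the `∂_l q_j`, the entries of this larger matrix generate the same algebra as
the entries of `K` together with the `s_l` (`forall_graphMatrix_mem_iff`). A fibre of the Gauss map
of `X` is therefore a fibre for `X₁` at a fixed value of `s`. On it `θ` is constant too, and `x ↦
(x, x₀ s, x₀ q(θ, s))` is linear there: this gives projective equivalence of the fibres as schemes
(`graphHom_mem_span_iff`). The kernels of the two differentials correspond in the same way
(`constantTangent_graph`), while the dimension grows by `r`, so the rank grows by `r`. Some Plücker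
coordinates of `X` are exactly those of `X₁`, so the map `μ` is a coordinate projection
(`exists_rationalMap_closure_range`).

For `r > 0` the `q_j` do not involve `θ`. One quadratic form with nondegenerate Hessian suffices
unless `p = 2` and `r` is odd; the Hessian is then alternating of odd size, hence singular, and a
second quadric is used. This accounts for the bound on `N`. The remaining `q_j` are pure powers,
which make `X` non-degenerate. For `r = 0` the `q_j` are powers of `θ`, which must be non-constant;
it can be chosen so because a non-degenerate variety with constant Gauss map is the whole space
(`IsFrameChart.exists_notMem_range`).

The remaining difficulty is that the closure of the fibre is defined by local conditions at all
smooth points, whereas the computation takes place in one chart. A general fibre has no component,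
even embedded, outside the chart, because a non-zero function is not a zero divisor on general
fibres. This is the generic-freeness statement `exists_ne_zero_forall_maximal`, and it leads to
`IsMapChart.exists_forall_mem_fiberIdeal_iff`. -/

namespace GaussMaps

/-! ### General fibres of a finitely generated algebra over a domain, by division with remainder -/

section GenericFibre

open MvPolynomial

/-- An exponent is `J`-reducible if it is divisible by the leading exponent of an element of `J`. -/
def IsReducible {A : Type*} [CommRing A] {n : ℕ} (J : Ideal (MvPolynomial (Fin n) A))
    (d : Fin n →₀ ℕ) : Prop :=
  ∃ g ∈ J, g ≠ 0 ∧ MonomialOrder.lex.degree g ≤ d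

/-- By Dickson's lemma the minimal reducible exponents form a finite antichain. With `h` the product
of the leading coefficients of one witness for each of them, the witnesses act as a Gröbner basis of
`J` once `h` is inverted. -/
theorem exists_leadingCoeff_dvd {A : Type*} [CommRing A] [IsDomain A] {n : ℕ}
    (J : Ideal (MvPolynomial (Fin n) A)) :
    ∃ h : A, h ≠ 0 ∧ ∀ d, IsReducible J d →
      ∃ g ∈ J, MonomialOrder.lex.degree g ≤ d ∧ MonomialOrder.lex.leadingCoeff g ∣ h := by
  classical
  let D : Set (Fin n →₀ ℕ) := {d | Minimal (IsReducible J) d}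
  have hfin : D.Finite := WellQuasiOrderedLE.finite_of_isAntichain (setOfPred_minimal_antichain _)
  have hmem : ∀ d ∈ D, ∃ g ∈ J, g ≠ 0 ∧ MonomialOrder.lex.degree g ≤ d := fun d hd => hd.1
  choose! g hgJ hg0 hgd using hmem
  refine ⟨∏ d ∈ hfin.toFinset, MonomialOrder.lex.leadingCoeff (g d), ?_, ?_⟩
  · refine Finset.prod_ne_zero_iff.mpr fun d hd => ?_
    exact (MonomialOrder.leadingCoeff_ne_zero_iff).mpr (hg0 d (hfin.mem_toFinset.mp hd))
  · intro d hd
    obtain ⟨d', hd', hmin⟩ := exists_minimal_le_of_wellFoundedLT (IsReducible J) d hd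
    exact ⟨g d', hgJ _ hmin, (hgd _ hmin).trans hd',
      Finset.dvd_prod_of_mem _ (hfin.mem_toFinset.mpr hmin)⟩

/-- Division with remainder by `J`, where each step may multiply by `h` to make the leading
coefficient divisible. The coefficients of `f` stay in `I` throughout, so what is subtracted lies in
`I * J` and not merely in `J`; this is the flatness that the fibre arguments need. -/
theorem exists_pow_mul_sub_mem {A : Type*} [CommRing A] [IsDomain A] {n : ℕ}
    (J : Ideal (MvPolynomial (Fin n) A)) (h : A)
    (hh : ∀ d, IsReducible J d →
      ∃ g ∈ J, MonomialOrder.lex.degree g ≤ d ∧ MonomialOrder.lex.leadingCoeff g ∣ h)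
    (I : Ideal A) (f : MvPolynomial (Fin n) A) (hf : ∀ d, f.coeff d ∈ I) :
    ∃ (e : ℕ) (r : MvPolynomial (Fin n) A), (∀ d, r.coeff d ∈ I) ∧
      (∀ d ∈ r.support, ¬ IsReducible J d) ∧ C (h ^ e) * f - r ∈ I.map C * J := by
  classical
  induction hs : MonomialOrder.lex.toSyn (MonomialOrder.lex.degree f) using
    WellFoundedLT.induction generalizing f with
  | _ s ih =>
  subst hs
  by_cases hf0 : f = 0
  · exact ⟨0, 0, by simp, by simp, by simp [hf0]⟩
  set d := MonomialOrder.lex.degree f with hd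
  have hlt : ∀ f' : MvPolynomial (Fin n) A, f' ≠ 0 → f'.coeff d = 0 →
      (∀ b ∈ f'.support, MonomialOrder.lex.toSyn b ≤ MonomialOrder.lex.toSyn d) →
      MonomialOrder.lex.toSyn (MonomialOrder.lex.degree f') < MonomialOrder.lex.toSyn d := by
    intro f' h0 hc hb
    refine lt_of_le_of_ne (hb _ (MonomialOrder.degree_mem_support h0)) fun he => ?_
    have := MonomialOrder.lex.toSyn.injective he
    rw [← this] at hc
    exact MonomialOrder.coeff_degree_ne_zero_iff.mpr h0 hc
  by_cases hred : IsReducible J d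
  · obtain ⟨g, hgJ, hgd, u, hu⟩ := hh d hred
    set c := f.coeff d with hc
    -- Since `h` is `u` times the leading coefficient of `g`, the leading terms of `C h * f` and `q
    -- * g` cancel.
    set q := monomial (d - MonomialOrder.lex.degree g) (u * c) with hq
    set f' := C h * f - q * g with hf'
    have hqI : q ∈ I.map C := by
      rw [hq, ← mul_one (u * c), ← C_mul_monomial]
      exact Ideal.mul_mem_right _ _ (Ideal.mem_map_of_mem _ (I.mul_mem_left _ (hf d)))
    have hcoef : ∀ b, f'.coeff b ∈ I := by
      rw [← mem_map_C_iff]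
      refine Ideal.sub_mem _ (Ideal.mul_mem_left _ _ (mem_map_C_iff.mpr hf)) ?_
      exact Ideal.mul_mem_right _ _ hqI
    have key : ∃ (e : ℕ) (r : MvPolynomial (Fin n) A), (∀ d, r.coeff d ∈ I) ∧
      (∀ d ∈ r.support, ¬ IsReducible J d) ∧ C (h ^ e) * f' - r ∈ I.map C * J := by
      by_cases hf'0 : f' = 0
      · exact ⟨0, 0, by simp, by simp, by simp [hf'0]⟩
      refine ih _ (hlt f' hf'0 ?_ ?_) f' hcoef rfl
      · rw [hf', coeff_sub, coeff_C_mul, ← hc, hq, coeff_monomial_mul', if_pos tsub_le_self,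
          tsub_tsub_cancel_of_le hgd]
        change h * c - u * c * MonomialOrder.lex.leadingCoeff g = 0
        rw [hu]; ring
      · intro b hb
        by_contra hcon
        rw [not_le] at hcon
        rw [mem_support_iff] at hb
        apply hb
        rw [hf', coeff_sub, coeff_C_mul, MonomialOrder.coeff_eq_zero_of_lt hcon, hq,
          coeff_monomial_mul']
        split_ifs with hle
        · rw [MonomialOrder.coeff_eq_zero_of_lt (m := MonomialOrder.lex) (f := g), mul_zero, mul_zero, sub_zero]
          rw [← add_lt_add_iff_left (MonomialOrder.lex.toSyn (d - MonomialOrder.lex.degree g)),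
            ← map_add, ← map_add, tsub_add_cancel_of_le hgd, add_comm, tsub_add_cancel_of_le hle]
          exact hcon
        · simp
    obtain ⟨e, r, hr1, hr2, hr3⟩ := key
    refine ⟨e + 1, r, hr1, hr2, ?_⟩
    have : C (h ^ (e + 1)) * f - r = (C (h ^ e) * f' - r) + C (h ^ e) * (q * g) := by
      rw [hf', pow_succ, C_mul]; ring
    rw [this]
    exact add_mem hr3 (Ideal.mul_mem_left _ _ (Ideal.mul_mem_mul hqI hgJ))
  · set f' := f - monomial d (f.coeff d) with hf'
    have hcoef : ∀ b, f'.coeff b ∈ I := by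
      intro b
      rw [hf', coeff_sub, coeff_monomial]
      split_ifs
      · exact I.sub_mem (hf _) (hf _)
      · simpa using hf b
    have key : ∃ (e : ℕ) (r : MvPolynomial (Fin n) A), (∀ d, r.coeff d ∈ I) ∧
      (∀ d ∈ r.support, ¬ IsReducible J d) ∧ C (h ^ e) * f' - r ∈ I.map C * J := by
      by_cases hf'0 : f' = 0
      · exact ⟨0, 0, by simp, by simp, by simp [hf'0]⟩
      refine ih _ (hlt f' hf'0 ?_ ?_) f' hcoef rfl
      · simp [hf']
      · intro b hb
        by_contra hcon
        rw [not_le] at hcon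
        rw [mem_support_iff] at hb
        apply hb
        have hne : d ≠ b := by rintro rfl; exact lt_irrefl _ hcon
        rw [hf', coeff_sub, MonomialOrder.coeff_eq_zero_of_lt hcon, coeff_monomial, if_neg hne,
          sub_zero]
    obtain ⟨e, r, hr1, hr2, hr3⟩ := key
    refine ⟨e, r + C (h ^ e) * monomial d (f.coeff d), ?_, ?_, ?_⟩
    · intro b
      rw [coeff_add, coeff_C_mul, coeff_monomial]
      refine I.add_mem (hr1 b) (I.mul_mem_left _ ?_)
      split_ifs
      · exact hf d
      · exact I.zero_mem
    · intro b hb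
      rcases Finset.mem_union.mp (support_add hb) with hb | hb
      · exact hr2 b hb
      · rw [C_mul_monomial] at hb
        rw [Finset.mem_singleton.mp (support_monomial_subset hb)]
        exact hred
    · have : C (h ^ e) * f - (r + C (h ^ e) * monomial d (f.coeff d)) = C (h ^ e) * f' - r := by
        rw [hf']; ring
      rw [this]
      exact hr3

theorem mem_of_pow_mul_mem {A : Type*} [CommRing A] {B : Type*} [CommRing B] [Algebra A B]
    (m : Ideal A) [hm : m.IsMaximal] {h : A} (hh : h ∉ m) {e : ℕ} {b : B}
    (hb : algebraMap A B (h ^ e) * b ∈ m.map (algebraMap A B)) :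
    b ∈ m.map (algebraMap A B) := by
  have h1 : h ^ e ∉ m := fun h2 => hh (hm.isPrime.mem_of_pow_mem e h2)
  obtain ⟨y, i, hi, hy⟩ := hm.exists_inv h1
  have : b = algebraMap A B y * (algebraMap A B (h ^ e) * b) + algebraMap A B i * b := by
    rw [← mul_assoc, ← map_mul, ← add_mul, ← map_add, hy, map_one, one_mul]
  rw [this]
  exact add_mem (Ideal.mul_mem_left _ _ hb)
    (Ideal.mul_mem_right _ _ (Ideal.mem_map_of_mem _ hi))

theorem map_algebraMap_eq_map {A B : Type*} [CommRing A] [CommRing B] [Algebra A B] {n : ℕ}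
    (π : MvPolynomial (Fin n) A →ₐ[A] B) (m : Ideal A) :
    m.map (algebraMap A B) = (m.map C).map π.toRingHom := by
  rw [Ideal.map_map]
  congr 1
  ext a
  simp [← MvPolynomial.algebraMap_eq]

theorem algHom_C {A B : Type*} [CommRing A] [CommRing B] [Algebra A B] {n : ℕ}
    (π : MvPolynomial (Fin n) A →ₐ[A] B) (a : A) : π (C a) = algebraMap A B a := by
  rw [← MvPolynomial.algebraMap_eq]
  exact π.commutes a

theorem exists_mem_map_C_eq {A B : Type*} [CommRing A] [CommRing B] [Algebra A B] {n : ℕ}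
    (π : MvPolynomial (Fin n) A →ₐ[A] B) (hπ : Function.Surjective π) (m : Ideal A) (b : B)
    (hb : b ∈ m.map (algebraMap A B)) :
    ∃ f : MvPolynomial (Fin n) A, f ∈ m.map (C : A →+* MvPolynomial (Fin n) A) ∧ π f = b := by
  rw [map_algebraMap_eq_map π] at hb
  exact (Ideal.mem_map_iff_of_surjective π.toRingHom hπ).mp hb

theorem map_mem_map_algebraMap {A B : Type*} [CommRing A] [CommRing B] [Algebra A B] {n : ℕ}
    (π : MvPolynomial (Fin n) A →ₐ[A] B) (m : Ideal A) (f : MvPolynomial (Fin n) A)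
    (hf : f ∈ m.map (C : A →+* MvPolynomial (Fin n) A)) : π f ∈ m.map (algebraMap A B) := by
  rw [map_algebraMap_eq_map π]
  exact Ideal.mem_map_of_mem π.toRingHom hf

/-- Over a general closed point of the base, `G` is not a zero divisor on the fibre. -/
theorem exists_forall_maximal_mem_of_mul_mem {A B : Type*} [CommRing A] [IsDomain A] [CommRing B]
    [IsDomain B] [Algebra A B] {n : ℕ} (π : MvPolynomial (Fin n) A →ₐ[A] B)
    (hπ : Function.Surjective π) (G : B) (hG : G ≠ 0) :
    ∃ h : A, h ≠ 0 ∧ ∀ m : Ideal A, m.IsMaximal → h ∉ m →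
      ∀ b : B, G * b ∈ m.map (algebraMap A B) → b ∈ m.map (algebraMap A B) := by
  classical
  set J : Ideal (MvPolynomial (Fin n) A) := (Ideal.span {G}).comap π.toRingHom
  obtain ⟨h₁, hh₁, H₁⟩ := exists_leadingCoeff_dvd J
  refine ⟨h₁, hh₁, fun m hm hm1 b hb => ?_⟩
  obtain ⟨f, hf, hfb⟩ := exists_mem_map_C_eq π hπ m _ hb
  obtain ⟨e, r, -, hr2, hr3⟩ := exists_pow_mul_sub_mem J h₁ H₁ m f (mem_map_C_iff.mp hf)
  -- The lift `f` of `G * b` lies both in `m` times the polynomial ring and in the preimage `J` of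
  -- `(G)`. Division turns this into membership in the product `m * J`, up to a power of `h₁`;
  -- applying `π` and cancelling `G` leaves an element of `mB`.
  have hfJ : f ∈ J := by
    change π f ∈ Ideal.span {G}
    rw [hfb]
    exact Ideal.mul_mem_right _ _ (Ideal.mem_span_singleton_self G)
  have hrJ : r ∈ J := by
    have h1 := J.sub_mem (J.mul_mem_left (C (h₁ ^ e)) hfJ) (Ideal.mul_le_right hr3)
    rwa [sub_sub_cancel] at h1
  -- A non-zero element of `J` has a reducible leading exponent, and `r` has no reducible exponents.
  have hr0 : r = 0 := by
    by_contra hne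
    exact hr2 _ (MonomialOrder.lex.degree_mem_support hne) ⟨r, hrJ, hne, le_rfl⟩
  rw [hr0, sub_zero] at hr3
  have h2 : ∀ x ∈ m.map (C : A →+* MvPolynomial (Fin n) A) * J,
      ∃ c ∈ m.map (algebraMap A B), π x = G * c := by
    intro x hx
    refine Submodule.mul_induction_on hx ?_ ?_
    · intro x hx y hy
      obtain ⟨c, hc⟩ := Ideal.mem_span_singleton'.mp (show π y ∈ Ideal.span {G} from hy)
      exact ⟨π x * c, Ideal.mul_mem_right _ _ (map_mem_map_algebraMap π m x hx),
        by rw [map_mul, ← hc]; ring⟩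
    · rintro x y ⟨c, hc, hxc⟩ ⟨c', hc', hyc⟩
      exact ⟨c + c', add_mem hc hc', by rw [map_add, hxc, hyc, mul_add]⟩
  obtain ⟨c, hc, hfc⟩ := h2 _ hr3
  rw [map_mul, hfb, algHom_C π, mul_left_comm] at hfc
  have h3 := mul_left_cancel₀ hG hfc
  rw [← h3] at hc
  exact mem_of_pow_mul_mem m hm1 hc

/-- A general closed point of the base has non-empty fibre. -/
theorem exists_forall_maximal_map_ne_top {A B : Type*} [CommRing A] [IsDomain A] [CommRing B]
    [IsDomain B] [Algebra A B] (hinj : Function.Injective (algebraMap A B)) {n : ℕ}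
    (π : MvPolynomial (Fin n) A →ₐ[A] B) (hπ : Function.Surjective π) :
    ∃ h : A, h ≠ 0 ∧ ∀ m : Ideal A, m.IsMaximal → h ∉ m → m.map (algebraMap A B) ≠ ⊤ := by
  classical
  set J₀ : Ideal (MvPolynomial (Fin n) A) := RingHom.ker π.toRingHom
  obtain ⟨h₀, hh₀, H₀⟩ := exists_leadingCoeff_dvd J₀
  refine ⟨h₀, hh₀, fun m hm hm0 htop => ?_⟩
  obtain ⟨f, hf, hf1⟩ := exists_mem_map_C_eq π hπ m 1 (htop ▸ Submodule.mem_top)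
  obtain ⟨e, r, hr1, hr2, hr3⟩ := exists_pow_mul_sub_mem J₀ h₀ H₀ m f (mem_map_C_iff.mp hf)
  -- A witness would be a non-zero constant in the kernel of `π`, against the injectivity of `A →
  -- B`.
  have hnot : ¬ IsReducible J₀ 0 := by
    rintro ⟨g, hg, hg0, hgd⟩
    rw [nonpos_iff_eq_zero] at hgd
    have hgC := MonomialOrder.eq_C_of_degree_eq_zero hgd
    have h1 : π g = 0 := hg
    rw [hgC, algHom_C π, map_eq_zero_iff _ hinj, MonomialOrder.leadingCoeff_eq_zero_iff] at h1
    exact hg0 h1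
  have hmem : C (h₀ ^ e) - r ∈ J₀ := by
    have h1 : π (C (h₀ ^ e) * f - r) = 0 := Ideal.mul_le_right hr3
    change π _ = 0
    rwa [map_sub, map_mul, hf1, mul_one, ← map_sub] at h1
  -- Neither the constant nor `r` has a reducible exponent, but their difference lies in the kernel.
  -- Hence the constant is `r`, whose coefficients lie in `m`, and `h₀` would lie in `m`.
  have h0 : C (h₀ ^ e) - r = 0 := by
    by_contra hne
    have h1 := MonomialOrder.lex.degree_mem_support hne
    have h2 : IsReducible J₀ (MonomialOrder.lex.degree (C (h₀ ^ e) - r)) :=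
      ⟨_, hmem, hne, le_rfl⟩
    rcases Finset.mem_union.mp (support_sub _ _ _ h1) with h3 | h3
    · have h5 := Finset.mem_singleton.mp (support_monomial_subset (show _ ∈ (monomial 0 (h₀ ^ e)).support from h3))
      rw [h5] at h2
      exact hnot h2
    · exact hr2 _ h3 h2
  have h4 := hr1 0
  rw [← sub_eq_zero.mp h0, coeff_C, if_pos rfl] at h4
  exact hm0 (hm.isPrime.mem_of_pow_mem e h4)

theorem exists_ne_zero_forall_maximal {A B : Type*} [CommRing A] [IsDomain A] [CommRing B]
    [IsDomain B] [Algebra A B] (hinj : Function.Injective (algebraMap A B))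
    [Algebra.FiniteType A B] (G : B) (hG : G ≠ 0) :
    ∃ h : A, h ≠ 0 ∧ ∀ m : Ideal A, m.IsMaximal → h ∉ m →
      (∀ b : B, G * b ∈ m.map (algebraMap A B) → b ∈ m.map (algebraMap A B)) ∧
      m.map (algebraMap A B) ≠ ⊤ := by
  obtain ⟨n, π, hπ⟩ := Algebra.FiniteType.iff_quotient_mvPolynomial''.mp
    (inferInstance : Algebra.FiniteType A B)
  obtain ⟨h₀, hh₀, H₀⟩ := exists_forall_maximal_map_ne_top hinj π hπ
  obtain ⟨h₁, hh₁, H₁⟩ := exists_forall_maximal_mem_of_mul_mem π hπ G hG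
  exact ⟨h₀ * h₁, mul_ne_zero hh₀ hh₁, fun m hm hhm =>
    ⟨H₁ m hm fun h => hhm (m.mul_mem_left _ h), H₀ m hm fun h => hhm (m.mul_mem_right _ h)⟩⟩

end GenericFibre

/-! ### Homogeneous polynomials, the Zariski topology and affine cones -/

section Cone

open MvPolynomial

variable {k : Type*} [Field k] {σ : Type*}

theorem aeval_smul_of_isHomogeneous {C : Type*} [CommRing C] [Algebra k C] {F : MvPolynomial σ k}
    {d : ℕ} (hF : F.IsHomogeneous d) (a : C) (v : σ → C) :
    aeval (a • v) F = a ^ d * aeval v F := by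
  rw [aeval_def, eval₂_eq, aeval_def, eval₂_eq, Finset.mul_sum]
  refine Finset.sum_congr rfl fun m hm => ?_
  have h1 : m.degree = d := hF.degree_eq_sum_deg_support hm ▸ rfl
  simp only [Pi.smul_apply, smul_eq_mul, mul_pow, Finset.prod_mul_distrib]
  rw [Finset.prod_pow_eq_pow_sum, mul_left_comm]
  congr 3

theorem eval_smul_of_isHomogeneous {F : MvPolynomial σ k} {d : ℕ} (hF : F.IsHomogeneous d)
    (a : k) (v : σ → k) : eval (a • v) F = a ^ d * eval v F := by
  simpa [aeval_eq_eval] using aeval_smul_of_isHomogeneous hF a v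

theorem eval_smul_ne_zero_iff {F : MvPolynomial σ k} {d : ℕ} (hF : F.IsHomogeneous d)
    {a : k} (ha : a ≠ 0) (v : σ → k) : eval (a • v) F ≠ 0 ↔ eval v F ≠ 0 := by
  rw [eval_smul_of_isHomogeneous hF]
  simp [ha]

theorem eval_rep_mk_ne_zero_iff {F : MvPolynomial σ k} {d : ℕ} (hF : F.IsHomogeneous d)
    (v : σ → k) (hv : v ≠ 0) :
    eval (Projectivization.mk k v hv).rep F ≠ 0 ↔ eval v F ≠ 0 := by
  obtain ⟨a, ha⟩ := Projectivization.exists_smul_eq_mk_rep k v hv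
  rw [← ha]
  exact eval_smul_ne_zero_iff hF a.ne_zero v

/-- As a function of `a`, the value at `a • v` is a polynomial with coefficients `eval v
(homogeneousComponent i F)`, and it has infinitely many roots. -/
theorem eval_homogeneousComponent_eq_zero [Infinite k] {F : MvPolynomial σ k} {v : σ → k}
    (h : ∀ a : k, a ≠ 0 → eval (a • v) F = 0) (d : ℕ) :
    eval v (homogeneousComponent d F) = 0 := by
  let q : Polynomial k := ∑ i ∈ Finset.range (F.totalDegree + 1),
    Polynomial.monomial i (eval v (homogeneousComponent i F))
  have hq : ∀ a : k, a ≠ 0 → q.eval a = 0 := by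
    intro a ha
    have h1 := h a ha
    rw [← sum_homogeneousComponent F, map_sum] at h1
    rw [Polynomial.eval_finsetSum, ← h1]
    refine Finset.sum_congr rfl fun i _ => ?_
    rw [Polynomial.eval_monomial, eval_smul_of_isHomogeneous (homogeneousComponent_isHomogeneous i F),
      mul_comm]
  have hq0 : q = 0 := by
    refine Polynomial.eq_zero_of_infinite_isRoot q ((Set.finite_singleton (0 : k)).infinite_compl.mono ?_)
    intro a ha
    exact hq a ha
  by_cases hd : d ∈ Finset.range (F.totalDegree + 1)
  · have h2 := congrArg (fun q => Polynomial.coeff q d) hq0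
    simp only [q, Polynomial.finsetSum_coeff, Polynomial.coeff_monomial, Polynomial.coeff_zero] at h2
    rwa [Finset.sum_ite_eq' _ d, if_pos hd] at h2
  · rw [homogeneousComponent_eq_zero _ _ (by simpa using hd), map_zero]

theorem eval_eq_zero_of_homogeneousComponent {F : MvPolynomial σ k} {v : σ → k}
    (h : ∀ d, eval v (homogeneousComponent d F) = 0) : eval v F = 0 := by
  rw [← sum_homogeneousComponent F, map_sum]
  exact Finset.sum_eq_zero fun d _ => h d

theorem mem_vanishingIdeal {X : Set (PSpace k σ)} {F : MvPolynomial σ k} :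
    F ∈ vanishingIdeal X ↔ ∀ x ∈ X, ∀ a : k, eval (a • x.rep) F = 0 := Iff.rfl

theorem mem_vanishingIdeal_of_isHomogeneous {X : Set (PSpace k σ)} {F : MvPolynomial σ k} {d : ℕ}
    (hF : F.IsHomogeneous d) : F ∈ vanishingIdeal X ↔ ∀ x ∈ X, eval x.rep F = 0 := by
  refine ⟨fun h x hx => by simpa using h x hx 1, fun h x hx a => ?_⟩
  rw [eval_smul_of_isHomogeneous hF, h x hx, mul_zero]

theorem homogeneousComponent_mem_vanishingIdeal [Infinite k] {X : Set (PSpace k σ)}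
    {F : MvPolynomial σ k} (hF : F ∈ vanishingIdeal X) (d : ℕ) :
    homogeneousComponent d F ∈ vanishingIdeal X :=
  (mem_vanishingIdeal_of_isHomogeneous (homogeneousComponent_isHomogeneous d F)).mpr
    fun x hx => eval_homogeneousComponent_eq_zero (fun a _ => hF x hx a) d

/-! ### The Zariski topology -/

theorem isOpen_setOf_eval_ne_zero {F : MvPolynomial σ k} {d : ℕ} (hF : F.IsHomogeneous d) :
    IsOpen {x : PSpace k σ | eval x.rep F ≠ 0} :=
  TopologicalSpace.isOpen_generateFrom_of_mem ⟨F, d, hF, rfl⟩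

theorem exists_isHomogeneous_of_mem_isOpen {O : Set (PSpace k σ)} (hO : IsOpen O)
    {x : PSpace k σ} (hx : x ∈ O) :
    ∃ (F : MvPolynomial σ k) (d : ℕ), F.IsHomogeneous d ∧ eval x.rep F ≠ 0 ∧
      ∀ z : PSpace k σ, eval z.rep F ≠ 0 → z ∈ O := by
  have hb := TopologicalSpace.isTopologicalBasis_of_subbasis_of_inter
    (α := PSpace k σ) (r := {D | ∃ (F : MvPolynomial σ k) (d : ℕ), F.IsHomogeneous d ∧
      D = {x : PSpace k σ | eval x.rep F ≠ 0}}) rfl (by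
    rintro _ ⟨F, d, hF, rfl⟩ _ ⟨G, e, hG, rfl⟩
    refine ⟨F * G, d + e, hF.mul hG, ?_⟩
    ext x
    simp)
  obtain ⟨V, hV, hxV, hVO⟩ := hb.exists_subset_of_mem_open hx hO
  rcases hV with rfl | ⟨F, d, hF, rfl⟩
  · exact ⟨1, 0, isHomogeneous_one _ _, by simp, fun z _ => hVO trivial⟩
  · exact ⟨F, d, hF, hxV, fun z hz => hVO hz⟩

theorem mem_closure_iff_eval {S : Set (PSpace k σ)} {x : PSpace k σ} :
    x ∈ closure S ↔ ∀ (F : MvPolynomial σ k) (d : ℕ), F.IsHomogeneous d → eval x.rep F ≠ 0 →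
      ∃ s ∈ S, eval s.rep F ≠ 0 := by
  rw [mem_closure_iff]
  constructor
  · intro h F d hF hx
    obtain ⟨s, hs, hsS⟩ := h _ (isOpen_setOf_eval_ne_zero hF) hx
    exact ⟨s, hsS, hs⟩
  · intro h O hO hx
    obtain ⟨F, d, hF, hxF, hFO⟩ := exists_isHomogeneous_of_mem_isOpen hO hx
    obtain ⟨s, hsS, hs⟩ := h F d hF hxF
    exact ⟨s, hFO s hs, hsS⟩

/-! ### The affine cone of a projective variety -/

/-- The affine cone over `X`. -/
def cone (X : Set (PSpace k σ)) : Set (σ → k) := {v | ∀ F ∈ vanishingIdeal X, eval v F = 0}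

theorem rep_mem_cone {X : Set (PSpace k σ)} {x : PSpace k σ} (hx : x ∈ X) : x.rep ∈ cone X :=
  fun F hF => by simpa using hF x hx 1

theorem smul_mem_cone [Infinite k] {X : Set (PSpace k σ)} {v : σ → k} (hv : v ∈ cone X) (a : k) :
    a • v ∈ cone X := fun F hF =>
  eval_eq_zero_of_homogeneousComponent fun d => by
    rw [eval_smul_of_isHomogeneous (homogeneousComponent_isHomogeneous d F),
      hv _ (homogeneousComponent_mem_vanishingIdeal hF d), mul_zero]

theorem IsProjectiveVariety.mk_mem {X : Set (PSpace k σ)} (hX : IsProjectiveVariety X)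
    {v : σ → k} (hv : v ∈ cone X) (hv0 : v ≠ 0) : Projectivization.mk k v hv0 ∈ X := by
  rw [← hX.isClosed.closure_eq, mem_closure_iff_eval]
  intro F d hF hne
  rw [eval_rep_mk_ne_zero_iff hF] at hne
  by_contra! hcon
  exact hne (hv F ((mem_vanishingIdeal_of_isHomogeneous hF).mpr hcon))

attribute [local instance] MvPolynomial.gradedAlgebra in
theorem isPrime_of_homogeneous [Infinite k] (I : Ideal (MvPolynomial σ k))
    (hI : ∀ F ∈ I, ∀ d, homogeneousComponent d F ∈ I) (hne : I ≠ ⊤)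
    (hmul : ∀ (F G : MvPolynomial σ k) (d e : ℕ), F.IsHomogeneous d → G.IsHomogeneous e →
      F * G ∈ I → F ∈ I ∨ G ∈ I) : I.IsPrime := by
  classical
  refine Ideal.IsHomogeneous.isPrime_of_homogeneous_mem_or_mem
    (𝒜 := MvPolynomial.homogeneousSubmodule σ k) (I := I) ?_ hne ?_
  · intro d F hF
    have h1 := hI F hF d
    rw [← MvPolynomial.decomposition.decompose'_apply] at h1
    exact h1
  · rintro F G ⟨d, hd⟩ ⟨e, he⟩ hFG
    exact hmul F G d e hd he hFG

theorem IsProjectiveVariety.isPrime [Infinite k] {X : Set (PSpace k σ)}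
    (hX : IsProjectiveVariety X) : (vanishingIdeal X).IsPrime := by
  refine isPrime_of_homogeneous _ (fun F hF d => homogeneousComponent_mem_vanishingIdeal hF d)
    ?_ ?_
  · intro h
    obtain ⟨x, hx⟩ := hX.isIrreducible.nonempty
    have h1 : (1 : MvPolynomial σ k) ∈ vanishingIdeal X := h ▸ Submodule.mem_top
    simpa using h1 x hx 1
  · intro F G d e hF hG hFG
    rw [mem_vanishingIdeal_of_isHomogeneous (hF.mul hG)] at hFG
    rw [mem_vanishingIdeal_of_isHomogeneous hF, mem_vanishingIdeal_of_isHomogeneous hG]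
    by_contra! hcon
    obtain ⟨⟨x, hx, hxF⟩, y, hy, hyG⟩ := hcon
    obtain ⟨z, hz, hzF, hzG⟩ := hX.isIrreducible.isPreirreducible _ _
      (isOpen_setOf_eval_ne_zero hF) (isOpen_setOf_eval_ne_zero hG) ⟨x, hx, hxF⟩ ⟨y, hy, hyG⟩
    exact mul_ne_zero hzF hzG (by rw [← map_mul]; exact hFG z hz)

/-- A projective variety from a prime ideal which is the ideal of a scaling invariant set `W`. -/
theorem isProjectiveVariety_of_isPrime [Infinite k] (W : Set (σ → k)) (h0 : (0 : σ → k) ∉ W)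
    (hW : ∀ a : k, a ≠ 0 → ∀ v ∈ W, a • v ∈ W) (J : Ideal (MvPolynomial σ k)) [J.IsPrime]
    (hJ : ∀ F, F ∈ J ↔ ∀ v ∈ W, eval v F = 0) :
    vanishingIdeal {x : PSpace k σ | ∀ F ∈ J, eval x.rep F = 0} = J ∧
      IsProjectiveVariety {x : PSpace k σ | ∀ F ∈ J, eval x.rep F = 0} := by
  have hcomp : ∀ F ∈ J, ∀ d, homogeneousComponent d F ∈ J := fun F hF d =>
    (hJ _).mpr fun v hv => eval_homogeneousComponent_eq_zero
      (fun a ha => (hJ F).mp hF _ (hW a ha v hv)) d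
  have hmem : ∀ v (hv : v ∈ W) (hv0 : v ≠ 0),
      Projectivization.mk k v hv0 ∈ {x : PSpace k σ | ∀ F ∈ J, eval x.rep F = 0} := by
    intro v hv hv0 F hF
    obtain ⟨a, ha⟩ := Projectivization.exists_smul_eq_mk_rep k v hv0
    rw [← ha]
    exact (hJ F).mp hF _ (hW a a.ne_zero v hv)
  have hI : vanishingIdeal {x : PSpace k σ | ∀ F ∈ J, eval x.rep F = 0} = J := by
    ext F
    constructor
    · intro hF
      refine (hJ F).mpr fun v hv => ?_
      have hv0 : v ≠ 0 := fun h => h0 (h ▸ hv)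
      obtain ⟨a, ha⟩ := Projectivization.exists_smul_eq_mk_rep k v hv0
      have h1 := hF _ (hmem v hv hv0) ((a⁻¹ : kˣ) : k)
      rw [← ha] at h1
      have h2 : ((a⁻¹ : kˣ) : k) • a • v = v := inv_smul_smul a v
      rwa [h2] at h1
    · intro hF x hx a
      refine eval_eq_zero_of_homogeneousComponent fun d => ?_
      rw [eval_smul_of_isHomogeneous (homogeneousComponent_isHomogeneous d F),
        hx _ (hcomp F hF d), mul_zero]
  refine ⟨hI, ?_, ?_, ?_⟩
  · rw [← isOpen_compl_iff, isOpen_iff_forall_mem_open]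
    intro x hx
    have : ∃ F ∈ J, eval x.rep F ≠ 0 := by simpa using hx
    obtain ⟨F, hF, hne⟩ := this
    have : ∃ d, eval x.rep (homogeneousComponent d F) ≠ 0 := by
      by_contra! hcon
      exact hne (eval_eq_zero_of_homogeneousComponent hcon)
    obtain ⟨d, hd⟩ := this
    refine ⟨_, ?_, isOpen_setOf_eval_ne_zero (homogeneousComponent_isHomogeneous d F), hd⟩
    intro y hy hyX
    exact hy (hyX _ (hcomp F hF d))
  · have : W.Nonempty := by
      by_contra hcon
      rw [Set.not_nonempty_iff_eq_empty] at hcon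
      exact ‹J.IsPrime›.ne_top ((Ideal.eq_top_iff_one J).mpr ((hJ 1).mpr (by simp [hcon])))
    obtain ⟨v, hv⟩ := this
    exact ⟨_, hmem v hv fun h => h0 (h ▸ hv)⟩
  · rintro U V hU hV ⟨x, hx, hxU⟩ ⟨y, hy, hyV⟩
    obtain ⟨F, d, hF, hxF, hFU⟩ := exists_isHomogeneous_of_mem_isOpen hU hxU
    obtain ⟨G, e, hG, hyG, hGV⟩ := exists_isHomogeneous_of_mem_isOpen hV hyV
    have h1 : F ∉ J := fun h => hxF (hx F h)
    have h2 : G ∉ J := fun h => hyG (hy G h)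
    have h3 : F * G ∉ J := fun h => (‹J.IsPrime›.mem_or_mem h).elim h1 h2
    rw [← hI, mem_vanishingIdeal_of_isHomogeneous (hF.mul hG)] at h3
    push Not at h3
    obtain ⟨z, hz, hzFG⟩ := h3
    rw [map_mul] at hzFG
    exact ⟨z, hz, hFU z (left_ne_zero_of_mul hzFG), hGV z (right_ne_zero_of_mul hzFG)⟩

/-! ### Tangent spaces of the cone and dual numbers -/

/-- First-order Taylor expansion. It turns tangent vectors into points with values in the dual
numbers, so that tangent spaces can be handled through homomorphisms. -/
theorem aeval_dualNumber {C : Type*} [CommRing C] [Algebra k C] (v t : σ → C) [Fintype σ]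
    (F : MvPolynomial σ k) :
    aeval (fun i => (TrivSqZeroExt.inl (v i) + TrivSqZeroExt.inr (t i) : DualNumber C)) F =
      TrivSqZeroExt.inl (aeval v F) + TrivSqZeroExt.inr (∑ i, aeval v (pderiv i F) * t i) := by
  classical
  induction F using MvPolynomial.induction_on with
  | C a =>
    ext
    · simp [TrivSqZeroExt.algebraMap_eq_inl']
    · simp [TrivSqZeroExt.algebraMap_eq_inl']
  | add p q hp hq =>
    rw [map_add, hp, hq]
    ext
    · simp
    · simp [add_mul, Finset.sum_add_distrib]
  | mul_X p i hp =>
    rw [map_mul, hp, aeval_X]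
    ext
    · simp
    · simp [pderiv_X, Pi.single_apply, add_mul, Finset.sum_add_distrib, mul_assoc]
      congr 1
      · simp [apply_ite (aeval v), ite_mul]
      · rw [mul_comm, Finset.mul_sum]

/-- The tangent space at `v` of the affine cone over `X`. -/
def coneTangent [Fintype σ] (X : Set (PSpace k σ)) (v : σ → k) : Submodule k (σ → k) where
  carrier := {t | ∀ F ∈ vanishingIdeal X, ∑ i, eval v (pderiv i F) * t i = 0}
  add_mem' := fun {s t} hs ht F hF => by
    simp only [Pi.add_apply, mul_add, Finset.sum_add_distrib, hs F hF, ht F hF, add_zero]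
  zero_mem' := fun F _ => by simp
  smul_mem' := fun c t ht F hF => by
    simp only [Pi.smul_apply, smul_eq_mul, mul_left_comm _ c, ← Finset.mul_sum, ht F hF, mul_zero]

theorem embTangent_eq_coneTangent [Fintype σ] (X : Set (PSpace k σ)) (x : PSpace k σ) :
    embTangent X x = coneTangent X x.rep := rfl

theorem mem_coneTangent_iff_isHomogeneous [Infinite k] [Fintype σ] {X : Set (PSpace k σ)}
    {v t : σ → k} : t ∈ coneTangent X v ↔ ∀ F ∈ vanishingIdeal X, ∀ d, F.IsHomogeneous d →
      ∑ i, eval v (pderiv i F) * t i = 0 := by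
  refine ⟨fun h F hF d _ => h F hF, fun h F hF => ?_⟩
  conv_lhs => rw [← sum_homogeneousComponent F]
  simp only [map_sum, Finset.sum_mul]
  rw [Finset.sum_comm]
  exact Finset.sum_eq_zero fun d _ => h _ (homogeneousComponent_mem_vanishingIdeal hF d) d
    (homogeneousComponent_isHomogeneous d F)

theorem coneTangent_smul [Infinite k] [Fintype σ] (X : Set (PSpace k σ)) (v : σ → k) {a : k}
    (ha : a ≠ 0) : coneTangent X (a • v) = coneTangent X v := by
  ext t
  rw [mem_coneTangent_iff_isHomogeneous, mem_coneTangent_iff_isHomogeneous]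
  refine forall₂_congr fun F hF => forall₂_congr fun d hd => ?_
  simp only [eval_smul_of_isHomogeneous hd.pderiv, mul_assoc]
  rw [← Finset.mul_sum]
  simp [ha]

theorem embTangent_mk [Infinite k] [Fintype σ] (X : Set (PSpace k σ)) (v : σ → k) (hv : v ≠ 0) :
    embTangent X (Projectivization.mk k v hv) = coneTangent X v := by
  obtain ⟨a, ha⟩ := Projectivization.exists_smul_eq_mk_rep k v hv
  rw [embTangent_eq_coneTangent, ← ha]
  exact coneTangent_smul X v a.ne_zero

theorem mem_coneTangent_iff_aeval [Fintype σ] {X : Set (PSpace k σ)} {v t : σ → k}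
    (hv : v ∈ cone X) : t ∈ coneTangent X v ↔ ∀ F ∈ vanishingIdeal X,
      aeval (fun i => (TrivSqZeroExt.inl (v i) + TrivSqZeroExt.inr (t i) : DualNumber k)) F = 0 := by
  refine forall₂_congr fun F hF => ?_
  rw [aeval_dualNumber]
  simp [TrivSqZeroExt.ext_iff, aeval_eq_eval, hv F hF]

end Cone

/-! ### The Zariski tangent space at the generic point -/

section Smoothness

open MvPolynomial Matrix

open scoped IntermediateField.algebraAdjoinAdjoin TensorProduct in
/-- Over a perfect field, the module of differentials of a finitely generated field extension has
the transcendence degree as its dimension. -/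
theorem finrank_kaehlerDifferential {k K : Type*} [Field k] [Field K] [Algebra k K]
    [PerfectField k] [Algebra.EssFiniteType k K] :
    Module.finrank K (Ω[K⁄k]) = Cardinal.toNat (Algebra.trdeg k K) := by
  -- With a separating transcendence basis, `K` is formally étale over a polynomial ring, and the
  -- differentials of `K` are obtained by base change from those of that ring.
  obtain ⟨s, hs, H⟩ := exists_isTranscendenceBasis_and_isSeparable_of_perfectField k K
  have h1 : Algebra.IsSeparable (IntermediateField.adjoin k (Set.range ((↑) : s → K))) K := by
    convert! H <;> simp
  have hcard : Cardinal.toNat (Algebra.trdeg k K) = s.card := by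
    rw [← hs.cardinalMk_eq_trdeg]
    simp
  let A := Algebra.adjoin k (Set.range ((↑) : s → K))
  let L := IntermediateField.adjoin k (Set.range ((↑) : s → K))
  let P := MvPolynomial s k
  let e : P ≃ₐ[k] A := hs.1.aevalEquiv
  let : Algebra P A := e.toRingEquiv.toRingHom.toAlgebra
  let : Algebra P K := ((algebraMap A K).comp (algebraMap P A)).toAlgebra
  have : IsScalarTower P A K := IsScalarTower.of_algebraMap_eq' rfl
  have : IsScalarTower k P A := IsScalarTower.of_algebraMap_eq fun x => (e.commutes x).symm
  have : IsScalarTower k P K := IsScalarTower.to₁₂₄ k P A K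
  have : Algebra.FormallyEtale P A :=
    Algebra.FormallyEtale.of_equiv (R := P) (A := P) (B := A)
      { e.toRingEquiv with commutes' := fun x => rfl }
  have : Algebra.FormallyEtale A L := Algebra.FormallyEtale.of_isLocalization (nonZeroDivisors A)
  have : Algebra.FormallyEtale L K := Algebra.FormallyEtale.of_isSeparable _ K
  have : Algebra.FormallyEtale A K := Algebra.FormallyEtale.comp A L K
  have : Algebra.FormallyEtale P K := Algebra.FormallyEtale.comp P A K
  rw [hcard, ← (KaehlerDifferential.tensorKaehlerEquivOfFormallyEtale k P K).finrank_eq,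
    Module.finrank_baseChange, Module.finrank_eq_card_basis (KaehlerDifferential.mvPolynomialBasis k s)]
  simp

theorem exists_linearIndependent_submatrix_col {K : Type*} [Field K] {m n : Type*} [Fintype m]
    [Fintype n] (A : Matrix m n K) {r : ℕ} (hA : A.rank = r) :
    ∃ b : Fin r → n, LinearIndependent K (A.submatrix id b).col := by
  obtain ⟨κ, a, ha, hspan, hli⟩ := exists_linearIndependent' K A.col
  have : Finite κ := Finite.of_injective a ha
  have : Fintype κ := Fintype.ofFinite κ
  have hcard : Fintype.card κ = r := by
    rw [← finrank_span_eq_card hli, hspan, ← Matrix.rank_eq_finrank_span_cols, hA]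
  let e : Fin r ≃ κ := (Fintype.equivFinOfCardEq hcard).symm
  exact ⟨a ∘ e, hli.comp e e.injective⟩

theorem exists_submatrix_det_ne_zero {K : Type*} [Field K] {m n : Type*} [Fintype m] [Fintype n]
    (A : Matrix m n K) {r : ℕ} (hr : A.rank = r) :
    ∃ (a : Fin r → m) (b : Fin r → n), (A.submatrix a b).det ≠ 0 := by
  classical
  obtain ⟨b, hb⟩ := exists_linearIndependent_submatrix_col A hr
  have h2 : (A.submatrix id b)ᵀ.rank = r := by
    simpa using LinearIndependent.rank_matrix (M := (A.submatrix id b)ᵀ) hb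
  obtain ⟨a, ha⟩ := exists_linearIndependent_submatrix_col _ h2
  refine ⟨a, b, fun h0 => ?_⟩
  have h3 : LinearIndependent K (A.submatrix a b)ᵀ.col := ha
  have hu := Matrix.linearIndependent_cols_iff_isUnit.mp h3
  rw [Matrix.isUnit_iff_isUnit_det, Matrix.det_transpose, h0] at hu
  exact not_isUnit_zero hu

theorem le_rank_of_submatrix_det_ne_zero {K : Type*} [Field K] {m n : Type*} [Fintype m]
    [Fintype n] (A : Matrix m n K) {r : ℕ} (a : Fin r → m) (b : Fin r → n)
    (h : (A.submatrix a b).det ≠ 0) : r ≤ A.rank := by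
  have h1 : (A.submatrix a b).rank = r := by
    rw [Matrix.rank_of_isUnit _ ((Matrix.isUnit_iff_isUnit_det _).mpr (isUnit_iff_ne_zero.mpr h))]
    simp
  have h2 := Matrix.eRank_submatrix_le A a b
  rw [← h1, ← Matrix.eRank_toNat_eq_rank, ← Matrix.eRank_toNat_eq_rank]
  exact ENat.toNat_le_toNat h2 (ne_top_of_le_ne_top (by simp) A.eRank_le_card_width)

theorem derivation_aeval {k : Type*} [Field k] {σ : Type*} [Fintype σ] {K : Type*} [CommRing K]
    [Algebra k K] (D : Derivation k K K) (x : σ → K) (F : MvPolynomial σ k) :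
    D (aeval x F) = ∑ i, aeval x (pderiv i F) * D (x i) := by
  classical
  induction F using MvPolynomial.induction_on with
  | C a => simp
  | add p q hp hq => simp [hp, hq, add_mul, Finset.sum_add_distrib]
  | mul_X p i hp =>
    simp only [map_mul, aeval_X, Derivation.leibniz, hp, smul_eq_mul, map_add, pderiv_X, add_mul,
      Finset.sum_add_distrib, Finset.mul_sum, Pi.single_apply]
    congr 1
    · simp [apply_ite (aeval x), ite_mul]
    · exact Finset.sum_congr rfl fun j _ => by ring

variable {k : Type*} [Field k] {σ : Type*} (I : Ideal (MvPolynomial σ k)) (K : Type*) [Field K]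
  [Algebra (MvPolynomial σ k ⧸ I) K] [Algebra k K] [IsScalarTower k (MvPolynomial σ k ⧸ I) K]

/-- The coordinates of the generic point of the affine variety with prime ideal `I`, whose function
field is `K`. -/
noncomputable def genericPoint (i : σ) : K :=
  algebraMap (MvPolynomial σ k ⧸ I) K (Ideal.Quotient.mk I (X i))

theorem aeval_genericPoint (F : MvPolynomial σ k) :
    aeval (genericPoint I K) F = algebraMap (MvPolynomial σ k ⧸ I) K (Ideal.Quotient.mk I F) := by
  have : aeval (genericPoint I K) = ((IsScalarTower.toAlgHom k (MvPolynomial σ k ⧸ I) K).comp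
      (Ideal.Quotient.mkₐ k I)) := by
    ext i
    simp [genericPoint]
  rw [this]
  rfl

theorem aeval_genericPoint_eq_zero_iff [IsFractionRing (MvPolynomial σ k ⧸ I) K]
    (F : MvPolynomial σ k) : aeval (genericPoint I K) F = 0 ↔ F ∈ I := by
  rw [aeval_genericPoint, map_eq_zero_iff _ (IsFractionRing.injective _ _),
    Ideal.Quotient.eq_zero_iff_mem]

/-- A dual number is a unit if its first component is, so `θ` extends to the fraction field; the
second component of the extension is the derivation. -/
theorem exists_derivation_fractionRing {k : Type*} [Field k] {S : Type*} [CommRing S] [IsDomain S]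
    [Algebra k S] (K : Type*) [Field K] [Algebra S K] [IsFractionRing S K] [Algebra k K]
    [IsScalarTower k S K] (θ : S →ₐ[k] DualNumber K) (hfst : ∀ s, (θ s).fst = algebraMap S K s) :
    ∃ D : Derivation k K K, ∀ s, D (algebraMap S K s) = (θ s).snd := by
  have hunit : ∀ s : nonZeroDivisors S, IsUnit (θ s) := by
    intro s
    rw [TrivSqZeroExt.isUnit_iff_isUnit_fst, hfst]
    exact IsLocalization.map_units K s
  let Θ : K →ₐ[k] DualNumber K := IsLocalization.liftAlgHom (M := nonZeroDivisors S) hunit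
  have hΘ : ∀ s : S, Θ (algebraMap S K s) = θ s := fun s => by
    simp [Θ]
  have hΘfst : ∀ a, (Θ a).fst = a := by
    intro a
    have : (TrivSqZeroExt.fstHom k K K).comp Θ = AlgHom.id k K := by
      refine IsLocalization.algHom_ext (nonZeroDivisors S) ?_
      ext s
      change (Θ (algebraMap S K s)).fst = algebraMap S K s
      rw [hΘ, hfst]
    exact DFunLike.congr_fun this a
  refine ⟨Derivation.mk' ((TrivSqZeroExt.sndHom K K).restrictScalars k ∘ₗ Θ.toLinearMap)
    (fun a b => by simp [hΘfst, mul_comm]), fun s => ?_⟩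
  change (Θ (algebraMap S K s)).snd = _
  rw [hΘ]

/-- The Zariski tangent space at the generic point has the transcendence degree as dimension. -/
theorem finrank_generic_tangent [Fintype σ] [I.IsPrime] [IsFractionRing (MvPolynomial σ k ⧸ I) K]
    [PerfectField k] (T : Submodule K (σ → K))
    (hT : ∀ t, t ∈ T ↔ ∀ F ∈ I, ∑ i, aeval (genericPoint I K) (pderiv i F) * t i = 0) :
    Module.finrank K T = Cardinal.toNat (Algebra.trdeg k K) := by
  classical
  have : Algebra.EssFiniteType (MvPolynomial σ k ⧸ I) K :=
    Algebra.EssFiniteType.of_isLocalization K (nonZeroDivisors _)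
  have hess : Algebra.EssFiniteType k K := Algebra.EssFiniteType.comp k (MvPolynomial σ k ⧸ I) K
  have hx : ∀ i, genericPoint I K i =
    algebraMap (MvPolynomial σ k ⧸ I) K (Ideal.Quotient.mk I (X i)) := fun i => rfl
  generalize hgx : genericPoint I K = x at hT hx
  -- A functional on the differentials is a derivation of `K`; `Ψ` records its values on the generic
  -- coordinates. It is injective because these generate the field, and its image is `T` because a
  -- vector of `T` defines a homomorphism to the dual numbers.
  let Ψ : (Ω[K⁄k] →ₗ[K] K) →ₗ[K] (σ → K) :=
    { toFun := fun f i => f (KaehlerDifferential.D k K (x i))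
      map_add' := fun f g => rfl
      map_smul' := fun a f => rfl }
  have hinj : Function.Injective Ψ := by
    rw [← LinearMap.ker_eq_bot, LinearMap.ker_eq_bot']
    intro f hf
    set D' := f.compDer (KaehlerDifferential.D k K) with hD'
    have h1 : ∀ F : MvPolynomial σ k, D' (aeval x F) = 0 := by
      intro F
      rw [derivation_aeval]
      refine Finset.sum_eq_zero fun i _ => ?_
      have : D' (x i) = 0 := congrFun hf i
      rw [this, mul_zero]
    have h2 : D' = 0 := by
      ext a
      obtain ⟨s, t, ht, rfl⟩ := IsFractionRing.div_surjective (A := MvPolynomial σ k ⧸ I) a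
      obtain ⟨F, rfl⟩ := Ideal.Quotient.mk_surjective s
      obtain ⟨G, rfl⟩ := Ideal.Quotient.mk_surjective t
      rw [Derivation.leibniz_div, ← aeval_genericPoint, ← aeval_genericPoint, hgx, h1, h1]
      simp
    have h3 : (KaehlerDifferential.linearMapEquivDerivation k K) f = 0 := h2
    simpa using h3
  have hrange : LinearMap.range Ψ = T := by
    ext t
    rw [hT]
    constructor
    · rintro ⟨f, rfl⟩ F hF
      have h1 := derivation_aeval (f.compDer (KaehlerDifferential.D k K)) x F
      rw [← hgx, (aeval_genericPoint_eq_zero_iff I K F).mpr hF, map_zero, hgx] at h1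
      exact h1.symm
    · intro ht
      let θ₀ : MvPolynomial σ k →ₐ[k] DualNumber K :=
        aeval (fun i => (TrivSqZeroExt.inl (x i) + TrivSqZeroExt.inr (t i) : DualNumber K))
      have hθ₀ : ∀ F ∈ I, θ₀ F = 0 := fun F hF => by
        simp only [θ₀]
        rw [aeval_dualNumber, ht F hF, ← hgx, (aeval_genericPoint_eq_zero_iff I K F).mpr hF]
        simp
      let θ : (MvPolynomial σ k ⧸ I) →ₐ[k] DualNumber K := Ideal.Quotient.liftₐ I θ₀ hθ₀
      have hfst : ∀ s, (θ s).fst = algebraMap (MvPolynomial σ k ⧸ I) K s := by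
        intro s
        obtain ⟨F, rfl⟩ := Ideal.Quotient.mk_surjective s
        change (θ₀ F).fst = _
        simp only [θ₀]
        rw [aeval_dualNumber, ← aeval_genericPoint, hgx]
        simp
      obtain ⟨D', hD'⟩ := exists_derivation_fractionRing K θ hfst
      refine ⟨D'.liftKaehlerDifferential, ?_⟩
      ext i
      change D'.liftKaehlerDifferential (KaehlerDifferential.D k K (x i)) = t i
      rw [Derivation.liftKaehlerDifferential_comp_D, hx, hD']
      change (θ₀ (X i)).snd = t i
      simp [θ₀]
  rw [← hrange, LinearMap.finrank_range_of_inj hinj]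
  have : Module.finrank K (Ω[K⁄k] →ₗ[K] K) = Module.finrank K (Ω[K⁄k]) :=
    Subspace.dual_finrank_eq
  rw [this, finrank_kaehlerDifferential]

end Smoothness

/-! ### Tangent dimensions on the cone and polynomial frames near smooth points -/

section Semicontinuity

open MvPolynomial Matrix

variable {k : Type*} [Field k]

/-- The subtraction in `dim` does not truncate: the cone contains a line through the origin on which
some coordinate takes every value, so that coordinate is transcendental over `k`. -/
theorem IsProjectiveVariety.trdeg_eq [Infinite k] {σ : Type*} [Finite σ] {X : Set (PSpace k σ)}
    (hX : IsProjectiveVariety X) :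
    Cardinal.toNat (Algebra.trdeg k (MvPolynomial σ k ⧸ vanishingIdeal X)) = dim X + 1 := by
  have := hX.isPrime
  have h1 : Cardinal.toNat (Algebra.trdeg k (MvPolynomial σ k ⧸ vanishingIdeal X)) ≠ 0 := by
    rw [ne_eq, Cardinal.toNat_eq_zero, not_or]
    refine ⟨?_, not_le.mpr trdeg_lt_aleph0_of_finiteType⟩
    refine trdeg_ne_zero_iff.mpr ⟨?_⟩
    obtain ⟨x, hx⟩ := hX.isIrreducible.nonempty
    obtain ⟨i, hi⟩ := Function.ne_iff.mp x.rep_nonzero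
    refine ⟨Ideal.Quotient.mk _ (MvPolynomial.X i), fun ⟨q, hq0, hq⟩ => hq0 ?_⟩
    have h2 : Polynomial.aeval (MvPolynomial.X i) q ∈ vanishingIdeal X := by
      rw [← Ideal.Quotient.eq_zero_iff_mem, ← hq]
      exact (Polynomial.aeval_algHom_apply (Ideal.Quotient.mkₐ k (vanishingIdeal X)) _ q).symm
    refine Polynomial.funext fun a => ?_
    have h3 := h2 x hx (a * (x.rep i)⁻¹)
    rw [← aeval_eq_eval, ← Polynomial.aeval_algHom_apply, aeval_X, Polynomial.coe_aeval_eq_eval,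
      Pi.smul_apply, smul_eq_mul, mul_assoc, inv_mul_cancel₀ hi, mul_one] at h3
    rw [h3, Polynomial.eval_zero]
  rw [dim]
  omega

theorem trdeg_fractionRing {k S : Type*} [Field k] [CommRing S] [IsDomain S] [Algebra k S] :
    Algebra.trdeg k (FractionRing S) = Algebra.trdeg k S := by
  have : Algebra.IsAlgebraic S (FractionRing S) :=
    IsLocalization.isAlgebraic (FractionRing S) (nonZeroDivisors S)
  rw [← trdeg_add_eq k S (A := FractionRing S), trdeg_eq_zero (R := S), add_zero]

theorem exists_finite_homogeneous_generators [Infinite k] {σ : Type*} [Finite σ]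
    (X : Set (PSpace k σ)) : ∃ (s : Finset (MvPolynomial σ k)),
      Ideal.span (s : Set (MvPolynomial σ k)) = vanishingIdeal X ∧
      ∀ F ∈ s, ∃ d, F.IsHomogeneous d := by
  classical
  obtain ⟨s, hs⟩ := IsNoetherian.noetherian (vanishingIdeal X)
  refine ⟨s.biUnion fun F => (Finset.range (F.totalDegree + 1)).image
    fun d => homogeneousComponent d F, le_antisymm ?_ ?_, ?_⟩
  · rw [Ideal.span_le]
    intro G hG
    simp only [Finset.coe_biUnion, Set.mem_iUnion, Finset.coe_image, Set.mem_image] at hG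
    obtain ⟨F, hF, d, -, rfl⟩ := hG
    exact homogeneousComponent_mem_vanishingIdeal (hs ▸ Submodule.subset_span hF) d
  · rw [← hs]
    refine Submodule.span_le.mpr fun F hF => ?_
    rw [← sum_homogeneousComponent F]
    refine Ideal.sum_mem _ fun d hd => Ideal.subset_span ?_
    simp only [Finset.coe_biUnion, Set.mem_iUnion, Finset.coe_image, Set.mem_image]
    exact ⟨F, hF, d, hd, rfl⟩
  · intro G hG
    simp only [Finset.mem_biUnion, Finset.mem_image] at hG
    obtain ⟨F, hF, d, -, rfl⟩ := hG
    exact ⟨d, homogeneousComponent_isHomogeneous d F⟩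

/-- The Jacobian matrix of a finite set of polynomials. -/
noncomputable def jacobian {σ : Type*} (s : Finset (MvPolynomial σ k)) :
    Matrix s σ (MvPolynomial σ k) := Matrix.of fun F i => pderiv i F.1

theorem mem_tangent_iff_jacobian {σ : Type*} [Fintype σ] {C : Type*} [CommRing C] [Algebra k C]
    (s : Finset (MvPolynomial σ k)) (x t : σ → C)
    (hx : ∀ F ∈ s, aeval x F = 0) :
    (∀ F ∈ Ideal.span (s : Set (MvPolynomial σ k)), ∑ i, aeval x (pderiv i F) * t i = 0) ↔
      ((jacobian s).map (aeval x)) *ᵥ t = 0 := by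
  constructor
  · intro h
    ext F
    exact h F.1 (Ideal.subset_span F.2)
  · intro h F hF
    refine Submodule.span_induction
      (p := fun F _ => aeval x F = 0 ∧ ∑ i, aeval x (pderiv i F) * t i = 0) ?_ ?_ ?_ ?_ hF |>.2
    · exact fun F hF => ⟨hx F hF, congrFun h ⟨F, hF⟩⟩
    · simp
    · intro F G _ _ hF hG
      simp [add_mul, Finset.sum_add_distrib, hF, hG]
    · intro a F _ hF
      simp only [smul_eq_mul, map_mul, hF.1, mul_zero, Derivation.leibniz, map_add, zero_mul,
        add_zero, mul_assoc, ← Finset.mul_sum, hF.2, and_self]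

theorem det_submatrix_map {σ m n : Type*} {C : Type*} [CommRing C] [Algebra k C] {r : ℕ}
    (J : Matrix m n (MvPolynomial σ k)) (x : σ → C) (a : Fin r → m) (b : Fin r → n) :
    ((J.map (aeval x)).submatrix a b).det = aeval x (J.submatrix a b).det := by
  rw [← AlgHom.coe_toRingHom, RingHom.map_det]
  rfl

theorem isHomogeneous_det {σ : Type*} {n : Type*} [Fintype n] [DecidableEq n]
    (M : Matrix n n (MvPolynomial σ k)) (e : n → ℕ) (h : ∀ i j, (M i j).IsHomogeneous (e i)) :
    M.det.IsHomogeneous (∑ i, e i) := by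
  rw [← Matrix.det_transpose, Matrix.det_apply]
  refine IsHomogeneous.sum _ _ _ fun τ _ => ?_
  have h1 : (∏ i, Mᵀ (τ i) i).IsHomogeneous (∑ i, e i) :=
    IsHomogeneous.prod _ _ _ fun i _ => h i (τ i)
  rcases Int.units_eq_one_or (Equiv.Perm.sign τ) with h2 | h2
  · rw [h2]; simpa using h1
  · rw [h2]; simpa using h1.neg

/-- The rank `r` is the Jacobian rank at the generic point, known from the tangent space there. A
minor that vanishes at the generic point lies in the ideal of `X` and hence vanishes on the whole
cone, so ranks can only drop; a minor that does not vanish there marks the open set where the rank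
is attained. -/
theorem rank_jacobian_le [PerfectField k] [Infinite k] {σ : Type*} [Fintype σ]
    {X : Set (PSpace k σ)} (hX : IsProjectiveVariety X) :
    ∃ (s : Finset (MvPolynomial σ k)) (r : ℕ),
      Ideal.span (s : Set (MvPolynomial σ k)) = vanishingIdeal X ∧
      (∀ F ∈ s, ∃ d, F.IsHomogeneous d) ∧ r + (dim X + 1) = Fintype.card σ ∧
      (∀ v ∈ cone X, ((jacobian s).map (aeval v)).rank ≤ r) ∧
      ∃ a b, ((jacobian s).submatrix (a : Fin r → s) b).det ∉ vanishingIdeal X := by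
  have := hX.isPrime
  obtain ⟨s, hs, hhom⟩ := exists_finite_homogeneous_generators X
  let K := FractionRing (MvPolynomial σ k ⧸ vanishingIdeal X)
  let x : σ → K := genericPoint (vanishingIdeal X) K
  have hgen : ∀ F, aeval x F = 0 ↔ F ∈ vanishingIdeal X :=
    aeval_genericPoint_eq_zero_iff _ K
  let J := (jacobian s).map (aeval x)
  have h1 : Module.finrank K (LinearMap.ker J.mulVecLin) = dim X + 1 := by
    rw [← hX.trdeg_eq, ← trdeg_fractionRing]
    refine finrank_generic_tangent (vanishingIdeal X) K _ fun t => ?_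
    have h3 := mem_tangent_iff_jacobian s x t fun F hF => (hgen F).mpr
      (hs ▸ Ideal.subset_span hF)
    rw [LinearMap.mem_ker, Matrix.mulVecLin_apply]
    refine h3.symm.trans (forall_congr' fun F => ?_)
    rw [hs]
  have h2 := J.mulVecLin.finrank_range_add_finrank_ker
  rw [h1, Module.finrank_fintype_fun_eq_card] at h2
  refine ⟨s, J.rank, hs, hhom, h2, fun v hv => ?_, ?_⟩
  · obtain ⟨a, b, hab⟩ := exists_submatrix_det_ne_zero ((jacobian s).map (aeval v)) rfl
    refine le_rank_of_submatrix_det_ne_zero J a b fun h => hab ?_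
    rw [det_submatrix_map, hgen] at h
    rw [det_submatrix_map]
    exact hv _ h
  · obtain ⟨a, b, hab⟩ := exists_submatrix_det_ne_zero J rfl
    rw [det_submatrix_map, ne_eq, hgen] at hab
    exact ⟨a, b, hab⟩

theorem mem_coneTangent_iff_jacobian {σ : Type*} [Fintype σ] {X : Set (PSpace k σ)}
    (s : Finset (MvPolynomial σ k))
    (hs : Ideal.span (s : Set (MvPolynomial σ k)) = vanishingIdeal X) {v : σ → k} (hv : v ∈ cone X)
    (t : σ → k) : t ∈ coneTangent X v ↔ ((jacobian s).map (aeval v)) *ᵥ t = 0 := by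
  rw [← mem_tangent_iff_jacobian s v t fun F hF => hv F (hs ▸ Ideal.subset_span hF), hs]
  rfl

theorem finrank_coneTangent_add_rank {σ : Type*} [Fintype σ] {X : Set (PSpace k σ)}
    (s : Finset (MvPolynomial σ k))
    (hs : Ideal.span (s : Set (MvPolynomial σ k)) = vanishingIdeal X) {v : σ → k} (hv : v ∈ cone X) :
    ((jacobian s).map (aeval v)).rank + Module.finrank k (coneTangent X v) = Fintype.card σ := by
  have h1 : coneTangent X v = LinearMap.ker ((jacobian s).map (aeval v)).mulVecLin := by
    ext t
    rw [mem_coneTangent_iff_jacobian s hs hv, LinearMap.mem_ker, Matrix.mulVecLin_apply]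
  rw [h1, ← Module.finrank_fintype_fun_eq_card k, Matrix.rank]
  exact LinearMap.finrank_range_add_finrank_ker _

theorem IsProjectiveVariety.le_finrank_coneTangent [PerfectField k] [Infinite k] {σ : Type*}
    [Fintype σ] {X : Set (PSpace k σ)} (hX : IsProjectiveVariety X) {v : σ → k} (hv : v ∈ cone X) :
    dim X + 1 ≤ Module.finrank k (coneTangent X v) := by
  obtain ⟨s, r, hs, -, hr, hle, -⟩ := rank_jacobian_le hX
  have h1 := finrank_coneTangent_add_rank s hs hv
  have h2 := hle v hv
  omega

theorem IsProjectiveVariety.exists_finrank_coneTangent_eq [PerfectField k] [Infinite k] {σ : Type*}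
    [Fintype σ] {X : Set (PSpace k σ)} (hX : IsProjectiveVariety X) :
    ∃ (H : MvPolynomial σ k) (d : ℕ), H.IsHomogeneous d ∧ H ∉ vanishingIdeal X ∧
      ∀ v ∈ cone X, eval v H ≠ 0 → Module.finrank k (coneTangent X v) = dim X + 1 := by
  obtain ⟨s, r, hs, hhom, hr, hle, a, b, hab⟩ := rank_jacobian_le hX
  choose! e he using hhom
  refine ⟨_, _, isHomogeneous_det _ (fun i => e (a i).1 - 1) fun i j => (he _ (a i).2).pderiv,
    hab, fun v hv hne => ?_⟩
  have h1 := finrank_coneTangent_add_rank s hs hv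
  have h2 := hle v hv
  have h3 := le_rank_of_submatrix_det_ne_zero ((jacobian s).map (aeval v)) a b (by
    rw [det_submatrix_map]; exact hne)
  omega

theorem IsProjectiveVariety.smoothLocus_nonempty [PerfectField k] [Infinite k] {σ : Type*}
    [Fintype σ] {X : Set (PSpace k σ)} (hX : IsProjectiveVariety X) : (smoothLocus X).Nonempty := by
  obtain ⟨H, d, hH, hHX, hfin⟩ := hX.exists_finrank_coneTangent_eq
  rw [mem_vanishingIdeal_of_isHomogeneous hH] at hHX
  push Not at hHX
  obtain ⟨x, hx, hne⟩ := hHX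
  exact ⟨x, hx, hfin _ (rep_mem_cone hx) hne⟩

/-- The columns of a non-zero maximal minor of a basis are coordinates that determine the vectors of
`V`. They serve as pivots for the normalized frames. -/
theorem exists_orderEmbedding_injOn {n N : ℕ} (V : Submodule k (Fin (N + 1) → k))
    (hV : Module.finrank k V = n + 1) :
    ∃ c : Fin (n + 1) ↪o Fin (N + 1), ∀ t ∈ V, (∀ i, t (c i) = 0) → t = 0 := by
  let b := Module.finBasisOfFinrankEq k V hV
  let A : Matrix (Fin (n + 1)) (Fin (N + 1)) k := Matrix.of fun i => (b i : Fin (N + 1) → k)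
  have hA : LinearIndependent k A.row :=
    b.linearIndependent.map' V.subtype (Submodule.ker_subtype _)
  obtain ⟨c, hc⟩ := Function.ne_iff.mp (minors_ne_zero A hA)
  refine ⟨c, fun t ht h0 => ?_⟩
  have hsum := b.sum_repr ⟨t, ht⟩
  have h1 : (fun i => b.repr ⟨t, ht⟩ i) ᵥ* (A.submatrix id c) = 0 := by
    ext j
    have h2 := congrFun (congrArg Subtype.val hsum) (c j)
    simp only [AddSubmonoidClass.coe_finsetSum, SetLike.val_smul, Finset.sum_apply, Pi.smul_apply,
      smul_eq_mul, h0 j] at h2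
    exact h2
  have h2 := Matrix.eq_zero_of_vecMul_eq_zero hc h1
  have h3 : b.repr ⟨t, ht⟩ = 0 := by
    ext i
    exact congrFun h2 i
  have h4 : (⟨t, ht⟩ : V) = 0 := by simpa using h3
  exact congrArg Subtype.val h4

/-- Near a smooth point, the embedded tangent spaces have bases that are given by homogeneous
polynomials of one common degree, and that are a multiple of the identity matrix in suitable
columns. -/
theorem IsProjectiveVariety.exists_polynomial_frame [PerfectField k] [Infinite k] {N : ℕ}
    {X : Set (PSpace k (Fin (N + 1)))} (hX : IsProjectiveVariety X) {x₀ : PSpace k (Fin (N + 1))}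
    (hx₀ : x₀ ∈ smoothLocus X) :
    ∃ (c : Fin (dim X + 1) ↪o Fin (N + 1))
      (K : Matrix (Fin (dim X + 1)) (Fin (N + 1)) (MvPolynomial (Fin (N + 1)) k))
      (δ : MvPolynomial (Fin (N + 1)) k) (e : ℕ), δ.IsHomogeneous e ∧
      (∀ i j, (K i j).IsHomogeneous e) ∧ eval x₀.rep δ ≠ 0 ∧
      (∀ i j, K i (c j) = if i = j then δ else 0) ∧
      ∀ v ∈ cone X, eval v δ ≠ 0 →
        coneTangent X v = Submodule.span k (Set.range fun i j => eval v (K i j)) ∧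
        Module.finrank k (coneTangent X v) = dim X + 1 := by
  classical
  obtain ⟨s, r, hs, hhom, hr, hle, -⟩ := rank_jacobian_le hX
  choose! w hw using hhom
  have hv₀ := rep_mem_cone hx₀.1
  have hfin₀ : Module.finrank k (coneTangent X x₀.rep) = dim X + 1 := hx₀.2
  have hrank₀ : ((jacobian s).map (aeval x₀.rep)).rank = r := by
    have := finrank_coneTangent_add_rank s hs hv₀
    omega
  obtain ⟨a, b, hab⟩ := exists_submatrix_det_ne_zero _ hrank₀
  obtain ⟨c, hc⟩ := exists_orderEmbedding_injOn (coneTangent X x₀.rep) hfin₀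
  have hcard : r + (dim X + 1) = N + 1 := by simpa using hr
  let q : Fin r ⊕ Fin (dim X + 1) ≃ Fin (N + 1) := finSumFinEquiv.trans (finCongr hcard)
  let R : Fin r ⊕ Fin (dim X + 1) → Fin (N + 1) → MvPolynomial (Fin (N + 1)) k :=
    Sum.elim (fun i => jacobian s (a i)) (fun i => Pi.single (c i) 1)
  -- A square matrix made of `r` Jacobian rows that are independent at `x₀` and the unit rows that
  -- read off the pivot coordinates `c`. Its determinant is the denominator `δ`; the adjugate
  -- columns belonging to the unit rows satisfy the chosen Jacobian equations and are `δ` times the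
  -- identity on the pivots.
  let M : Matrix (Fin (N + 1)) (Fin (N + 1)) (MvPolynomial (Fin (N + 1)) k) :=
    Matrix.of fun i => R (q.symm i)
  let u : Fin (N + 1) → ℕ := fun i => Sum.elim (fun i => w (a i).1 - 1) (fun _ => 0) (q.symm i)
  have hsingle : ∀ (i j : Fin (N + 1)) (d : ℕ), d = 0 →
      (Pi.single (M := fun _ => MvPolynomial (Fin (N + 1)) k) i 1 j).IsHomogeneous d := by
    rintro i j d rfl
    rw [Pi.single_apply]
    split_ifs
    · exact isHomogeneous_one _ _
    · exact isHomogeneous_zero _ _ _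
  have hMhom : ∀ i j, (M i j).IsHomogeneous (u i) := by
    intro i j
    change (R (q.symm i) j).IsHomogeneous (Sum.elim _ _ (q.symm i))
    rcases q.symm i with i | i
    · exact (hw _ (a i).2).pderiv
    · exact hsingle _ _ _ rfl
  let K : Matrix (Fin (dim X + 1)) (Fin (N + 1)) (MvPolynomial (Fin (N + 1)) k) :=
    Matrix.of fun i j => M.adjugate j (q (Sum.inr i))
  have hMK : ∀ (z : Fin r ⊕ Fin (dim X + 1)) (i), ∑ j, R z j * K i j =
      if z = Sum.inr i then M.det else 0 := by
    intro z i
    have h1 := congrFun (congrFun (Matrix.mul_adjugate M) (q z)) (q (Sum.inr i))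
    rw [Matrix.mul_apply, Matrix.smul_apply, Matrix.one_apply] at h1
    simp only [q.injective.eq_iff, smul_eq_mul, mul_ite, mul_one, mul_zero] at h1
    rw [← h1]
    refine Finset.sum_congr rfl fun j _ => ?_
    simp [M, K]
  have hKM : ∀ (v t : Fin (N + 1) → k), (∀ i, ∑ j, eval v (R (Sum.inl i) j) * t j = 0) →
      eval v M.det • t = ∑ i, t (c i) • fun j => eval v (K i j) := by
    intro v t ht
    have h1 : (M.map (eval v)) *ᵥ t = fun z => Sum.elim (fun _ => (0 : k)) (fun i => t (c i)) (q.symm z) := by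
      ext z
      change ∑ j, eval v (R (q.symm z) j) * t j = _
      rcases q.symm z with i | i
      · exact ht i
      · simp [R, Pi.single_apply, apply_ite (eval v)]
    have h2 : (M.map (eval v)).adjugate = M.adjugate.map (eval v) := by
      exact (RingHom.map_adjugate (eval v) M).symm
    have h3 : (M.map (eval v)).det = eval v M.det := (RingHom.map_det (eval v) M).symm
    have h4 : (M.map (eval v)).adjugate *ᵥ ((M.map (eval v)) *ᵥ t) = eval v M.det • t := by
      rw [Matrix.mulVec_mulVec, Matrix.adjugate_mul, h3, Matrix.smul_mulVec, Matrix.one_mulVec]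
    rw [← h4, h1, h2]
    ext j
    simp only [Matrix.mulVec, dotProduct, Matrix.map_apply, Finset.sum_apply, Pi.smul_apply,
      smul_eq_mul]
    rw [← q.sum_comp, Fintype.sum_sum_type]
    simp [K, mul_comm]
  refine ⟨c, K, M.det, ∑ i, u i, isHomogeneous_det M u hMhom, ?_, ?_, ?_, ?_⟩
  · intro i j
    change (M.adjugate j (q (Sum.inr i))).IsHomogeneous _
    -- An adjugate entry is the determinant with a unit row, of degree zero, replaced by another
    -- unit vector; it therefore has the same degree as `M.det`.
    rw [Matrix.adjugate_apply]
    refine isHomogeneous_det _ u fun z l => ?_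
    rw [Matrix.updateRow_apply]
    split_ifs with h
    · exact hsingle _ _ _ (by simp [u, h])
    · exact hMhom z l
  · intro h0
    have h1 : (M.map (eval x₀.rep)).det = 0 := by
      rw [← h0]; exact (RingHom.map_det (eval x₀.rep) M).symm
    obtain ⟨t, ht0, ht⟩ := Matrix.exists_mulVec_eq_zero_iff.mpr h1
    apply ht0
    have h2 : ∀ z, ∑ j, eval x₀.rep (R z j) * t j = 0 := by
      intro z
      have := congrFun ht (q z)
      simpa [M, Matrix.mulVec, dotProduct] using this
    refine hc t ?_ fun i => ?_
    · rw [mem_coneTangent_iff_jacobian s hs hv₀]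
      -- The chosen rows already have the full rank of the Jacobian at `x₀`, so they have the same
      -- kernel, the tangent space. A vector killed by `M` is then tangent with all pivot
      -- coordinates zero.
      have h3 : LinearMap.ker ((jacobian s).map (aeval x₀.rep)).mulVecLin ≤
          LinearMap.ker (((jacobian s).map (aeval x₀.rep)).submatrix a id).mulVecLin := by
        intro y hy
        rw [LinearMap.mem_ker, Matrix.mulVecLin_apply] at hy ⊢
        ext i
        exact congrFun hy (a i)
      have h4 : r ≤ (((jacobian s).map (aeval x₀.rep)).submatrix a id).rank :=
        le_rank_of_submatrix_det_ne_zero _ id b hab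
      have h5 := LinearMap.finrank_range_add_finrank_ker
        (((jacobian s).map (aeval x₀.rep)).submatrix a id).mulVecLin
      have h6 := LinearMap.finrank_range_add_finrank_ker
        ((jacobian s).map (aeval x₀.rep)).mulVecLin
      rw [Module.finrank_fintype_fun_eq_card] at h5 h6
      change ((jacobian s).map (aeval x₀.rep)).rank + _ = _ at h6
      change (((jacobian s).map (aeval x₀.rep)).submatrix a id).rank + _ = _ at h5
      have h7 := Submodule.eq_of_le_of_finrank_le h3 (by omega)
      have h8 : t ∈ LinearMap.ker ((jacobian s).map (aeval x₀.rep)).mulVecLin := by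
        rw [h7, LinearMap.mem_ker, Matrix.mulVecLin_apply]
        ext i
        exact h2 (Sum.inl i)
      simpa using h8
    · have := h2 (Sum.inr i)
      simpa [R, Pi.single_apply, apply_ite (eval x₀.rep)] using this
  · intro i j
    have := hMK (Sum.inr j) i
    simpa [R, Pi.single_apply, eq_comm] using this
  · intro v hv hne
    -- The frame spans at most `dim X + 1` dimensions and contains the tangent space, which has at
    -- least that dimension by semicontinuity.
    have h1 : coneTangent X v ≤ Submodule.span k (Set.range fun i j => eval v (K i j)) := by
      intro t ht
      rw [mem_coneTangent_iff_jacobian s hs hv] at ht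
      have h2 := hKM v t fun i => congrFun ht (a i)
      have h3 : t = (eval v M.det)⁻¹ • ∑ i, t (c i) • fun j => eval v (K i j) := by
        rw [← h2, inv_smul_smul₀ hne]
      rw [h3]
      exact Submodule.smul_mem _ _ (Submodule.sum_mem _ fun i _ =>
        Submodule.smul_mem _ _ (Submodule.subset_span ⟨i, rfl⟩))
    have h2 : Module.finrank k (Submodule.span k (Set.range fun i j => eval v (K i j))) ≤
        dim X + 1 := by
      have := finrank_range_le_card (R := k) (fun i j => eval v (K i j))
      rwa [Fintype.card_fin] at this
    have h3 := hX.le_finrank_coneTangent hv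
    have h4 := Submodule.eq_of_le_of_finrank_le h1 (h2.trans h3)
    exact ⟨h4, le_antisymm (h4 ▸ h2) h3⟩

end Semicontinuity

/-! ### Plücker coordinates and the regularity of the Gauss map -/

section Plucker

open MvPolynomial Matrix

variable {k : Type*} [Field k]

/-- Two bases of `V` differ by a square matrix `g`, which multiplies all maximal minors by `g.det`.
-/
theorem plucker_eq_mk {n N : ℕ} (V : Gr k n N) (A : Matrix (Fin (n + 1)) (Fin (N + 1)) k)
    (hA : Submodule.span k (Set.range A) = V.1) :
    ∃ h : minors A ≠ 0, plucker V = Projectivization.mk k (minors A) h := by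
  have hli : LinearIndependent k A.row := by
    rw [linearIndependent_iff_card_eq_finrank_span, Set.finrank, Fintype.card_fin]
    exact (hA ▸ V.2 : Module.finrank k (Submodule.span k (Set.range A)) = n + 1).symm
  have h0 := minors_ne_zero A hli
  refine ⟨h0, ?_⟩
  set b := Module.finBasisOfFinrankEq k V.1 V.2 with hb
  have hmem : ∀ i, A i ∈ V.1 := fun i => hA ▸ Submodule.subset_span ⟨i, rfl⟩
  let g : Matrix (Fin (n + 1)) (Fin (n + 1)) k := Matrix.of fun i j => b.repr ⟨A i, hmem i⟩ j
  have hg : A = g * Matrix.of fun i => (b i : Fin (N + 1) → k) := by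
    ext i j
    have h2 := congrFun (congrArg Subtype.val (b.sum_repr ⟨A i, hmem i⟩)) j
    simp only [AddSubmonoidClass.coe_finsetSum, SetLike.val_smul, Finset.sum_apply, Pi.smul_apply,
      smul_eq_mul] at h2
    rw [← h2]
    rfl
  have hmin : minors A = g.det • minors (Matrix.of fun i => (b i : Fin (N + 1) → k)) := by
    ext s
    rw [Pi.smul_apply, smul_eq_mul, minors, minors, ← Matrix.det_mul]
    congr 1
    nth_rewrite 1 [hg]
    rfl
  rw [plucker, Projectivization.mk_eq_mk_iff']
  refine ⟨g.det⁻¹, ?_⟩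
  rw [hmin, inv_smul_smul₀]
  intro hdet
  rw [hdet, zero_smul] at hmin
  exact h0 hmin

/-- A choice of columns either has a repetition, and the minor is zero, or is a permutation of an
increasing choice, which changes the minor by a sign. -/
theorem det_submatrix_eq_of_forall_orderEmbedding {C : Type*} [CommRing C] {m M : ℕ}
    {A A' : Matrix (Fin m) (Fin M) C}
    (h : ∀ s : Fin m ↪o Fin M, (A.submatrix id s).det = (A'.submatrix id s).det)
    (f : Fin m → Fin M) : (A.submatrix id f).det = (A'.submatrix id f).det := by
  classical
  by_cases hf : Function.Injective f
  · have hcard : (Finset.univ.image f).card = m := by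
      rw [Finset.card_image_of_injective _ hf, Finset.card_univ, Fintype.card_fin]
    let s := (Finset.univ.image f).orderEmbOfFin hcard
    have hs : ∀ i, ∃ j, s j = f i := fun i => by
      have : f i ∈ Set.range s := by
        rw [Finset.range_orderEmbOfFin]
        simp
      exact this
    choose τ hτ using hs
    have hτi : Function.Injective τ := fun i j hij => hf (by rw [← hτ, ← hτ, hij])
    let τ' : Equiv.Perm (Fin m) := Equiv.ofBijective τ (Finite.injective_iff_bijective.mp hτi)
    have key : ∀ B : Matrix (Fin m) (Fin M) C,
        (B.submatrix id f).det = Equiv.Perm.sign τ' * (B.submatrix id s).det := by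
      intro B
      rw [← Matrix.det_permute']
      congr 1
      ext i j
      simp [τ', hτ]
    rw [key, key, h s]
  · obtain ⟨i, j, hij, hne⟩ : ∃ i j, f i = f j ∧ i ≠ j := by
      simpa [Function.Injective] using hf
    rw [Matrix.det_zero_of_column_eq hne fun l => by simp [hij],
      Matrix.det_zero_of_column_eq hne fun l => by simp [hij]]

/-- A matrix that contains the identity matrix is determined by its maximal minors. -/
theorem eq_of_minors_eq {C : Type*} [CommRing C] {m M : ℕ} {A A' : Matrix (Fin m) (Fin M) C}
    (c : Fin m → Fin M) (hA : A.submatrix id c = 1) (hA' : A'.submatrix id c = 1)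
    (h : ∀ s : Fin m ↪o Fin M, (A.submatrix id s).det = (A'.submatrix id s).det) : A = A' := by
  classical
  -- Cramer's rule for the identity block: replacing its column `i` by column `j` of the matrix
  -- gives a minor equal to the entry at `(i, j)`.
  have key : ∀ (B : Matrix (Fin m) (Fin M) C) (_ : B.submatrix id c = 1) (i j),
      B i j = (B.submatrix id (Function.update c i j)).det := by
    intro B hB i j
    have h1 : B.submatrix id (Function.update c i j) =
        (1 : Matrix (Fin m) (Fin m) C).updateCol i (fun l => B l j) := by
      ext l l'
      rw [Matrix.updateCol_apply, ← hB]
      by_cases hl : l' = i <;> simp [hl]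
    rw [h1, ← Matrix.cramer_apply, Matrix.cramer_one]
    simp
  ext i j
  rw [key A hA, key A' hA', det_submatrix_eq_of_forall_orderEmbedding h]

variable [Infinite k] {N : ℕ} {X : Set (PSpace k (Fin (N + 1)))}

theorem gaussMap_eq_mk (hX : IsProjectiveVariety X) {v : Fin (N + 1) → k} (hv : v ∈ cone X)
    (hv0 : v ≠ 0) (A : Matrix (Fin (dim X + 1)) (Fin (N + 1)) k)
    (hA : coneTangent X v = Submodule.span k (Set.range A))
    (hfin : Module.finrank k (coneTangent X v) = dim X + 1) :
    ∃ (hs : Projectivization.mk k v hv0 ∈ smoothLocus X) (h : minors A ≠ 0),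
      gaussMap X ⟨_, hs⟩ = Projectivization.mk k (minors A) h := by
  have h1 := embTangent_mk X v hv0
  refine ⟨⟨hX.mk_mem hv hv0, by rw [h1, hfin]⟩, ?_⟩
  exact plucker_eq_mk _ A (hA.symm.trans h1.symm)

theorem IsProjectiveVariety.exists_isLocalRep_gaussMap [PerfectField k]
    (hX : IsProjectiveVariety X) (x : smoothLocus X) : ∃ P, IsLocalRep (gaussMap X) x P := by
  obtain ⟨c, K, δ, e, hδ, hK, hne, hc, hT⟩ := hX.exists_polynomial_frame x.2
  have hminor : ∀ (v : Fin (N + 1) → k) (s : Fin (dim X + 1) ↪o Fin (N + 1)),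
      eval v (K.submatrix id s).det = minors (K.map (eval v)) s := by
    intro v s
    rw [RingHom.map_det]
    rfl
  have hP : ∀ v : Fin (N + 1) → k, (fun s : Fin (dim X + 1) ↪o Fin (N + 1) =>
      eval v (δ * (K.submatrix id s).det)) = eval v δ • minors (K.map (eval v)) := by
    intro v
    ext s
    rw [map_mul, hminor]
    rfl
  have hgauss : ∀ u : smoothLocus X, eval u.1.rep δ ≠ 0 →
      ∃ h : minors (K.map (eval u.1.rep)) ≠ 0,
        gaussMap X u = Projectivization.mk k (minors (K.map (eval u.1.rep))) h := by
    intro u hu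
    obtain ⟨h1, h2⟩ := hT _ (rep_mem_cone u.2.1) hu
    exact plucker_eq_mk _ (K.map (eval u.1.rep)) h1.symm
  -- The factor `δ` makes the representation vanish wherever the frame may fail to span the tangent
  -- space, so the formula is valid at every smooth point where the polynomials do not all vanish.
  refine ⟨fun s => δ * (K.submatrix id s).det, ⟨⟨e + ∑ _i : Fin (dim X + 1), e, fun s =>
    hδ.mul (isHomogeneous_det _ _ fun i j => hK _ _)⟩, ?_, fun u h => ?_⟩⟩
  · rw [hP]
    exact smul_ne_zero hne (hgauss x hne).1
  · have hu : eval u.1.rep δ ≠ 0 := by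
      intro h0
      rw [hP, h0, zero_smul] at h
      exact h rfl
    obtain ⟨h1, h2⟩ := hgauss u hu
    rw [h2, Projectivization.mk_eq_mk_iff']
    exact ⟨(eval u.1.rep δ)⁻¹, by rw [hP, inv_smul_smul₀ hu]⟩

end Plucker

/-! ### Affine charts of the cone and their points -/

section AffineChart

open MvPolynomial

variable {k : Type*} [Field k]

/-- The Nullstellensatz: the residue field of a maximal ideal above `I` is finite over `k`, hence
equal to it. -/
theorem exists_algHom_of_ne_top [IsAlgClosed k] {B : Type*} [CommRing B] [Algebra k B]
    [Algebra.FiniteType k B] (I : Ideal B) (hI : I ≠ ⊤) : ∃ χ : B →ₐ[k] k, ∀ b ∈ I, χ b = 0 := by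
  obtain ⟨M, hM, hIM⟩ := Ideal.exists_le_maximal I hI
  let : Field (B ⧸ M) := Ideal.Quotient.field M
  have : Algebra.FiniteType k (B ⧸ M) := inferInstance
  have : Module.Finite k (B ⧸ M) := finite_of_finite_type_of_isJacobsonRing k (B ⧸ M)
  let e : k ≃ₐ[k] (B ⧸ M) := AlgEquiv.ofBijective (Algebra.ofId k (B ⧸ M))
    (IsAlgClosed.algebraMap_bijective_of_isIntegral (k := k) (K := B ⧸ M))
  refine ⟨e.symm.toAlgHom.comp (Ideal.Quotient.mkₐ k M), fun b hb => ?_⟩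
  have : Ideal.Quotient.mk M b = 0 := Ideal.Quotient.eq_zero_iff_mem.mpr (hIM hb)
  simp [this]

/-- The ring `B` is the coordinate ring of the open subset `G ≠ 0` of the affine cone over `X`. -/
structure IsAffineChart {σ : Type*} (X : Set (PSpace k σ)) (G : MvPolynomial σ k) {B : Type*}
    [CommRing B] [Algebra k B] (π : MvPolynomial σ k →ₐ[k] B) : Prop where
  isHomogeneous : ∃ d, 0 < d ∧ G.IsHomogeneous d
  map_eq_zero_iff : ∀ F, π F = 0 ↔ F ∈ vanishingIdeal X
  isUnit : IsUnit (π G)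
  exists_eq : ∀ b, ∃ (e : ℕ) (F : MvPolynomial σ k), π G ^ e * b = π F

/-- The point of affine space that corresponds to a `k`-point of an affine chart. -/
noncomputable def chartPoint {σ B : Type*} [CommRing B] [Algebra k B] (π : MvPolynomial σ k →ₐ[k] B)
    (χ : B →ₐ[k] k) (i : σ) : k := χ (π (X i))

theorem eval_chartPoint {σ B : Type*} [CommRing B] [Algebra k B] (π : MvPolynomial σ k →ₐ[k] B)
    (χ : B →ₐ[k] k) (F : MvPolynomial σ k) : eval (chartPoint π χ) F = χ (π F) := by
  have : aeval (chartPoint π χ) = χ.comp π := by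
    ext i
    simp [chartPoint]
  rw [← aeval_eq_eval, this]
  rfl

namespace IsAffineChart

variable {σ : Type*} {X : Set (PSpace k σ)} {G : MvPolynomial σ k} {B : Type*} [CommRing B]
  [Algebra k B] {π : MvPolynomial σ k →ₐ[k] B}

theorem chartPoint_mem_cone (h : IsAffineChart X G π) (χ : B →ₐ[k] k) :
    chartPoint π χ ∈ cone X := fun F hF => by
  rw [eval_chartPoint, (h.map_eq_zero_iff F).mpr hF, map_zero]

theorem eval_chartPoint_ne_zero (h : IsAffineChart X G π) (χ : B →ₐ[k] k) :
    eval (chartPoint π χ) G ≠ 0 := by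
  rw [eval_chartPoint]
  exact (h.isUnit.map χ).ne_zero

theorem chartPoint_ne_zero (h : IsAffineChart X G π) (χ : B →ₐ[k] k) : chartPoint π χ ≠ 0 := by
  intro h0
  obtain ⟨d, hd, hG⟩ := h.isHomogeneous
  apply h.eval_chartPoint_ne_zero χ
  have := eval_smul_of_isHomogeneous hG 0 (chartPoint π χ)
  rw [h0, smul_zero, zero_pow hd.ne', zero_mul] at this
  rw [h0, this]

theorem finiteType [Finite σ] (h : IsAffineChart X G π) : Algebra.FiniteType k B := by
  obtain ⟨u, hu⟩ := h.isUnit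
  let φ : MvPolynomial (Option σ) k →ₐ[k] B :=
    aeval fun o => o.elim (↑u⁻¹ : B) fun i => π (MvPolynomial.X i)
  have hφ : ∀ F, φ (rename some F) = π F := by
    intro F
    have : φ.comp (rename some) = π := by
      ext i
      simp [φ]
    exact DFunLike.congr_fun this F
  refine Algebra.FiniteType.of_surjective φ fun b => ?_
  obtain ⟨e, F, hF⟩ := h.exists_eq b
  refine ⟨MvPolynomial.X none ^ e * rename some F, ?_⟩
  rw [map_mul, hφ, ← hF, ← hu, map_pow]
  simp only [φ, aeval_X, Option.elim]
  rw [← mul_assoc, ← mul_pow, Units.inv_mul, one_pow, one_mul]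

/-- The universal property of an affine chart. -/
theorem exists_lift (h : IsAffineChart X G π) {C : Type*} [CommRing C] [Algebra k C] (v : σ → C)
    (hv : ∀ F ∈ vanishingIdeal X, aeval v F = 0) (hG : IsUnit (aeval v G)) :
    ∃ χ : B →ₐ[k] C, ∀ F, χ (π F) = aeval v F := by
  let S := MvPolynomial σ k ⧸ vanishingIdeal X
  let j : S →ₐ[k] B := Ideal.Quotient.liftₐ (vanishingIdeal X) π
    fun F hF => (h.map_eq_zero_iff F).mpr hF
  let : Algebra S B := j.toRingHom.toAlgebra
  have : IsScalarTower k S B := IsScalarTower.of_algebraMap_eq fun x => (j.commutes x).symm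
  have hj : ∀ F, algebraMap S B (Ideal.Quotient.mk _ F) = π F := fun F => rfl
  have : IsLocalization (Submonoid.powers (Ideal.Quotient.mk (vanishingIdeal X) G)) B := by
    refine ⟨?_, ?_, ?_⟩
    · rintro ⟨_, e, rfl⟩
      rw [map_pow, hj]
      exact h.isUnit.pow e
    · intro b
      obtain ⟨e, F, hF⟩ := h.exists_eq b
      refine ⟨⟨Ideal.Quotient.mk _ F, ⟨_, e, rfl⟩⟩, ?_⟩
      rw [map_pow, hj, hj, ← hF, mul_comm]
    · intro a b hab
      obtain ⟨F, rfl⟩ := Ideal.Quotient.mk_surjective a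
      obtain ⟨F', rfl⟩ := Ideal.Quotient.mk_surjective b
      refine ⟨1, ?_⟩
      rw [hj, hj, ← sub_eq_zero, ← map_sub, h.map_eq_zero_iff] at hab
      rw [Ideal.Quotient.eq.mpr hab]
  let θ : S →ₐ[k] C := Ideal.Quotient.liftₐ (vanishingIdeal X) (aeval v) hv
  have hu : ∀ y : Submonoid.powers (Ideal.Quotient.mk (vanishingIdeal X) G), IsUnit (θ y) := by
    rintro ⟨_, e, rfl⟩
    rw [map_pow]
    exact hG.pow e
  refine ⟨IsLocalization.liftAlgHom hu, fun F => ?_⟩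
  rw [← hj]
  exact IsLocalization.lift_eq _ _

theorem algHom_ext (h : IsAffineChart X G π) {C : Type*} [CommRing C] [Algebra k C]
    {χ χ' : B →ₐ[k] C} (hχ : ∀ i, χ (π (MvPolynomial.X i)) = χ' (π (MvPolynomial.X i))) :
    χ = χ' := by
  have h1 : χ.comp π = χ'.comp π := by
    ext i
    exact hχ i
  ext b
  obtain ⟨e, F, hF⟩ := h.exists_eq b
  have h2 : ∀ F, χ (π F) = χ' (π F) := fun F => DFunLike.congr_fun h1 F
  have h3 := congrArg χ hF
  rw [h2, ← hF, map_mul, map_mul, map_pow, map_pow, h2] at h3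
  exact ((h.isUnit.map χ').pow e).mul_left_cancel h3

theorem exists_chartPoint_eq (h : IsAffineChart X G π) {v : σ → k} (hv : v ∈ cone X)
    (hG : eval v G ≠ 0) : ∃ χ : B →ₐ[k] k, chartPoint π χ = v := by
  obtain ⟨χ, hχ⟩ := h.exists_lift v hv (isUnit_iff_ne_zero.mpr hG)
  refine ⟨χ, funext fun i => ?_⟩
  rw [chartPoint, hχ, aeval_X]

theorem exists_map_ne_zero [IsAlgClosed k] [Finite σ] [IsDomain B] (h : IsAffineChart X G π)
    {b : B} (hb : b ≠ 0) : ∃ χ : B →ₐ[k] k, χ b ≠ 0 := by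
  obtain ⟨e, F, hF⟩ := h.exists_eq b
  have hF0 : F ∉ vanishingIdeal X := by
    rw [← h.map_eq_zero_iff, ← hF]
    exact mul_ne_zero (pow_ne_zero _ h.isUnit.ne_zero) hb
  have hFG : F * G ∉ vanishingIdeal X := by
    rw [← h.map_eq_zero_iff, map_mul]
    exact mul_ne_zero (by rwa [ne_eq, h.map_eq_zero_iff]) h.isUnit.ne_zero
  rw [mem_vanishingIdeal] at hFG
  push Not at hFG
  obtain ⟨x, hx, a, ha⟩ := hFG
  rw [map_mul] at ha
  obtain ⟨χ, hχ⟩ := h.exists_chartPoint_eq (smul_mem_cone (rep_mem_cone hx) a)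
    (right_ne_zero_of_mul ha)
  refine ⟨χ, fun h0 => left_ne_zero_of_mul ha ?_⟩
  rw [← hχ, eval_chartPoint, ← hF, map_mul, h0, mul_zero]

theorem eq_zero_of_forall [IsAlgClosed k] [Finite σ] [IsDomain B] (h : IsAffineChart X G π)
    {b : B} (hb : ∀ χ : B →ₐ[k] k, χ b = 0) : b = 0 := by
  by_contra hne
  obtain ⟨χ, hχ⟩ := h.exists_map_ne_zero hne
  exact hχ (hb χ)

end IsAffineChart

/-- The standard affine chart: the localization of the homogeneous coordinate ring at `G`. -/
noncomputable def awayHom {σ : Type*} (X : Set (PSpace k σ)) (G : MvPolynomial σ k) :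
    MvPolynomial σ k →ₐ[k] Localization.Away (Ideal.Quotient.mk (vanishingIdeal X) G) :=
  (IsScalarTower.toAlgHom k (MvPolynomial σ k ⧸ vanishingIdeal X)
    (Localization.Away (Ideal.Quotient.mk (vanishingIdeal X) G))).comp
      (Ideal.Quotient.mkₐ k (vanishingIdeal X))

theorem IsProjectiveVariety.isDomain_away [Infinite k] {σ : Type*} {X : Set (PSpace k σ)}
    (hX : IsProjectiveVariety X) {G : MvPolynomial σ k} (hG : G ∉ vanishingIdeal X) :
    IsDomain (Localization.Away (Ideal.Quotient.mk (vanishingIdeal X) G)) := by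
  have := hX.isPrime
  refine IsLocalization.isDomain_localization ?_
  exact powers_le_nonZeroDivisors_of_noZeroDivisors
    (by rwa [ne_eq, Ideal.Quotient.eq_zero_iff_mem])

theorem awayHom_eq_zero_iff [Infinite k] {σ : Type*} {X : Set (PSpace k σ)}
    (hX : IsProjectiveVariety X) {G : MvPolynomial σ k} (hG : G ∉ vanishingIdeal X)
    (F : MvPolynomial σ k) : awayHom X G F = 0 ↔ F ∈ vanishingIdeal X := by
  have := hX.isPrime
  rw [← Ideal.Quotient.eq_zero_iff_mem]
  exact map_eq_zero_iff (algebraMap (MvPolynomial σ k ⧸ vanishingIdeal X)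
    (Localization.Away (Ideal.Quotient.mk (vanishingIdeal X) G)))
    (IsLocalization.injective _ (powers_le_nonZeroDivisors_of_noZeroDivisors
      (by rwa [ne_eq, Ideal.Quotient.eq_zero_iff_mem])))

theorem isUnit_awayHom {σ : Type*} (X : Set (PSpace k σ)) (G : MvPolynomial σ k) :
    IsUnit (awayHom X G G) :=
  IsLocalization.Away.algebraMap_isUnit (Ideal.Quotient.mk (vanishingIdeal X) G)

theorem exists_awayHom_eq {σ : Type*} (X : Set (PSpace k σ)) (G : MvPolynomial σ k)
    (b : Localization.Away (Ideal.Quotient.mk (vanishingIdeal X) G)) :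
    ∃ (e : ℕ) (F : MvPolynomial σ k), awayHom X G G ^ e * b = awayHom X G F := by
  obtain ⟨e, s, hs⟩ := IsLocalization.Away.surj (Ideal.Quotient.mk (vanishingIdeal X) G) b
  obtain ⟨F, rfl⟩ := Ideal.Quotient.mk_surjective s
  exact ⟨e, F, by rw [mul_comm]; exact hs⟩

theorem isAffineChart_awayHom [Infinite k] {σ : Type*} {X : Set (PSpace k σ)}
    (hX : IsProjectiveVariety X) {G : MvPolynomial σ k} {d : ℕ} (hd : 0 < d)
    (hhom : G.IsHomogeneous d) (hG : G ∉ vanishingIdeal X) : IsAffineChart X G (awayHom X G) :=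
  ⟨⟨d, hd, hhom⟩, awayHom_eq_zero_iff hX hG, isUnit_awayHom X G, exists_awayHom_eq X G⟩

end AffineChart

/-! ### Homogeneous denominators in the local parts of an ideal -/

section LocalPart

open MvPolynomial

variable {k : Type*} [Field k] {σ : Type*}

attribute [local instance] MvPolynomial.gradedAlgebra in
theorem homogeneousComponent_mem_sup_span {X : Set (PSpace k σ)} [Infinite k] {ι : Type*}
    (P : ι → MvPolynomial σ k) {d : ℕ} (hP : ∀ i, (P i).IsHomogeneous d) {F : MvPolynomial σ k}
    (hF : F ∈ vanishingIdeal X ⊔ Ideal.span (Set.range P)) (e : ℕ) :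
    homogeneousComponent e F ∈ vanishingIdeal X ⊔ Ideal.span (Set.range P) := by
  obtain ⟨A, hA, B, hB, rfl⟩ := Submodule.mem_sup.mp hF
  rw [map_add]
  refine Ideal.add_mem _ (Ideal.mem_sup_left (homogeneousComponent_mem_vanishingIdeal hA e))
    (Ideal.mem_sup_right ?_)
  refine homogeneousComponent_mem_of_mem (Ideal.homogeneous_span _ _ ?_) hB e
  rintro _ ⟨i, rfl⟩
  exact ⟨d, hP i⟩

theorem homogeneousComponent_add_mul (H : MvPolynomial σ k) {F : MvPolynomial σ k} {d : ℕ}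
    (hF : F.IsHomogeneous d) (e : ℕ) :
    homogeneousComponent (e + d) (H * F) = homogeneousComponent e H * F := by
  conv_lhs => rw [← sum_homogeneousComponent H, Finset.sum_mul, map_sum]
  have h1 : ∀ i, homogeneousComponent (e + d) (homogeneousComponent i H * F) =
      if e = i then homogeneousComponent i H * F else 0 := fun i => by
    rw [homogeneousComponent_of_mem ((homogeneousComponent_isHomogeneous i H).mul hF)]
    simp only [add_left_inj]
  simp only [h1, Finset.sum_ite_eq, Finset.mem_range]
  split_ifs with h
  · rfl
  · rw [homogeneousComponent_eq_zero _ _ (by omega), zero_mul]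

/-- Multiplying all variables by a new variable `T` separates the homogeneous components as the
coefficients of the powers of `T`. -/
theorem coeff_aeval_C_mul_X {S : Type*} [CommRing S] [Algebra k S] (φ : MvPolynomial σ k →ₐ[k] S)
    (F : MvPolynomial σ k) (d : ℕ) :
    (aeval (fun i => Polynomial.C (φ (X i)) * Polynomial.X) F).coeff d =
      φ (homogeneousComponent d F) := by
  have h1 : (fun i => Polynomial.C (φ (X i)) * Polynomial.X) =
      (Polynomial.X : Polynomial S) • fun i => Polynomial.C (φ (X i)) := by
    funext i
    simp only [Pi.smul_apply, smul_eq_mul, Polynomial.X_mul_C]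
  have h2 : ∀ G, aeval (fun i => Polynomial.C (φ (X i))) G = Polynomial.C (φ G) := by
    intro G
    induction G using MvPolynomial.induction_on with
    | C a =>
      rw [aeval_C, ← algebraMap_eq, AlgHom.commutes]
      rfl
    | add p q hp hq => rw [map_add, map_add, map_add, hp, hq]
    | mul_X p i hp => rw [map_mul, map_mul, map_mul, hp, aeval_X]
  have h3 : ∀ e, (aeval (fun i => Polynomial.C (φ (X i)) * Polynomial.X)
      (homogeneousComponent e F)).coeff d = if d = e then φ (homogeneousComponent e F) else 0 := by
    intro e
    rw [h1, aeval_smul_of_isHomogeneous _ Polynomial.X _, h2, Polynomial.X_pow_mul_C,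
      Polynomial.coeff_C_mul_X_pow]
    exact homogeneousComponent_isHomogeneous e F
  conv_lhs => rw [← sum_homogeneousComponent F, map_sum, Polynomial.finsetSum_coeff]
  simp only [h3, Finset.sum_ite_eq, Finset.mem_range]
  split_ifs with h
  · rfl
  · rw [homogeneousComponent_eq_zero _ _ (by omega), map_zero]

/-- After multiplying the variables by `T`, the assumption says that the product of the two
resulting elements of `S[T]` is zero. By McCoy's theorem a zero divisor of `S[T]` is killed by a
non-zero element of `S`, which `hH` forbids for the image of `H`. -/
theorem map_homogeneousComponent_eq_zero {S : Type*} [CommRing S] [Algebra k S]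
    (φ : MvPolynomial σ k →ₐ[k] S) {H F : MvPolynomial σ k}
    (hHF : ∀ e, φ (homogeneousComponent e (H * F)) = 0)
    (hH : ∀ a, (∀ e, a * φ (homogeneousComponent e H) = 0) → a = 0) (d : ℕ) :
    φ (homogeneousComponent d F) = 0 := by
  let θ : MvPolynomial σ k →ₐ[k] Polynomial S :=
    aeval (fun i => Polynomial.C (φ (X i)) * Polynomial.X)
  have hθ : θ H * θ F = 0 := by
    rw [← map_mul]
    ext e
    rw [coeff_aeval_C_mul_X, Polynomial.coeff_zero, hHF]
  have hF0 : θ F = 0 := by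
    by_contra hne
    have hnot : θ H ∉ nonZeroDivisors _ := fun hmem =>
      hne ((mul_left_mem_nonZeroDivisors_eq_zero_iff hmem).mp hθ)
    obtain ⟨a, ha, haH⟩ := Polynomial.notMem_nonZeroDivisors_iff.mp hnot
    refine ha (hH a fun e => ?_)
    have h1 := congrArg (fun q => q.coeff e) haH
    simpa only [Polynomial.coeff_smul, Polynomial.coeff_zero, smul_eq_mul, θ,
      coeff_aeval_C_mul_X] using h1
  rw [← coeff_aeval_C_mul_X]
  exact congrArg (fun q => q.coeff d) hF0

theorem exists_eval_homogeneousComponent_ne_zero {v : σ → k} {H : MvPolynomial σ k}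
    (hH : eval v H ≠ 0) : ∃ e, eval v (homogeneousComponent e H) ≠ 0 := by
  by_contra hcon
  push Not at hcon
  apply hH
  rw [← sum_homogeneousComponent H, map_sum]
  exact Finset.sum_eq_zero fun e _ => hcon e

/-- The denominator `H` need not be homogeneous, so membership cannot be split into degrees
directly. But some component of `H` is non-zero at `x.rep` and hence cancellable modulo the local
part, which is the condition needed for the McCoy argument. -/
theorem homogeneousComponent_mem_localPart {J : Ideal (MvPolynomial σ k)}
    (hJ : ∀ F ∈ J, ∀ e, homogeneousComponent e F ∈ J) {x : PSpace k σ} {F : MvPolynomial σ k}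
    (hF : F ∈ localPart J x) (d : ℕ) : homogeneousComponent d F ∈ localPart J x := by
  obtain ⟨H, hH, hHF⟩ := hF
  have hle : J ≤ localPart J x := fun G hG => ⟨1, by simp, by simpa using hG⟩
  have h := map_homogeneousComponent_eq_zero (Ideal.Quotient.mkₐ k (localPart J x))
    (H := H) (F := F) (fun e => Ideal.Quotient.eq_zero_iff_mem.mpr (hle (hJ _ hHF e))) ?_ d
  · exact Ideal.Quotient.eq_zero_iff_mem.mp h
  intro a ha
  obtain ⟨A, rfl⟩ := Ideal.Quotient.mk_surjective a
  obtain ⟨e, he⟩ := exists_eval_homogeneousComponent_ne_zero hH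
  have h1 := ha e
  rw [Ideal.Quotient.mkₐ_eq_mk, ← map_mul, Ideal.Quotient.eq_zero_iff_mem] at h1
  obtain ⟨H', hH', hmem⟩ := h1
  exact Ideal.Quotient.eq_zero_iff_mem.mpr ⟨H' * homogeneousComponent e H,
    by rw [map_mul]; exact mul_ne_zero hH' he, by rwa [mul_assoc, mul_comm _ A]⟩

/-- A homogeneous denominator makes the local condition independent of the vector that represents
`x`. This matters because points of a chart come with their own representatives. -/
theorem exists_isHomogeneous_mul_mem {J : Ideal (MvPolynomial σ k)}
    (hJ : ∀ F ∈ J, ∀ e, homogeneousComponent e F ∈ J) {x : PSpace k σ} {F : MvPolynomial σ k}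
    (hF : F ∈ localPart J x) :
    ∃ (H : MvPolynomial σ k) (e : ℕ), H.IsHomogeneous e ∧ eval x.rep H ≠ 0 ∧ H * F ∈ J := by
  have key : ∀ d, ∃ (H : MvPolynomial σ k) (e : ℕ), H.IsHomogeneous e ∧ eval x.rep H ≠ 0 ∧
      H * homogeneousComponent d F ∈ J := by
    intro d
    obtain ⟨H, hH, hHF⟩ := homogeneousComponent_mem_localPart hJ hF d
    obtain ⟨e, he⟩ := exists_eval_homogeneousComponent_ne_zero hH
    refine ⟨_, e, homogeneousComponent_isHomogeneous e H, he, ?_⟩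
    have h1 := hJ _ hHF (e + d)
    rwa [homogeneousComponent_add_mul _ (homogeneousComponent_isHomogeneous d F)] at h1
  choose H e hH hx hmem using key
  refine ⟨∏ d ∈ Finset.range (F.totalDegree + 1), H d, _,
    IsHomogeneous.prod _ _ e fun d _ => hH d, ?_, ?_⟩
  · rw [map_prod]
    exact Finset.prod_ne_zero_iff.mpr fun d _ => hx d
  · have h1 : ∀ G : MvPolynomial σ k, G * F =
        ∑ d ∈ Finset.range (F.totalDegree + 1), G * homogeneousComponent d F := fun G => by
      rw [← Finset.mul_sum, sum_homogeneousComponent]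
    rw [h1]
    refine sum_mem fun d hd => ?_
    rw [← Finset.prod_erase_mul _ _ hd, mul_assoc]
    exact J.mul_mem_left _ (hmem d)

end LocalPart

/-! ### Fibre ideals over general points of the closure of the image -/

section FiberClosure

open MvPolynomial

variable {k : Type*} [Field k] {σ τ : Type*}

/-- The homogenization of a polynomial with respect to one of its variables. -/
noncomputable def homogenization (a : τ) (q : MvPolynomial τ k) : MvPolynomial τ k :=
  ∑ d ∈ Finset.range (q.totalDegree + 1), X a ^ (q.totalDegree - d) * homogeneousComponent d q

theorem isHomogeneous_homogenization (a : τ) (q : MvPolynomial τ k) :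
    (homogenization a q).IsHomogeneous q.totalDegree := by
  refine IsHomogeneous.sum _ _ _ fun d hd => ?_
  have h1 := (isHomogeneous_X_pow (R := k) a (q.totalDegree - d)).mul
    (homogeneousComponent_isHomogeneous d q)
  rwa [Nat.sub_add_cancel (Nat.lt_succ_iff.mp (Finset.mem_range.mp hd))] at h1

theorem aeval_homogenization {C : Type*} [CommRing C] [Algebra k C] {g : τ → C} {a : τ}
    (hg : g a = 1) (q : MvPolynomial τ k) : aeval g (homogenization a q) = aeval g q := by
  conv_rhs => rw [← sum_homogeneousComponent q]
  rw [homogenization, map_sum, map_sum]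
  exact Finset.sum_congr rfl fun d _ => by rw [map_mul, map_pow, aeval_X, hg, one_pow, one_mul]

/-- The ideal generated by the equations `y i * g j = y j * g i`. -/
def minorIdeal {B : Type*} [CommRing B] [Algebra k B] (y : τ → k) (g : τ → B) : Ideal B :=
  Ideal.span (Set.range fun ij : τ × τ => y ij.1 • g ij.2 - y ij.2 • g ij.1)

theorem minorIdeal_eq {B : Type*} [CommRing B] [Algebra k B] {y : τ → k} {g : τ → B} {a : τ}
    (hy : y a ≠ 0) (hg : g a = 1) :
    minorIdeal y g = Ideal.span (Set.range fun j => g j - algebraMap k B (y j / y a)) := by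
  apply le_antisymm
  · refine Ideal.span_le.mpr ?_
    rintro _ ⟨⟨i, j⟩, rfl⟩
    have h1 : y i • g j - y j • g i = algebraMap k B (y i) * (g j - algebraMap k B (y j / y a)) -
        algebraMap k B (y j) * (g i - algebraMap k B (y i / y a)) := by
      simp only [Algebra.smul_def, mul_sub, ← map_mul]
      rw [show y i * (y j / y a) = y j * (y i / y a) by ring]
      ring
    change y i • g j - y j • g i ∈ _
    rw [h1]
    exact sub_mem (Ideal.mul_mem_left _ _ (Ideal.subset_span ⟨j, rfl⟩))
      (Ideal.mul_mem_left _ _ (Ideal.subset_span ⟨i, rfl⟩))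
  · refine Ideal.span_le.mpr ?_
    rintro _ ⟨j, rfl⟩
    have h1 : g j - algebraMap k B (y j / y a) =
        algebraMap k B (y a)⁻¹ * (y a • g j - y j • g a) := by
      rw [hg, Algebra.smul_def, Algebra.smul_def, mul_sub, ← mul_assoc, ← map_mul,
        inv_mul_cancel₀ hy, mul_one, ← map_mul, map_one, one_mul, div_eq_inv_mul]
    change g j - algebraMap k B (y j / y a) ∈ _
    rw [h1]
    exact Ideal.mul_mem_left _ _ (Ideal.subset_span ⟨(a, j), rfl⟩)

theorem mem_span_range_X_sub_C {w : τ → k} {q : MvPolynomial τ k} (hq : eval w q = 0) :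
    q ∈ Ideal.span (Set.range fun j => (X j - C (w j) : MvPolynomial τ k)) := by
  have h1 : ∀ q : MvPolynomial τ k, q - C (eval w q) ∈
      Ideal.span (Set.range fun j => (X j - C (w j) : MvPolynomial τ k)) := by
    intro q
    induction q using MvPolynomial.induction_on with
    | C a => simp
    | add p q hp hq =>
      rw [map_add, map_add, add_sub_add_comm]
      exact add_mem hp hq
    | mul_X p i hp =>
      rw [map_mul, eval_X, map_mul, show p * X i - C (eval w p) * C (w i) =
        p * (X i - C (w i)) + C (w i) * (p - C (eval w p)) by ring]
      exact add_mem (Ideal.mul_mem_left _ _ (Ideal.subset_span ⟨i, rfl⟩))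
        (Ideal.mul_mem_left _ _ hp)
  simpa [hq] using h1 q

/-- Apply the generic-fibre theorem to the subalgebra `A = k[g]` of `B`. A vector `y` that satisfies
all homogeneous relations among the `g j` and has `y a ≠ 0` gives a maximal ideal of `A`, whose
extension to `B` is `minorIdeal y g`. The element of `A` to be avoided is a polynomial in the `g j`,
and it can be homogenized because `g a = 1`. -/
theorem exists_isHomogeneous_forall_minorIdeal {B : Type*} [CommRing B] [IsDomain B] [Algebra k B]
    [Algebra.FiniteType k B] (g : τ → B) {a : τ} (hg : g a = 1) {G : B} (hG : G ≠ 0) :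
    ∃ (H : MvPolynomial τ k) (d : ℕ), H.IsHomogeneous d ∧ aeval g H ≠ 0 ∧ ∀ y : τ → k,
      (∀ Q d, Q.IsHomogeneous d → aeval g Q = 0 → eval y Q = 0) → eval y H ≠ 0 →
        y a ≠ 0 ∧ (∀ b, G * b ∈ minorIdeal y g → b ∈ minorIdeal y g) ∧ minorIdeal y g ≠ ⊤ := by
  let A := (aeval g : MvPolynomial τ k →ₐ[k] B).range
  have : Algebra.FiniteType A B := Algebra.FiniteType.of_restrictScalars_finiteType k A B
  obtain ⟨⟨_, q, rfl⟩, hh, hmax⟩ := exists_ne_zero_forall_maximal (A := A) (B := B)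
    Subtype.val_injective G hG
  set Q := homogenization a q
  have hQ : Q.IsHomogeneous q.totalDegree := isHomogeneous_homogenization a q
  have hq0 : aeval g q ≠ 0 := fun h0 => hh (Subtype.ext h0)
  -- The factor `X a` keeps `y` in the affine part where coordinates can be divided by `y a`.
  refine ⟨X a * Q, _, (isHomogeneous_X k a).mul hQ, ?_, ?_⟩
  · rw [map_mul, aeval_X, hg, one_mul, aeval_homogenization hg]
    exact hq0
  intro y hy hyQ
  rw [map_mul, eval_X] at hyQ
  have hya := left_ne_zero_of_mul hyQ
  have hw : ∀ {Q : MvPolynomial τ k} {d : ℕ}, Q.IsHomogeneous d →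
      aeval (fun j => y j / y a) Q = (y a)⁻¹ ^ d * eval y Q := by
    intro Q d hQ
    have := aeval_smul_of_isHomogeneous hQ (y a)⁻¹ y
    rw [← aeval_eq_eval, ← this]
    congr 2
    funext j
    rw [Pi.smul_apply, smul_eq_mul, div_eq_inv_mul]
  have hwa : (fun j => y j / y a) a = 1 := div_self hya
  let ψ₀ : MvPolynomial τ k →ₐ[k] k := aeval (fun j => y j / y a)
  have hker : ∀ q, aeval g q = 0 → ψ₀ q = 0 := by
    intro q' hq'
    have hQ' := isHomogeneous_homogenization a q'
    change aeval _ q' = 0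
    rw [← aeval_homogenization (g := fun j => y j / y a) hwa, hw hQ', hy _ _ hQ' (by rw [aeval_homogenization hg, hq']),
      mul_zero]
  let π : MvPolynomial τ k →ₐ[k] A := (aeval g).rangeRestrict
  have hπ : Function.Surjective π := (aeval g : MvPolynomial τ k →ₐ[k] B).rangeRestrict_surjective
  have hπ0 : ∀ q, π q = 0 ↔ aeval g q = 0 := fun q => by
    rw [← Subtype.coe_inj]; rfl
  let m : Ideal A := (RingHom.ker ψ₀).map π
  have hm : ∀ q, π q ∈ m ↔ ψ₀ q = 0 := by
    intro q
    rw [Ideal.mem_map_iff_of_surjective _ hπ]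
    constructor
    · rintro ⟨q', hq', h⟩
      rw [← sub_eq_zero, ← map_sub, hπ0] at h
      have := hker _ h
      rw [map_sub, (RingHom.mem_ker).mp hq', zero_sub, neg_eq_zero] at this
      exact this
    · exact fun h => ⟨q, h, rfl⟩
  have hmmax : m.IsMaximal := by
    have hkm : (RingHom.ker ψ₀).IsMaximal := RingHom.ker_isMaximal_of_surjective _
      fun c => ⟨C c, by simp [ψ₀]⟩
    refine (Ideal.map_eq_top_or_isMaximal_of_surjective π hπ hkm).resolve_left ?_
    intro htop
    have h1 := (hm 1).mp (by rw [map_one]; exact (Ideal.eq_top_iff_one m).mp htop)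
    rw [map_one] at h1
    exact one_ne_zero h1
  have hmB : m.map (algebraMap A B) = minorIdeal y g := by
    rw [minorIdeal_eq hya hg]
    change ((RingHom.ker ψ₀).map (π : MvPolynomial τ k →+* A)).map (algebraMap A B) = _
    rw [Ideal.map_map]
    have hcomp : ∀ q, ((algebraMap A B).comp (π : MvPolynomial τ k →+* A)) q = aeval g q :=
      fun q => rfl
    apply le_antisymm
    · refine Ideal.map_le_iff_le_comap.mpr fun q hq => ?_
      have hq' : eval (fun j => y j / y a) q = 0 := by
        rw [← aeval_eq_eval]
        exact hq
      have h1 := Ideal.mem_map_of_mem (aeval g : MvPolynomial τ k →ₐ[k] B)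
        (mem_span_range_X_sub_C hq')
      rw [Ideal.map_span, ← Set.range_comp] at h1
      rw [Ideal.mem_comap, hcomp]
      convert h1 using 4 with j
      simp
    · refine Ideal.span_le.mpr ?_
      rintro _ ⟨j, rfl⟩
      have h1 : (X j - C (y j / y a) : MvPolynomial τ k) ∈ RingHom.ker ψ₀ := by
        rw [RingHom.mem_ker]
        simp [ψ₀]
      have h2 := Ideal.mem_map_of_mem ((algebraMap A B).comp (π : MvPolynomial τ k →+* A)) h1
      rw [hcomp] at h2
      simpa using h2
  have hnot : (⟨aeval g q, q, rfl⟩ : A) ∉ m := by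
    intro hmem
    have h1 : ψ₀ q = 0 := (hm q).mp hmem
    have h2 : aeval (fun j => y j / y a) q = (y a)⁻¹ ^ q.totalDegree * eval y Q := by
      rw [← aeval_homogenization (g := fun j => y j / y a) hwa, hw hQ]
    change aeval _ q = 0 at h1
    rw [h1] at h2
    exact mul_ne_zero (pow_ne_zero _ (inv_ne_zero hya)) (right_ne_zero_of_mul hyQ) h2.symm
  have h := hmax m hmmax hnot
  rw [hmB] at h
  exact ⟨hya, h⟩

end FiberClosure

/-! ### Comparison of the closure of a fibre with its part in one chart -/

section FiberChart

open MvPolynomial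

variable {k : Type*} [Field k] {σ τ : Type*}

theorem mk_eq_mk_of_apply_eq_one {v w : τ → k} {hv : v ≠ 0} {hw : w ≠ 0} {a : τ} (hwa : w a = 1)
    (h : Projectivization.mk k v hv = Projectivization.mk k w hw) (c : τ) : v c = v a * w c := by
  obtain ⟨s, hs⟩ := (Projectivization.mk_eq_mk_iff' k v w hv hw).mp h
  rw [← hs]
  simp [hwa]

/-- An affine chart of `X` on which the map `f` is given by the functions `g`, one of which
is normalized to be `1`. -/
structure IsMapChart (X : Set (PSpace k σ)) (G : MvPolynomial σ k) {B : Type*}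
    [CommRing B] [Algebra k B] (π : MvPolynomial σ k →ₐ[k] B) {U : Set (PSpace k σ)}
    (f : U → PSpace k τ) (g : τ → B) (a : τ) : Prop extends IsAffineChart X G π where
  apply_eq_one : g a = 1
  map_mk : ∀ χ : B →ₐ[k] k, ∃ (hv : chartPoint π χ ≠ 0)
    (hu : Projectivization.mk k (chartPoint π χ) hv ∈ U) (h : (fun c => χ (g c)) ≠ 0),
    f ⟨_, hu⟩ = Projectivization.mk k (fun c => χ (g c)) h

theorem IsLocalRep.mk_eq_mk {U : Set (PSpace k σ)} {f : U → PSpace k τ} {x : U}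
    {P : τ → MvPolynomial σ k} (hP : IsLocalRep f x P) {v : σ → k} {hv : v ≠ 0}
    (hu : Projectivization.mk k v hv ∈ U) (hPv : (fun i => eval v (P i)) ≠ 0) :
    f ⟨_, hu⟩ = Projectivization.mk k (fun i => eval v (P i)) hPv := by
  obtain ⟨d, hd⟩ := hP.homogeneous
  obtain ⟨a, ha⟩ := Projectivization.exists_smul_eq_mk_rep k v hv
  have h1 : (fun i => eval (Projectivization.mk k v hv).rep (P i)) =
      (a : k) ^ d • fun i => eval v (P i) := by
    funext i
    rw [← ha]
    exact eval_smul_of_isHomogeneous (hd i) _ _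
  have ha0 : (a : k) ^ d ≠ 0 := pow_ne_zero _ a.ne_zero
  have h2 : (fun i => eval (Projectivization.mk k v hv).rep (P i)) ≠ 0 := by
    rw [h1]
    exact smul_ne_zero ha0 hPv
  rw [hP.eq_mk ⟨_, hu⟩ h2, Projectivization.mk_eq_mk_iff']
  exact ⟨_, h1.symm⟩

/-- Clearing denominators: elements of `B` become images of polynomials after multiplication by a
power of `G`. -/
theorem exists_pow_mul_mem_of_mem_map {I : Ideal (MvPolynomial σ k)} {G : MvPolynomial σ k}
    {B : Type*} [CommRing B] [Algebra k B] {π : MvPolynomial σ k →ₐ[k] B}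
    (hπ : ∀ F, π F = 0 ↔ F ∈ I) (hG : ∀ b, ∃ (e : ℕ) (F : MvPolynomial σ k), π G ^ e * b = π F)
    {J : Ideal (MvPolynomial σ k)} {F : MvPolynomial σ k} (hF : π F ∈ J.map π) :
    ∃ e, G ^ e * F ∈ I ⊔ J := by
  have key : ∀ b ∈ J.map π, ∃ (e : ℕ) (F' : MvPolynomial σ k), F' ∈ J ∧ π G ^ e * b = π F' := by
    intro b hb
    induction hb using Submodule.span_induction with
    | mem x hx =>
      obtain ⟨F', hF', rfl⟩ := hx
      exact ⟨0, F', hF', by rw [pow_zero, one_mul]⟩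
    | zero => exact ⟨0, 0, zero_mem _, by simp⟩
    | add x y _ _ hx hy =>
      obtain ⟨e, F₁, h₁, h₁'⟩ := hx
      obtain ⟨e', F₂, h₂, h₂'⟩ := hy
      refine ⟨e + e', G ^ e' * F₁ + G ^ e * F₂,
        add_mem (J.mul_mem_left _ h₁) (J.mul_mem_left _ h₂), ?_⟩
      rw [map_add, map_mul, map_mul, ← h₁', ← h₂', map_pow, map_pow]
      ring
    | smul c x _ hx =>
      obtain ⟨e, F₁, h₁, h₁'⟩ := hx
      obtain ⟨e', F₂, h₂⟩ := hG c
      refine ⟨e + e', F₂ * F₁, J.mul_mem_left _ h₁, ?_⟩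
      rw [map_mul, ← h₁', ← h₂, smul_eq_mul]
      ring
  obtain ⟨e, F', hF', h⟩ := key _ hF
  refine ⟨e, ?_⟩
  rw [← map_pow, ← map_mul, ← sub_eq_zero, ← map_sub, hπ] at h
  rw [← sub_add_cancel (G ^ e * F) F']
  exact Submodule.add_mem_sup h hF'

/-- The polynomials `y i * P j - y j * P i`. -/
noncomputable def fiberEquation (y : τ → k) (P : τ → MvPolynomial σ k) (ij : τ × τ) :
    MvPolynomial σ k :=
  C (y ij.1) * P ij.2 - C (y ij.2) * P ij.1

theorem span_fiberEquation (y : τ → k) (P : τ → MvPolynomial σ k) {B : Type*} [CommRing B]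
    [Algebra k B] {π : MvPolynomial σ k →ₐ[k] B} {g : τ → B} {b : B}
    (h : ∀ c, π (P c) = b * g c) :
    (Ideal.span (Set.range (fiberEquation y P))).map π = Ideal.span {b} * minorIdeal y g := by
  rw [Ideal.map_span, ← Set.range_comp, minorIdeal, Ideal.span_mul_span', Set.singleton_mul,
    ← Set.range_comp]
  congr 2
  funext ij
  have hC : ∀ a : k, π (C a) = algebraMap k B a := fun a => by rw [← algebraMap_eq, AlgHom.commutes]
  simp only [Function.comp_apply, fiberEquation, map_sub, map_mul, h, hC, Algebra.smul_def]
  ring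

/-- The ideal generated by all components of all local representations is finitely generated.
Finitely many representations therefore cover `U`, and only finitely many open conditions on the
point of the target arise. -/
theorem exists_finite_reps [Finite σ] {U : Set (PSpace k σ)} {f : U → PSpace k τ}
    (hrep : ∀ x : U, ∃ P, IsLocalRep f x P) :
    ∃ S : Finset ((τ → MvPolynomial σ k) × τ),
      (∀ s ∈ S, ∃ x, IsLocalRep f x s.1 ∧ eval x.1.rep (s.1 s.2) ≠ 0) ∧
      ∀ x : U, ∃ s ∈ S, eval x.1.rep (s.1 s.2) ≠ 0 := by
  classical
  let T : Set ((τ → MvPolynomial σ k) × τ) :=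
    {s | ∃ x, IsLocalRep f x s.1 ∧ eval x.1.rep (s.1 s.2) ≠ 0}
  have hfg : (Ideal.span ((fun s : (τ → MvPolynomial σ k) × τ => s.1 s.2) '' T)).FG :=
    IsNoetherian.noetherian _
  obtain ⟨S', hS', hspan⟩ := (Submodule.fg_span_iff_fg_span_finset_subset _).mp hfg
  obtain ⟨S, hST, rfl⟩ := Finset.subset_set_image_iff.mp hS'
  refine ⟨S, fun s hs => hST hs, fun x => ?_⟩
  by_contra hcon
  push Not at hcon
  obtain ⟨P, hP⟩ := hrep x
  obtain ⟨c, hc⟩ := Function.ne_iff.mp hP.ne_zero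
  have h1 : P c ∈ Ideal.span ((fun s : (τ → MvPolynomial σ k) × τ => s.1 s.2) '' T) :=
    Ideal.subset_span ⟨(P, c), ⟨x, hP, hc⟩, rfl⟩
  have h2 : Ideal.span ((fun s : (τ → MvPolynomial σ k) × τ => s.1 s.2) '' T) ≤
      RingHom.ker (eval x.1.rep) := by
    rw [Ideal.span, hspan, ← Ideal.span, Ideal.span_le]
    intro Q hQ
    obtain ⟨s, hs, rfl⟩ := Finset.mem_image.mp hQ
    exact hcon s hs
  exact hc (h2 h1)

namespace IsMapChart

variable {X : Set (PSpace k σ)} {G : MvPolynomial σ k} {B : Type*}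
  [CommRing B] [Algebra k B] {π : MvPolynomial σ k →ₐ[k] B} {U : Set (PSpace k σ)}
  {f : U → PSpace k τ} {g : τ → B} {a : τ}

theorem eval_chartPoint_rep (h : IsMapChart X G π f g a) {x : U} {P : τ → MvPolynomial σ k}
    (hP : IsLocalRep f x P) (χ : B →ₐ[k] k) (c : τ) :
    eval (chartPoint π χ) (P c) = eval (chartPoint π χ) (P a) * χ (g c) := by
  obtain ⟨hv, hu, h0, hf⟩ := h.map_mk χ
  by_cases hPv : (fun i => eval (chartPoint π χ) (P i)) = 0
  · rw [show eval (chartPoint π χ) (P c) = 0 from congrFun hPv c,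
      show eval (chartPoint π χ) (P a) = 0 from congrFun hPv a, zero_mul]
  · rw [hP.mk_eq_mk hu hPv] at hf
    exact mk_eq_mk_of_apply_eq_one (by simp [h.apply_eq_one]) hf c

variable [IsAlgClosed k] [Finite σ] [IsDomain B]

theorem map_rep (h : IsMapChart X G π f g a) {x : U} {P : τ → MvPolynomial σ k}
    (hP : IsLocalRep f x P) (c : τ) : π (P c) = π (P a) * g c := by
  rw [← sub_eq_zero]
  refine h.eq_zero_of_forall fun χ => ?_
  rw [map_sub, map_mul, ← eval_chartPoint, ← eval_chartPoint, h.eval_chartPoint_rep hP, sub_self]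

theorem rep_notMem (h : IsMapChart X G π f g a) (hUX : U ⊆ X) {x : U} {P : τ → MvPolynomial σ k}
    (hP : IsLocalRep f x P) : P a ∉ vanishingIdeal X := by
  intro hmem
  refine hP.ne_zero (funext fun c => ?_)
  have h1 : P c ∈ vanishingIdeal X := by
    rw [← h.map_eq_zero_iff, h.map_rep hP, (h.map_eq_zero_iff _).mpr hmem, zero_mul]
  simpa using h1 x.1 (hUX x.2) 1

/-- In the chart, every representation is `π (P a)` times `g`, and this factor is non-zero. All
representations thus satisfy the same homogeneous relations, which are the equations of the closure
of the image. -/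
theorem aeval_rep_mem_iff (h : IsMapChart X G π f g a) (hUX : U ⊆ X) {x : U}
    {P : τ → MvPolynomial σ k} (hP : IsLocalRep f x P) {Q : MvPolynomial τ k} {d : ℕ}
    (hQ : Q.IsHomogeneous d) : aeval P Q ∈ vanishingIdeal X ↔ aeval g Q = 0 := by
  have h1 : π (aeval P Q) = π (P a) ^ d * aeval g Q := by
    rw [← aeval_smul_of_isHomogeneous hQ, comp_aeval_apply]
    congr 2
    funext c
    exact h.map_rep hP c
  have h2 : π (P a) ≠ 0 := by
    rw [ne_eq, h.map_eq_zero_iff]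
    exact h.rep_notMem hUX hP
  rw [← h.map_eq_zero_iff, h1, mul_eq_zero, or_iff_right (pow_ne_zero _ h2)]

theorem eval_rep_eq_zero_of_mem_closure (h : IsMapChart X G π f g a) (hUX : U ⊆ X)
    (hrep : ∀ x : U, ∃ P, IsLocalRep f x P) {y : PSpace k τ} (hy : y ∈ closure (Set.range f))
    {Q : MvPolynomial τ k} {d : ℕ} (hQ : Q.IsHomogeneous d) (hgQ : aeval g Q = 0) :
    eval y.rep Q = 0 := by
  by_contra hne
  obtain ⟨_, ⟨x, rfl⟩, hx⟩ := mem_closure_iff_eval.mp hy Q d hQ hne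
  obtain ⟨P, hP⟩ := hrep x
  rw [hP.eq_mk x hP.ne_zero, eval_rep_mk_ne_zero_iff hQ] at hx
  apply hx
  have h1 := (h.aeval_rep_mem_iff hUX hP hQ).mpr hgQ x.1 (hUX x.2) 1
  rw [one_smul] at h1
  rw [← h1, ← aeval_eq_eval, ← aeval_eq_eval, comp_aeval_apply]

theorem mul_sub_mul_mem (h : IsMapChart X G π f g a) {x x' : U} {P Q : τ → MvPolynomial σ k}
    (hP : IsLocalRep f x P) (hQ : IsLocalRep f x' Q) (i j : τ) :
    P i * Q j - P j * Q i ∈ vanishingIdeal X := by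
  rw [← h.map_eq_zero_iff, map_sub, map_mul, map_mul, h.map_rep hP i, h.map_rep hP j,
    h.map_rep hQ i, h.map_rep hQ j]
  ring

/-- Two representations are proportional modulo the ideal of `X`. Up to the factor `Q c`, which is
non-zero at `x`, the fibre equations of `P` are therefore combinations of those of `Q`. -/
theorem mem_localPart_of_rep (h : IsMapChart X G π f g a) {x : U} {P Q : τ → MvPolynomial σ k}
    (hP : IsLocalRep f x P) (hQ : IsLocalRep f x Q) {y : τ → k} {F : MvPolynomial σ k}
    (hF : F ∈ localPart (vanishingIdeal X ⊔ Ideal.span (Set.range (fiberEquation y P))) x.1) :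
    F ∈ localPart (vanishingIdeal X ⊔ Ideal.span (Set.range (fiberEquation y Q))) x.1 := by
  obtain ⟨H, hH, hHF⟩ := hF
  obtain ⟨c, hc⟩ := Function.ne_iff.mp hQ.ne_zero
  refine ⟨Q c * H, by rw [map_mul]; exact mul_ne_zero hc hH, ?_⟩
  have key : ∀ F ∈ vanishingIdeal X ⊔ Ideal.span (Set.range (fiberEquation y P)),
      Q c * F ∈ vanishingIdeal X ⊔ Ideal.span (Set.range (fiberEquation y Q)) := by
    intro F hF
    obtain ⟨A, hA, D, hD, rfl⟩ := Submodule.mem_sup.mp hF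
    rw [mul_add]
    refine add_mem (Ideal.mem_sup_left (Ideal.mul_mem_left _ _ hA)) ?_
    clear hF hHF
    induction hD using Submodule.span_induction with
    | mem D hD =>
      obtain ⟨⟨i, j⟩, rfl⟩ := hD
      have h1 : Q c * fiberEquation y P (i, j) =
          (C (y i) * (P j * Q c - P c * Q j) - C (y j) * (P i * Q c - P c * Q i)) +
            P c * fiberEquation y Q (i, j) := by
        simp only [fiberEquation]
        ring
      rw [h1]
      exact Submodule.add_mem_sup (sub_mem
        (Ideal.mul_mem_left _ _ (h.mul_sub_mul_mem hP hQ _ _))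
        (Ideal.mul_mem_left _ _ (h.mul_sub_mul_mem hP hQ _ _)))
        (Ideal.mul_mem_left _ _ (Ideal.subset_span ⟨_, rfl⟩))
    | zero => rw [mul_zero]; exact zero_mem _
    | add D D' _ _ h1 h2 => rw [mul_add]; exact add_mem h1 h2
    | smul r D _ h1 =>
      rw [smul_eq_mul, mul_left_comm]
      exact Ideal.mul_mem_left _ _ h1
  rw [mul_assoc]
  exact key _ hHF

/-- Transfer from the chart `G ≠ 0` to the open set `P c ≠ 0`. On the latter, the product `G * P a`
is not a zero divisor modulo the ideal of a general fibre, so a polynomial that vanishes on the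
fibre where this product is invertible vanishes on the fibre throughout `P c ≠ 0`. -/
theorem exists_pow_mul_mem_of_rep (h : IsMapChart X G π f g a) (hX : IsProjectiveVariety X)
    (hUX : U ⊆ X) {x : U} {P : τ → MvPolynomial σ k} (hP : IsLocalRep f x P) {c : τ}
    (hc : P c ∉ vanishingIdeal X) :
    ∃ (H : MvPolynomial τ k) (d : ℕ), H.IsHomogeneous d ∧ aeval g H ≠ 0 ∧ ∀ y : τ → k,
      (∀ Q d, Q.IsHomogeneous d → aeval g Q = 0 → eval y Q = 0) → eval y H ≠ 0 →
      ∀ F, π F ∈ minorIdeal y g →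
        ∃ e, P c ^ e * F ∈ vanishingIdeal X ⊔ Ideal.span (Set.range (fiberEquation y P)) := by
  have hdom := hX.isDomain_away hc
  have hft : Algebra.FiniteType k
      (Localization.Away (Ideal.Quotient.mk (vanishingIdeal X) (P c))) := inferInstance
  set π' := awayHom X (P c)
  have h0 : ∀ F, π' F = 0 ↔ F ∈ vanishingIdeal X := awayHom_eq_zero_iff hX hc
  obtain ⟨u, hu⟩ : IsUnit (π' (P c)) := isUnit_awayHom X (P c)
  let g' := (↑u⁻¹ : Localization.Away (Ideal.Quotient.mk (vanishingIdeal X) (P c))) •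
    fun j => π' (P j)
  have hg' : ∀ j, π' (P j) = π' (P c) * g' j := fun j => by
    rw [← hu]
    simp [g']
  have hgc : g' c = 1 := by
    simp [g', ← hu]
  have hg0 : ∀ (Q : MvPolynomial τ k) d, Q.IsHomogeneous d → aeval g' Q = 0 → aeval g Q = 0 := by
    intro Q d hQ hQ0
    rw [aeval_smul_of_isHomogeneous hQ, ← comp_aeval_apply,
      (Units.isUnit _).pow d |>.mul_right_eq_zero, h0, h.aeval_rep_mem_iff hUX hP hQ] at hQ0
    exact hQ0
  have hg1 : ∀ (Q : MvPolynomial τ k) d, Q.IsHomogeneous d → aeval g Q = 0 → aeval g' Q = 0 := by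
    intro Q d hQ hQ0
    rw [aeval_smul_of_isHomogeneous hQ, ← comp_aeval_apply,
      (h0 _).mpr ((h.aeval_rep_mem_iff hUX hP hQ).mpr hQ0), mul_zero]
  have hGP : π' (G * P a) ≠ 0 := by
    rw [ne_eq, h0, ← h.map_eq_zero_iff, map_mul]
    exact mul_ne_zero h.isUnit.ne_zero (by
      rw [ne_eq, h.map_eq_zero_iff]
      exact h.rep_notMem hUX hP)
  obtain ⟨H, d, hH, hH0, hy⟩ := exists_isHomogeneous_forall_minorIdeal (k := k) g' hgc hGP
  refine ⟨H, d, hH, fun h1 => hH0 (hg1 H d hH h1), fun y hyQ hyH F hF => ?_⟩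
  obtain ⟨-, hreg, -⟩ := hy y (fun Q d hQ hQ0 => hyQ Q d hQ (hg0 Q d hQ hQ0)) hyH
  have h1 : π (P a * F) ∈ (Ideal.span (Set.range (fiberEquation y P))).map π := by
    rw [span_fiberEquation y P (h.map_rep hP), map_mul]
    exact Ideal.mul_mem_mul (Ideal.mem_span_singleton_self _) hF
  obtain ⟨e, he⟩ := exists_pow_mul_mem_of_mem_map h.map_eq_zero_iff h.exists_eq h1
  have hmap : (Ideal.span (Set.range (fiberEquation y P))).map π' = minorIdeal y g' := by
    rw [span_fiberEquation y P hg', Ideal.span_singleton_eq_top.mpr ⟨u, hu⟩, Ideal.top_mul]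
  have h2 : π' (G ^ e * (P a * F)) ∈ minorIdeal y g' := by
    obtain ⟨A, hA, D, hD, hAD⟩ := Submodule.mem_sup.mp he
    rw [← hAD, map_add, (h0 A).mpr hA, zero_add, ← hmap]
    exact Ideal.mem_map_of_mem _ hD
  have h3 : ∀ (n : ℕ) b, π' (G * P a) ^ n * b ∈ minorIdeal y g' → b ∈ minorIdeal y g' := by
    intro n
    induction n with
    | zero => intro b hb; rwa [pow_zero, one_mul] at hb
    | succ n ih => intro b hb; exact hreg _ (ih _ (by rwa [pow_succ, mul_assoc] at hb))
  have h4 : π' F ∈ minorIdeal y g' := by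
    refine h3 (e + 1) _ ?_
    have h5 := Ideal.mul_mem_left _ (π' (G * P a ^ e)) h2
    rw [← map_mul, show G * P a ^ e * (G ^ e * (P a * F)) = (G * P a) ^ (e + 1) * F by ring] at h5
    rwa [map_mul, map_pow] at h5
  rw [← hmap] at h4
  exact exists_pow_mul_mem_of_mem_map h0 (exists_awayHom_eq X (P c)) h4

/-- Otherwise the colon ideal of `minorIdeal` by `π F` is proper and has a zero `χ`. This is a point
of the fibre, and local membership of `F` there gives an element of the colon ideal that does not
vanish at `χ`. -/
theorem mem_of_mem_fiberIdeal (h : IsMapChart X G π f g a)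
    (hrep : ∀ x : U, ∃ P, IsLocalRep f x P)
    {y : PSpace k τ} (hya : y.rep a ≠ 0) {F : MvPolynomial σ k} (hF : F ∈ fiberIdeal X f y) :
    π F ∈ minorIdeal y.rep g := by
  have : Algebra.FiniteType k B := h.finiteType
  by_contra hnot
  have hne : (minorIdeal y.rep g).colon {π F} ≠ ⊤ := fun htop => hnot (by
    have h1 := Submodule.mem_colon_singleton.mp
      ((Ideal.eq_top_iff_one _).mp htop)
    rwa [one_smul] at h1)
  obtain ⟨χ, hχ⟩ := exists_algHom_of_ne_top (k := k) _ hne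
  have hχ' : ∀ b ∈ minorIdeal y.rep g, χ b = 0 := fun b hb =>
    hχ b (Submodule.mem_colon_singleton.mpr (Ideal.mul_mem_right _ _ hb))
  obtain ⟨hv, hu, h0, hf⟩ := h.map_mk χ
  have hy : f ⟨_, hu⟩ = y := by
    rw [hf]
    conv_rhs => rw [← y.mk_rep]
    rw [Projectivization.mk_eq_mk_iff']
    -- At `χ` the fibre equations for the pairs `(a, c)` say that `y.rep` is `y.rep a` times the
    -- vector of values of `g`.
    refine ⟨(y.rep a)⁻¹, funext fun c => ?_⟩
    have h1 := hχ' _ (Ideal.subset_span ⟨(a, c), rfl⟩)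
    simp only [h.apply_eq_one, map_sub, map_smul, map_one, smul_eq_mul, mul_one] at h1
    rw [Pi.smul_apply, smul_eq_mul, ← sub_eq_zero.mp h1, inv_mul_cancel_left₀ hya]
  obtain ⟨P, hP⟩ := hrep ⟨_, hu⟩
  simp only [fiberIdeal, Submodule.mem_iInf] at hF
  obtain ⟨d, hd⟩ := hP.homogeneous
  have hF' : F ∈ localPart (vanishingIdeal X ⊔ Ideal.span (Set.range (fiberEquation y.rep P)))
      (Projectivization.mk k (chartPoint π χ) hv) := hF ⟨_, hu⟩ hy P hP
  obtain ⟨H, e, hH, hHx, hHF⟩ := exists_isHomogeneous_mul_mem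
    (fun A hA => homogeneousComponent_mem_sup_span (fiberEquation y.rep P) (d := d)
      (fun ij => by
        have h1 : ∀ c j, (C c * P j).IsHomogeneous d := fun c j => by
          simpa using (isHomogeneous_C _ c).mul (hd j)
        exact (h1 _ _).sub (h1 _ _)) hA) hF'
  have hHv := (eval_rep_mk_ne_zero_iff hH _ hv).mp hHx
  rw [eval_chartPoint] at hHv
  refine hHv (hχ _ (Submodule.mem_colon_singleton.mpr ?_))
  rw [smul_eq_mul, ← map_mul]
  obtain ⟨A, hA, D, hD, hAD⟩ := Submodule.mem_sup.mp hHF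
  rw [← hAD, map_add, (h.map_eq_zero_iff A).mpr hA, zero_add]
  have h2 : (Ideal.span (Set.range (fiberEquation y.rep P))).map π ≤ minorIdeal y.rep g := by
    rw [span_fiberEquation y.rep P (h.map_rep hP)]
    exact Ideal.mul_le_right (J := minorIdeal y.rep g)
  exact h2 (Ideal.mem_map_of_mem π hD)

/-- For general `y`, the closure of the fibre over `y` is computed in an affine chart. -/
theorem exists_forall_mem_fiberIdeal_iff (h : IsMapChart X G π f g a) (hX : IsProjectiveVariety X)
    (hUX : U ⊆ X) (hrep : ∀ x : U, ∃ P, IsLocalRep f x P) :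
    ∃ (H : MvPolynomial τ k) (d : ℕ), H.IsHomogeneous d ∧ aeval g H ≠ 0 ∧
      ∀ y ∈ closure (Set.range f), eval y.rep H ≠ 0 → ∃ χ : B →ₐ[k] k,
        (∃ h, y = Projectivization.mk k (fun c => χ (g c)) h) ∧ ∀ F, F ∈ fiberIdeal X f y ↔
          π F ∈ Ideal.span (Set.range fun c => g c - algebraMap k B (χ (g c))) := by
  have : Algebra.FiniteType k B := h.finiteType
  obtain ⟨S, hS, hcov⟩ := exists_finite_reps hrep
  obtain ⟨H₀, d₀, hH₀, hgH₀, hy₀⟩ := exists_isHomogeneous_forall_minorIdeal (k := k) g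
    h.apply_eq_one (one_ne_zero : (1 : B) ≠ 0)
  have key : ∀ s : S, ∃ (H : MvPolynomial τ k) (d : ℕ), H.IsHomogeneous d ∧ aeval g H ≠ 0 ∧
      ∀ y : τ → k, (∀ Q d, Q.IsHomogeneous d → aeval g Q = 0 → eval y Q = 0) → eval y H ≠ 0 →
      ∀ F, π F ∈ minorIdeal y g → ∃ e, s.1.1 s.1.2 ^ e * F ∈
        vanishingIdeal X ⊔ Ideal.span (Set.range (fiberEquation y s.1.1)) := by
    rintro ⟨s, hs⟩
    obtain ⟨x, hx, hx0⟩ := hS s hs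
    refine h.exists_pow_mul_mem_of_rep hX hUX hx fun hmem => hx0 ?_
    simpa using hmem x.1 (hUX x.2) 1
  choose H d hH hgH hy using key
  refine ⟨H₀ * ∏ s, H s, _, hH₀.mul (IsHomogeneous.prod _ _ _ fun s _ => hH s), ?_, ?_⟩
  · rw [map_mul, map_prod]
    exact mul_ne_zero hgH₀ (Finset.prod_ne_zero_iff.mpr fun s _ => hgH s)
  intro y hyf hyH
  rw [map_mul, map_prod] at hyH
  have hyQ : ∀ Q d, Q.IsHomogeneous d → aeval g Q = 0 → eval y.rep Q = 0 :=
    fun Q d hQ hQ0 => h.eval_rep_eq_zero_of_mem_closure hUX hrep hyf hQ hQ0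
  obtain ⟨hya, -, htop⟩ := hy₀ y.rep hyQ (left_ne_zero_of_mul hyH)
  obtain ⟨χ, hχ⟩ := exists_algHom_of_ne_top (k := k) _ htop
  have hmin := minorIdeal_eq hya h.apply_eq_one (k := k)
  have hχg : ∀ c, χ (g c) = y.rep c / y.rep a := fun c => by
    have h1 := hχ (g c - algebraMap k B (y.rep c / y.rep a))
      (hmin ▸ Ideal.subset_span ⟨c, rfl⟩)
    rwa [map_sub, AlgHom.commutes, sub_eq_zero] at h1
  refine ⟨χ, ⟨?_, ?_⟩, fun F => ?_⟩
  · exact Function.ne_iff.mpr ⟨a, by simp [h.apply_eq_one]⟩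
  · conv_lhs => rw [← y.mk_rep]
    rw [Projectivization.mk_eq_mk_iff']
    refine ⟨y.rep a, funext fun c => ?_⟩
    rw [Pi.smul_apply, smul_eq_mul, hχg, mul_div_cancel₀ _ hya]
  simp only [hχg]
  rw [← hmin]
  refine ⟨h.mem_of_mem_fiberIdeal hrep hya, fun hF => ?_⟩
  simp only [fiberIdeal, Submodule.mem_iInf]
  intro x hx P hP
  obtain ⟨s, hs, hsx⟩ := hcov x
  obtain ⟨x', hx', -⟩ := hS s hs
  -- A representation at `x'` is valid at every point where its polynomials do not all vanish, in
  -- particular at `x`.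
  have hs' : IsLocalRep f x s.1 :=
    ⟨hx'.homogeneous, Function.ne_iff.mpr ⟨s.2, hsx⟩, hx'.eq_mk⟩
  refine h.mem_localPart_of_rep hs' hP ?_
  obtain ⟨e, he⟩ := hy ⟨s, hs⟩ y.rep hyQ
    (Finset.prod_ne_zero_iff.mp (right_ne_zero_of_mul hyH) _ (Finset.mem_univ _)) F hF
  exact ⟨_, by rw [map_pow]; exact pow_ne_zero _ hsx, he⟩

end IsMapChart

end FiberChart

/-! ### Tangent vectors as derivations at points, and vectors along which a map is stationary -/

section PointDerivation

open MvPolynomial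

variable {k : Type*} [Field k] {σ : Type*} {B : Type*} [CommRing B] [Algebra k B]

/-- `D` is a tangent vector at the `k`-point `χ` of the spectrum of `B`. -/
def IsPointDerivation (χ : B →ₐ[k] k) (D : B →ₗ[k] k) : Prop :=
  ∀ a b, D (a * b) = χ a * D b + χ b * D a

/-- A tangent vector as a point with values in the dual numbers. -/
noncomputable def IsPointDerivation.toAlgHom {χ : B →ₐ[k] k} {D : B →ₗ[k] k}
    (hD : IsPointDerivation χ D) : B →ₐ[k] DualNumber k :=
  AlgHom.ofLinearMap
    (TrivSqZeroExt.inlAlgHom k k k ∘ₗ χ.toLinearMap + TrivSqZeroExt.inrHom k k ∘ₗ D)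
    (by
      have h1 := hD 1 1
      simp only [mul_one, map_one, one_mul] at h1
      have h2 : D 1 = 0 := by linear_combination -h1
      ext <;> simp [h2])
    (fun a b => by
      ext
      · simp
      · simp [hD a b, mul_comm])

theorem IsPointDerivation.toAlgHom_apply {χ : B →ₐ[k] k} {D : B →ₗ[k] k}
    (hD : IsPointDerivation χ D) (b : B) :
    hD.toAlgHom b = TrivSqZeroExt.inl (χ b) + TrivSqZeroExt.inr (D b) := rfl

theorem IsPointDerivation.map_algebraMap {χ : B →ₐ[k] k} {D : B →ₗ[k] k}
    (hD : IsPointDerivation χ D) (c : k) : D (algebraMap k B c) = 0 := by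
  have h1 := hD.toAlgHom.commutes c
  rw [hD.toAlgHom_apply, AlgHom.commutes] at h1
  simpa [TrivSqZeroExt.algebraMap_eq_inl'] using congrArg TrivSqZeroExt.snd h1

/-- The directional derivative of a polynomial. -/
noncomputable def dirDeriv [Fintype σ] (v t : σ → k) (F : MvPolynomial σ k) : k :=
  ∑ i, eval v (pderiv i F) * t i

theorem IsPointDerivation.apply_map [Fintype σ] {χ : B →ₐ[k] k} {D : B →ₗ[k] k}
    (hD : IsPointDerivation χ D) (π : MvPolynomial σ k →ₐ[k] B) (F : MvPolynomial σ k) :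
    D (π F) = dirDeriv (chartPoint π χ) (fun i => D (π (X i))) F := by
  have h1 := aeval_dualNumber (chartPoint π χ) (fun i => D (π (X i))) F
  have h2 : aeval (fun i => (TrivSqZeroExt.inl (chartPoint π χ i) +
      TrivSqZeroExt.inr (D (π (X i))) : DualNumber k)) = hD.toAlgHom.comp π := by
    ext i <;> simp [hD.toAlgHom_apply, chartPoint]
  rw [h2] at h1
  simpa [hD.toAlgHom_apply, dirDeriv, aeval_eq_eval] using congrArg TrivSqZeroExt.snd h1

theorem isPointDerivation_snd {χ : B →ₐ[k] k} (χ' : B →ₐ[k] DualNumber k)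
    (h : ∀ b, (χ' b).fst = χ b) :
    IsPointDerivation χ (TrivSqZeroExt.sndHom k k ∘ₗ χ'.toLinearMap) := by
  intro a b
  simp [h, mul_comm]

/-- A tangent vector is a dual-number point of the cone. The universal property of the chart extends
it to `B`, and the second component is a derivation at `χ`. -/
theorem IsAffineChart.mem_coneTangent_iff [Fintype σ] {X : Set (PSpace k σ)} {G : MvPolynomial σ k}
    {π : MvPolynomial σ k →ₐ[k] B} (h : IsAffineChart X G π) {χ : B →ₐ[k] k} {t : σ → k} :
    t ∈ coneTangent X (chartPoint π χ) ↔
      ∃ D : B →ₗ[k] k, IsPointDerivation χ D ∧ ∀ i, D (π (MvPolynomial.X i)) = t i := by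
  constructor
  · intro ht
    rw [mem_coneTangent_iff_aeval (h.chartPoint_mem_cone χ)] at ht
    obtain ⟨χ', hχ'⟩ := h.exists_lift _ ht (by
      rw [aeval_dualNumber, TrivSqZeroExt.isUnit_iff_isUnit_fst]
      simpa [aeval_eq_eval] using h.eval_chartPoint_ne_zero χ)
    have hfst : ∀ b, (χ' b).fst = χ b := by
      intro b
      have h1 : (TrivSqZeroExt.fstHom k k k).comp χ' = χ := h.algHom_ext fun i => by
        simp [hχ', chartPoint]
      exact DFunLike.congr_fun h1 b
    refine ⟨_, isPointDerivation_snd χ' hfst, fun i => ?_⟩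
    simp [hχ']
  · rintro ⟨D, hD, hDt⟩ F hF
    have h1 := hD.apply_map π F
    rw [(h.map_eq_zero_iff F).mpr hF, map_zero] at h1
    simp only [hDt] at h1
    exact h1.symm

/-- The vectors along which the functions `g` on an affine chart are constant to first order. -/
def constantTangent {ι : Type*} (π : MvPolynomial σ k →ₐ[k] B) (χ : B →ₐ[k] k) (g : ι → B) :
    Submodule k (σ → k) where
  carrier := {t | ∃ D : B →ₗ[k] k, IsPointDerivation χ D ∧ (∀ i, D (π (X i)) = t i) ∧
    ∀ i, D (g i) = 0}
  add_mem' := by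
    rintro s t ⟨D, hD, hDs, hDg⟩ ⟨E, hE, hEt, hEg⟩
    refine ⟨D + E, fun a b => ?_, fun i => ?_, fun i => ?_⟩
    · simp only [LinearMap.add_apply, hD a b, hE a b]
      ring
    · simp [hDs, hEt]
    · simp [hDg, hEg]
  zero_mem' := ⟨0, fun a b => by simp, fun i => by simp, fun i => by simp⟩
  smul_mem' := by
    rintro c t ⟨D, hD, hDt, hDg⟩
    refine ⟨c • D, fun a b => ?_, fun i => ?_, fun i => ?_⟩
    · simp only [LinearMap.smul_apply, hD a b, smul_eq_mul]
      ring
    · simp [hDt]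
    · simp [hDg]

/-- Minors are polynomials in the entries, and conversely a matrix with an identity block is
determined by its minors over any ring. Applied over the quotient rings, this shows that Plücker
coordinates and matrix entries cut out the same scheme-theoretic fibre. -/
theorem span_minors_sub_eq {m M : ℕ} {K : Matrix (Fin m) (Fin M) B} {c : Fin m ↪o Fin M}
    (hK : K.submatrix id c = 1) (χ : B →ₐ[k] k) :
    Ideal.span (Set.range fun s : Fin m ↪o Fin M =>
        (K.submatrix id s).det - algebraMap k B (χ (K.submatrix id s).det)) =
      Ideal.span (Set.range fun ij : Fin m × Fin M =>
        K ij.1 ij.2 - algebraMap k B (χ (K ij.1 ij.2))) := by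
  have hdet : ∀ {C : Type _} [CommRing C] (φ : B →+* C) (s : Fin m ↪o Fin M),
      φ (K.submatrix id s).det = ((K.map φ).submatrix id s).det := fun φ s => by
    rw [RingHom.map_det]
    rfl
  apply le_antisymm
  · refine Ideal.span_le.mpr ?_
    rintro _ ⟨s, rfl⟩
    set 𝔫 := Ideal.span (Set.range fun ij : Fin m × Fin M =>
        K ij.1 ij.2 - algebraMap k B (χ (K ij.1 ij.2)))
    change _ ∈ 𝔫
    rw [← Ideal.Quotient.eq_zero_iff_mem, map_sub, sub_eq_zero]
    rw [hdet (Ideal.Quotient.mk 𝔫)]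
    change _ = ((Ideal.Quotient.mk 𝔫).comp ((algebraMap k B).comp (χ : B →+* k))) _
    rw [hdet]
    congr 2
    ext i j
    exact Ideal.Quotient.eq.mpr (Ideal.subset_span ⟨(i, j), rfl⟩)
  · set 𝔫 := Ideal.span (Set.range fun s : Fin m ↪o Fin M =>
        (K.submatrix id s).det - algebraMap k B (χ (K.submatrix id s).det))
    refine Ideal.span_le.mpr ?_
    rintro _ ⟨⟨i, j⟩, rfl⟩
    have h1 : ∀ φ : B →+* B ⧸ 𝔫, (K.map φ).submatrix id c = 1 := fun φ => by
      rw [Matrix.submatrix_map, hK, Matrix.map_one _ (map_zero φ) (map_one φ)]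
    have h2 := eq_of_minors_eq c (h1 (Ideal.Quotient.mk 𝔫))
      (h1 ((Ideal.Quotient.mk 𝔫).comp ((algebraMap k B).comp (χ : B →+* k)))) fun s => by
        rw [← hdet, ← hdet]
        exact Ideal.Quotient.eq.mpr (Ideal.subset_span ⟨s, rfl⟩)
    exact Ideal.Quotient.eq.mp (congrFun (congrFun h2 i) j)

/-- By the product rule, a derivation at `χ` kills the functions `g i` if and only if it vanishes on
the ideal generated by the `g i - χ (g i)`. This ideal is the same for minors and for entries. -/
theorem constantTangent_minors {m M : ℕ} {K : Matrix (Fin m) (Fin M) B} {c : Fin m ↪o Fin M}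
    (hK : K.submatrix id c = 1) (π : MvPolynomial σ k →ₐ[k] B) (χ : B →ₐ[k] k) :
    constantTangent π χ (fun s : Fin m ↪o Fin M => (K.submatrix id s).det) =
      constantTangent π χ (fun ij : Fin m × Fin M => K ij.1 ij.2) := by
  have key : ∀ {ι : Type _} (g : ι → B) (t : σ → k), t ∈ constantTangent π χ g ↔
      ∃ D : B →ₗ[k] k, IsPointDerivation χ D ∧ (∀ i, D (π (X i)) = t i) ∧
        ∀ b ∈ Ideal.span (Set.range fun i => g i - algebraMap k B (χ (g i))), D b = 0 := by
    intro ι g t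
    refine exists_congr fun D => and_congr_right fun hD => and_congr_right fun _ => ?_
    constructor
    · intro h b hb
      have h2 : D b = 0 ∧ χ b = 0 := by
        induction hb using Submodule.span_induction with
        | mem x hx =>
          obtain ⟨i, rfl⟩ := hx
          simp [h, hD.map_algebraMap]
        | zero => simp
        | add x y _ _ hx hy => simp [hx, hy]
        | smul r x _ hx => simp [hD r x, hx]
      exact h2.1
    · intro h i
      have h2 := h _ (Ideal.subset_span ⟨i, rfl⟩)
      simpa [hD.map_algebraMap] using h2
  ext t
  rw [key, key, span_minors_sub_eq hK]

end PointDerivation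

/-! ### The rank of the Gauss map in a chart with a normalized frame -/

section FrameChart

open MvPolynomial

variable {k : Type*} [Field k] {B : Type*} [CommRing B] [Algebra k B] {N : ℕ}

/-- An affine chart of `X`, with a frame of the tangent spaces of the cone over `X` that is
normalized to be the unit matrix in the columns `c`. -/
structure IsFrameChart (X : Set (PSpace k (Fin (N + 1)))) (G : MvPolynomial (Fin (N + 1)) k)
    (π : MvPolynomial (Fin (N + 1)) k →ₐ[k] B) (c : Fin (dim X + 1) ↪o Fin (N + 1))
    (K : Matrix (Fin (dim X + 1)) (Fin (N + 1)) B) : Prop extends IsAffineChart X G π where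
  submatrix_eq : K.submatrix id c = 1
  coneTangent_eq : ∀ χ : B →ₐ[k] k,
    coneTangent X (chartPoint π χ) = Submodule.span k (Set.range fun i j => χ (K i j))

namespace IsFrameChart

variable {X : Set (PSpace k (Fin (N + 1)))} {G : MvPolynomial (Fin (N + 1)) k}
    {π : MvPolynomial (Fin (N + 1)) k →ₐ[k] B} {c : Fin (dim X + 1) ↪o Fin (N + 1)}
    {K : Matrix (Fin (dim X + 1)) (Fin (N + 1)) B}

theorem map_apply_pivot (h : IsFrameChart X G π c K) (χ : B →ₐ[k] k) (i j) :
    χ (K i (c j)) = (1 : Matrix _ _ k) i j := by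
  have h1 := congrFun (congrFun h.submatrix_eq i) j
  rw [Matrix.submatrix_apply, id] at h1
  rw [h1, Matrix.one_apply, Matrix.one_apply]
  split_ifs <;> simp

theorem linearIndependent (h : IsFrameChart X G π c K) (χ : B →ₐ[k] k) :
    LinearIndependent k (fun i j => χ (K i j)) := by
  rw [Fintype.linearIndependent_iff]
  intro a ha i
  have h1 := congrFun ha (c i)
  simpa [Finset.sum_apply, h.map_apply_pivot, Matrix.one_apply] using h1

theorem finrank_coneTangent (h : IsFrameChart X G π c K) (χ : B →ₐ[k] k) :
    Module.finrank k (coneTangent X (chartPoint π χ)) = dim X + 1 := by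
  rw [h.coneTangent_eq, finrank_span_eq_card (h.linearIndependent χ), Fintype.card_fin]

theorem isMapChart [Infinite k] (h : IsFrameChart X G π c K) (hX : IsProjectiveVariety X) :
    IsMapChart X G π (gaussMap X)
      (fun s : Fin (dim X + 1) ↪o Fin (N + 1) => (K.submatrix id s).det) c := by
  refine ⟨h.toIsAffineChart, by rw [h.submatrix_eq, Matrix.det_one], fun χ => ?_⟩
  have hv := h.chartPoint_ne_zero χ
  obtain ⟨hs, h0, hg⟩ := gaussMap_eq_mk hX (h.chartPoint_mem_cone χ) hv (K.map χ)
    (h.coneTangent_eq χ) (h.finrank_coneTangent χ)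
  have h1 : minors (K.map χ) = fun s : Fin (dim X + 1) ↪o Fin (N + 1) =>
      χ (K.submatrix id s).det := by
    funext s
    rw [AlgHom.map_det]
    rfl
  exact ⟨hv, hs, h1 ▸ h0, by rw [hg]; congr⟩

variable [IsAlgClosed k] [IsDomain B]

/-- Write `P = P c • g` with `g c = 1` in the chart. The derivative of `P` is proportional to `P` if
and only if that of `g` vanishes, so the kernel of the differential consists of the vectors along
which the frame is stationary. The radial direction belongs to this kernel, since the differential
is taken on the cone. -/
theorem finrank_range_differential_add (h : IsFrameChart X G π c K) (hX : IsProjectiveVariety X)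
    {x : smoothLocus X}
    {P : (Fin (dim X + 1) ↪o Fin (N + 1)) → MvPolynomial (Fin (N + 1)) k}
    (hP : IsLocalRep (gaussMap X) x P) {χ : B →ₐ[k] k} (hχ : chartPoint π χ = x.1.rep) :
    Module.finrank k (LinearMap.range (differential X P x.1)) +
      Module.finrank k (constantTangent π χ fun ij : Fin (dim X + 1) × Fin (N + 1) =>
        K ij.1 ij.2) = dim X + 1 := by
  have hmap := h.isMapChart hX
  have hker : (LinearMap.ker (differential X P x.1)).map (embTangent X x.1).subtype =
      constantTangent π χ fun ij : Fin (dim X + 1) × Fin (N + 1) => K ij.1 ij.2 := by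
    rw [← constantTangent_minors h.submatrix_eq]
    set g := fun s : Fin (dim X + 1) ↪o Fin (N + 1) => (K.submatrix id s).det
    have hPg := hmap.map_rep hP
    have hgc : g c = 1 := hmap.apply_eq_one
    have hval : ∀ s, eval x.1.rep (P s) = χ (π (P c)) * χ (g s) := fun s => by
      rw [← hχ, eval_chartPoint, hPg, map_mul]
    have hpc : χ (π (P c)) ≠ 0 := fun h0 => hP.ne_zero (funext fun s => by
      rw [hval, h0, zero_mul]; rfl)
    have hdiff : ∀ (t : Fin (N + 1) → k) (ht : t ∈ embTangent X x.1),
        (⟨t, ht⟩ : embTangent X x.1) ∈ LinearMap.ker (differential X P x.1) ↔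
          ∃ a : k, ∀ s, a * eval x.1.rep (P s) = dirDeriv x.1.rep t (P s) := by
      intro t ht
      rw [LinearMap.mem_ker]
      change Submodule.Quotient.mk _ = _ ↔ _
      rw [Submodule.Quotient.mk_eq_zero, Submodule.mem_span_singleton]
      exact exists_congr fun a => funext_iff
    have hD1 : ∀ D : B →ₗ[k] k, IsPointDerivation χ D → D 1 = 0 := fun D hD => by
      simpa using hD.map_algebraMap 1
    have hDP : ∀ (D : B →ₗ[k] k) (t : Fin (N + 1) → k), IsPointDerivation χ D →
        (∀ i, D (π (MvPolynomial.X i)) = t i) → ∀ s, dirDeriv x.1.rep t (P s) =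
          χ (π (P c)) * D (g s) + χ (g s) * D (π (P c)) := by
      intro D t hD ht s
      rw [← hD, ← hPg, hD.apply_map, hχ]
      simp only [ht]
    have hemb : ∀ t, t ∈ embTangent X x.1 ↔ t ∈ coneTangent X (chartPoint π χ) := fun t => by
      rw [hχ]; rfl
    ext t
    constructor
    · rintro ⟨⟨t, ht⟩, htk, rfl⟩
      obtain ⟨a, ha⟩ := (hdiff t ht).mp htk
      obtain ⟨D, hD, hDt⟩ := h.mem_coneTangent_iff.mp ((hemb t).mp ht)
      refine ⟨D, hD, hDt, fun s => ?_⟩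
      have h1 := ha c
      have h2 := ha s
      rw [hDP D t hD hDt, hval, hgc, map_one, hD1 D hD] at h1
      rw [hDP D t hD hDt, hval] at h2
      have h3 : χ (π (P c)) * D (g s) = 0 := by linear_combination χ (g s) * h1 - h2
      exact (mul_eq_zero.mp h3).resolve_left hpc
    · rintro ⟨D, hD, hDt, hDg⟩
      have ht : t ∈ embTangent X x.1 := (hemb t).mpr (h.mem_coneTangent_iff.mpr ⟨D, hD, hDt⟩)
      refine ⟨⟨t, ht⟩, (hdiff t ht).mpr ⟨D (π (P c)) / χ (π (P c)), fun s => ?_⟩, rfl⟩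
      rw [hDP D t hD hDt, hval, hDg]
      field_simp
      ring
  rw [← hker, Submodule.finrank_map_subtype_eq, LinearMap.finrank_range_add_finrank_ker]
  exact x.2.2

theorem hasRank (h : IsFrameChart X G π c K) (hX : IsProjectiveVariety X) {ρ d : ℕ}
    {H : MvPolynomial (Fin (N + 1)) k} (hH : H.IsHomogeneous d) (hHX : H ∉ vanishingIdeal X)
    (hρ : ∀ χ : B →ₐ[k] k, eval (chartPoint π χ) H ≠ 0 →
      Module.finrank k (constantTangent π χ fun ij : Fin (dim X + 1) × Fin (N + 1) =>
        K ij.1 ij.2) + ρ = dim X + 1) :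
    HasRank X (gaussMap X) ρ := by
  obtain ⟨e, -, hG⟩ := h.isHomogeneous
  have hchart : ∀ x ∈ X, eval x.rep (G * H) ≠ 0 → ∃ χ : B →ₐ[k] k, chartPoint π χ = x.rep ∧
      eval (chartPoint π χ) H ≠ 0 := by
    intro x hx hGH
    rw [map_mul] at hGH
    obtain ⟨χ, hχ⟩ := h.exists_chartPoint_eq (rep_mem_cone hx) (left_ne_zero_of_mul hGH)
    exact ⟨χ, hχ, hχ ▸ right_ne_zero_of_mul hGH⟩
  refine ⟨{x | eval x.rep (G * H) ≠ 0}, isOpen_setOf_eval_ne_zero (hG.mul hH), ?_, ?_⟩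
  · have hGH : G * H ∉ vanishingIdeal X := by
      rw [← h.map_eq_zero_iff, map_mul]
      exact mul_ne_zero h.isUnit.ne_zero (by rwa [ne_eq, h.map_eq_zero_iff])
    rw [mem_vanishingIdeal_of_isHomogeneous (hG.mul hH)] at hGH
    push Not at hGH
    obtain ⟨x, hx, hx0⟩ := hGH
    obtain ⟨χ, hχ, -⟩ := hchart x hx hx0
    refine ⟨x, hx0, hx, ?_⟩
    have h1 := h.finrank_coneTangent χ
    rwa [hχ] at h1
  · intro x hx
    obtain ⟨P, hP⟩ := hX.exists_isLocalRep_gaussMap x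
    refine ⟨P, hP, ?_⟩
    obtain ⟨χ, hχ, hχH⟩ := hchart x.1 x.2.1 hx
    have h1 := h.finrank_range_differential_add hX hP hχ
    have h2 := hρ χ hχH
    omega

/-- If the frame is a quotient of homogeneous polynomials, then the rank of the Gauss map is
attained on the complement of a homogeneous polynomial. -/
theorem exists_finrank_constantTangent (h : IsFrameChart X G π c K)
    {K₀ : Matrix (Fin (dim X + 1)) (Fin (N + 1)) (MvPolynomial (Fin (N + 1)) k)}
    {δ : MvPolynomial (Fin (N + 1)) k} {e : ℕ} (hδ : δ.IsHomogeneous e)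
    (hK₀ : ∀ i j, (K₀ i j).IsHomogeneous e) (hδu : IsUnit (π δ))
    (hK : ∀ i j, π (K₀ i j) = π δ * K i j) :
    ∃ (ρ : ℕ) (H : MvPolynomial (Fin (N + 1)) k) (d : ℕ), H.IsHomogeneous d ∧
      H ∉ vanishingIdeal X ∧ ∀ χ : B →ₐ[k] k, eval (chartPoint π χ) H ≠ 0 →
        Module.finrank k (constantTangent π χ fun ij : Fin (dim X + 1) × Fin (N + 1) =>
          K ij.1 ij.2) + ρ = dim X + 1 := by
  -- The derivatives of the quotients `K₀ / δ` along the rows of `K₀`, cleared of denominators. Two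
  -- factors `δ` come from the quotient rule and one from the direction, whence the cube in `hmain`.
  let E : Matrix (Fin (dim X + 1) × Fin (N + 1)) (Fin (dim X + 1))
      (MvPolynomial (Fin (N + 1)) k) := Matrix.of fun ab i =>
    ∑ l, K₀ i l * (δ * pderiv l (K₀ ab.1 ab.2) - K₀ ab.1 ab.2 * pderiv l δ)
  have hE : ∀ ab i, (E ab i).IsHomogeneous (e + (e + (e - 1))) := fun ab i =>
    IsHomogeneous.sum Finset.univ (fun l => K₀ i l *
        (δ * pderiv l (K₀ ab.1 ab.2) - K₀ ab.1 ab.2 * pderiv l δ)) _ fun l _ =>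
      (hK₀ i l).mul ((hδ.mul (hK₀ _ _).pderiv).sub ((hK₀ _ _).mul hδ.pderiv))
  let Ev : (B →ₐ[k] k) → Matrix (Fin (dim X + 1) × Fin (N + 1)) (Fin (dim X + 1)) k :=
    fun χ => E.map (aeval (chartPoint π χ))
  have hrank : ∀ χ, Module.finrank k (constantTangent π χ
      fun ij : Fin (dim X + 1) × Fin (N + 1) => K ij.1 ij.2) + (Ev χ).rank = dim X + 1 := by
    intro χ
    have hδ0 : χ (π δ) ≠ 0 := (hδu.map χ).ne_zero
    have hinj : Function.Injective (Fintype.linearCombination k fun i j => χ (K i j)) :=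
      (h.linearIndependent χ).fintypeLinearCombination_injective
    have key : (LinearMap.ker (Ev χ).mulVecLin).map
        (Fintype.linearCombination k fun i j => χ (K i j)) =
        constantTangent π χ fun ij : Fin (dim X + 1) × Fin (N + 1) => K ij.1 ij.2 := by
      have hmain : ∀ (a : Fin (dim X + 1) → k) (D : B →ₗ[k] k), IsPointDerivation χ D →
          (∀ j, D (π (MvPolynomial.X j)) =
            Fintype.linearCombination k (fun i j => χ (K i j)) a j) →
          ∀ ab, (Ev χ).mulVec a ab = χ (π δ) ^ 3 * D (K ab.1 ab.2) := by
        intro a D hD hDt ab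
        have h1 := congrArg D (hK ab.1 ab.2)
        rw [hD, hD.apply_map, hD.apply_map] at h1
        have h2 : ∀ i l, eval (chartPoint π χ) (K₀ i l) = χ (π δ) * χ (K i l) := fun i l => by
          rw [eval_chartPoint, hK, map_mul]
        have h3 : ∀ F, dirDeriv (chartPoint π χ) (fun i => D (π (MvPolynomial.X i))) F =
            ∑ l, ∑ i, eval (chartPoint π χ) (pderiv l F) * (a i * χ (K i l)) := fun F => by
          simp only [dirDeriv, hDt, Fintype.linearCombination_apply, Finset.sum_apply,
            Pi.smul_apply, smul_eq_mul, Finset.mul_sum]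
        have h4 : (Ev χ).mulVec a ab = χ (π δ) * (χ (π δ) *
            (∑ l, ∑ i, eval (chartPoint π χ) (pderiv l (K₀ ab.1 ab.2)) * (a i * χ (K i l))) -
            χ (π δ) * χ (K ab.1 ab.2) *
              ∑ l, ∑ i, eval (chartPoint π χ) (pderiv l δ) * (a i * χ (K i l))) := by
          simp only [Matrix.mulVec, dotProduct, Ev, E, Matrix.map_apply, Matrix.of_apply,
            aeval_eq_eval, map_sum, map_mul, map_sub, h2, Finset.sum_mul, Finset.mul_sum,
            ← eval_chartPoint π χ δ, ← Finset.sum_sub_distrib]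
          rw [Finset.sum_comm]
          refine Finset.sum_congr rfl fun l _ => Finset.sum_congr rfl fun i _ => ?_
          ring
        rw [h4, ← h3, ← h3, h1]
        ring
      ext t
      constructor
      · rintro ⟨a, ha, rfl⟩
        have ht : Fintype.linearCombination k (fun i j => χ (K i j)) a ∈
            coneTangent X (chartPoint π χ) := by
          rw [h.coneTangent_eq, ← Fintype.range_linearCombination]
          exact ⟨a, rfl⟩
        obtain ⟨D, hD, hDt⟩ := h.mem_coneTangent_iff.mp ht
        refine ⟨D, hD, hDt, fun ab => ?_⟩
        have h1 := hmain a D hD hDt ab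
        rw [show (Ev χ).mulVec a ab = 0 from congrFun ha ab] at h1
        exact (mul_eq_zero.mp h1.symm).resolve_left (pow_ne_zero _ hδ0)
      · rintro ⟨D, hD, hDt, hDK⟩
        have ht := h.mem_coneTangent_iff.mpr ⟨D, hD, hDt⟩
        rw [h.coneTangent_eq, ← Fintype.range_linearCombination] at ht
        obtain ⟨a, rfl⟩ := ht
        refine ⟨a, ?_, rfl⟩
        rw [SetLike.mem_coe, LinearMap.mem_ker]
        funext ab
        exact (hmain a D hD hDt ab).trans (by rw [hDK, mul_zero]; rfl)
    rw [← key, (Submodule.equivMapOfInjective _ hinj _).finrank_eq.symm, add_comm,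
      Matrix.rank, LinearMap.finrank_range_add_finrank_ker, Module.finrank_fin_fun]
  obtain ⟨χ₁, -⟩ := h.exists_map_ne_zero (one_ne_zero : (1 : B) ≠ 0)
  -- The rank is attained at a point where it is maximal, and a non-zero minor there keeps it
  -- maximal on an open set.
  have hbdd : BddAbove (Set.range fun χ => (Ev χ).rank) :=
    ⟨dim X + 1, by rintro _ ⟨χ, rfl⟩; have := hrank χ; simp only; omega⟩
  obtain ⟨χ₀, hχ₀⟩ := Nat.sSup_mem (Set.range_nonempty_iff_nonempty.mpr ⟨χ₁⟩) hbdd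
  have hmax : ∀ χ, (Ev χ).rank ≤ (Ev χ₀).rank := fun χ => by
    have h1 := le_csSup hbdd ⟨χ, rfl⟩
    rwa [← hχ₀] at h1
  obtain ⟨a, b, hab⟩ := exists_submatrix_det_ne_zero (Ev χ₀) rfl
  refine ⟨(Ev χ₀).rank, (E.submatrix a b).det, _,
    isHomogeneous_det _ (fun _ => e + (e + (e - 1))) (fun i j => hE _ _), ?_, ?_⟩
  · intro hmem
    rw [det_submatrix_map, aeval_eq_eval] at hab
    exact hab (h.chartPoint_mem_cone χ₀ _ hmem)
  · intro χ hχ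
    have h1 := le_rank_of_submatrix_det_ne_zero (Ev χ) a b
      (by rwa [det_submatrix_map, aeval_eq_eval])
    rw [← le_antisymm (hmax χ) h1, hrank]

end IsFrameChart
end FrameChart

/-! ### Existence of framed charts and consequences of a constant frame -/

section FrameChartExistence

open MvPolynomial

variable {k : Type*} [Field k] {N : ℕ} {X : Set (PSpace k (Fin (N + 1)))}

/-- Divide a polynomial frame by its denominator `δ`. The linear form `L` is inverted as well: it
gives the localized form positive degree and will be the coordinate by which the graph is
homogenized. -/
theorem IsProjectiveVariety.exists_isFrameChart [PerfectField k] [Infinite k]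
    (hX : IsProjectiveVariety X) {L : MvPolynomial (Fin (N + 1)) k} (hL : L.IsHomogeneous 1)
    (hLX : L ∉ vanishingIdeal X) :
    ∃ (c : Fin (dim X + 1) ↪o Fin (N + 1))
      (K₀ : Matrix (Fin (dim X + 1)) (Fin (N + 1)) (MvPolynomial (Fin (N + 1)) k))
      (δ : MvPolynomial (Fin (N + 1)) k) (e : ℕ)
      (K : Matrix (Fin (dim X + 1)) (Fin (N + 1))
        (Localization.Away (Ideal.Quotient.mk (vanishingIdeal X) (δ * L)))),
      δ.IsHomogeneous e ∧ (∀ i j, (K₀ i j).IsHomogeneous e) ∧ δ * L ∉ vanishingIdeal X ∧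
      IsFrameChart X (δ * L) (awayHom X (δ * L)) c K ∧
      ∀ i j, awayHom X (δ * L) (K₀ i j) = awayHom X (δ * L) δ * K i j := by
  obtain ⟨x₀, hx₀⟩ := hX.smoothLocus_nonempty
  obtain ⟨c, K₀, δ, e, hδ, hK₀, hne, hc, hT⟩ := hX.exists_polynomial_frame hx₀
  have hδX : δ ∉ vanishingIdeal X := fun hmem => hne (by simpa using hmem x₀ hx₀.1 1)
  have hδL : δ * L ∉ vanishingIdeal X := fun hmem =>
    (hX.isPrime.mem_or_mem hmem).elim hδX hLX
  have hchart := isAffineChart_awayHom hX (Nat.succ_pos e) (hδ.mul hL) hδL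
  obtain ⟨u, hu⟩ : IsUnit (awayHom X (δ * L) δ) :=
    isUnit_of_mul_isUnit_left (by rw [← map_mul]; exact hchart.isUnit)
  have hK : ∀ i j, awayHom X (δ * L) (K₀ i j) =
      awayHom X (δ * L) δ * (↑u⁻¹ * awayHom X (δ * L) (K₀ i j)) := fun i j => by
    rw [← hu, Units.mul_inv_cancel_left]
  let K : Matrix (Fin (dim X + 1)) (Fin (N + 1))
      (Localization.Away (Ideal.Quotient.mk (vanishingIdeal X) (δ * L))) :=
    Matrix.of fun i j => ↑u⁻¹ * awayHom X (δ * L) (K₀ i j)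
  refine ⟨c, K₀, δ, e, K, hδ, hK₀, hδL, ⟨hchart, ?_, fun χ => ?_⟩, hK⟩
  · ext i j
    change ↑u⁻¹ * awayHom X (δ * L) (K₀ i (c j)) = _
    rw [hc, Matrix.one_apply]
    split_ifs
    · rw [← hu, Units.inv_mul]
    · rw [map_zero, mul_zero]
  · have hδ0 : χ (awayHom X (δ * L) δ) ≠ 0 := ((hu ▸ u.isUnit : IsUnit _).map χ).ne_zero
    obtain ⟨h1, -⟩ := hT _ (hchart.chartPoint_mem_cone χ) (by rwa [eval_chartPoint])
    have h2 : (fun i j => eval (chartPoint (awayHom X (δ * L)) χ) (K₀ i j)) =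
        fun i => Units.mk0 _ hδ0 • fun j => χ (↑u⁻¹ * awayHom X (δ * L) (K₀ i j)) := by
      funext i j
      rw [eval_chartPoint, hK, map_mul]
      rfl
    rw [h1, h2]
    apply le_antisymm
    · rw [Submodule.span_le]
      rintro _ ⟨i, rfl⟩
      exact Submodule.smul_mem _ _ (Submodule.subset_span ⟨i, rfl⟩)
    · rw [Submodule.span_le]
      rintro _ ⟨i, rfl⟩
      refine (Submodule.smul_mem_iff' _ (Units.mk0 _ hδ0)).mp ?_
      exact Submodule.subset_span ⟨i, rfl⟩

/-- A matrix that is normalized in some columns is determined by its row space. -/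
theorem eq_of_span_eq {m M : ℕ} {A A' : Fin m → Fin M → k} {c : Fin m → Fin M}
    (hA : ∀ i j, A i (c j) = (1 : Matrix (Fin m) (Fin m) k) i j)
    (hA' : ∀ i j, A' i (c j) = (1 : Matrix (Fin m) (Fin m) k) i j)
    (h : Submodule.span k (Set.range A) ≤ Submodule.span k (Set.range A')) : A = A' := by
  funext i
  have h1 : A i ∈ Submodule.span k (Set.range A') := h (Submodule.subset_span ⟨i, rfl⟩)
  rw [← Fintype.range_linearCombination] at h1
  obtain ⟨a, ha⟩ := h1
  have h2 : a = Pi.single i 1 := by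
    funext j
    have h3 := congrFun ha (c j)
    rw [Fintype.linearCombination_apply, Finset.sum_apply] at h3
    simp only [Pi.smul_apply, smul_eq_mul, hA, hA', Matrix.one_apply, mul_ite, mul_one, mul_zero,
      Finset.sum_ite_eq', Finset.mem_univ, if_true] at h3
    rw [h3, Pi.single_apply]
    simp only [eq_comm]
  rw [← ha, h2]
  simp [Fintype.linearCombination_apply_single]

variable {G : MvPolynomial (Fin (N + 1)) k} {B : Type*} [CommRing B] [Algebra k B]
    {π : MvPolynomial (Fin (N + 1)) k →ₐ[k] B} {c : Fin (dim X + 1) ↪o Fin (N + 1)}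
    {K : Matrix (Fin (dim X + 1)) (Fin (N + 1)) B}

/-- Tangent spaces are constant along the lines of the cone, and a normalized frame is determined by
the space it spans. The entries of `K` are thus functions on `X` itself. -/
theorem IsFrameChart.apply_eq_of_smul [Infinite k] (h : IsFrameChart X G π c K)
    {χ χ' : B →ₐ[k] k} {a : k} (ha : a ≠ 0) (hχ : chartPoint π χ' = a • chartPoint π χ) (i j) :
    χ' (K i j) = χ (K i j) := by
  have h1 := h.coneTangent_eq χ'
  rw [hχ, coneTangent_smul X _ ha, h.coneTangent_eq χ] at h1
  have h2 := eq_of_span_eq (A := fun i j => χ' (K i j)) (A' := fun i j => χ (K i j)) (c := c)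
    (h.map_apply_pivot χ') (h.map_apply_pivot χ) h1.symm.le
  exact congrFun (congrFun h2 i) j

theorem self_mem_coneTangent [Infinite k] {σ : Type*} [Fintype σ] {X : Set (PSpace k σ)}
    {v : σ → k} (hv : v ∈ cone X) : v ∈ coneTangent X v := by
  rw [mem_coneTangent_iff_isHomogeneous]
  intro F hF d hd
  have h1 := congrArg (eval v) hd.sum_X_mul_pderiv
  rw [map_sum, map_nsmul, hv F hF, smul_zero] at h1
  simpa [mul_comm] using h1

/-- The homogeneous coordinate ring then has `N + 1` generators and transcendence degree `N + 1`, so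
the generators are algebraically independent. -/
theorem eq_univ_of_dim_eq [Infinite k] (hX : IsProjectiveVariety X) (h : dim X = N) :
    X = Set.univ := by
  have := hX.isPrime
  have h1 : vanishingIdeal X = ⊥ := by
    have h2 := hX.trdeg_eq
    let S := MvPolynomial (Fin (N + 1)) k ⧸ vanishingIdeal X
    have hgen : Algebra.adjoin k (Set.range fun i => (Ideal.Quotient.mk (vanishingIdeal X)
        (MvPolynomial.X i) : S)) = ⊤ := by
      have h3 : (fun i => (Ideal.Quotient.mk (vanishingIdeal X) (MvPolynomial.X i) : S)) =
          (Ideal.Quotient.mkₐ k (vanishingIdeal X)) ∘ MvPolynomial.X := rfl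
      rw [h3, Set.range_comp, ← AlgHom.map_adjoin, MvPolynomial.adjoin_range_X,
        Algebra.map_top, AlgHom.range_eq_top]
      exact Ideal.Quotient.mkₐ_surjective _ _
    have : Algebra.IsAlgebraic (Algebra.adjoin k (Set.range fun i =>
        (Ideal.Quotient.mk (vanishingIdeal X) (MvPolynomial.X i) : S))) S := by
      rw [hgen]
      exact ⟨fun s => isAlgebraic_algebraMap (⟨s, trivial⟩ : (⊤ : Subalgebra k S))⟩
    have h4 : IsTranscendenceBasis k (fun i =>
        (Ideal.Quotient.mk (vanishingIdeal X) (MvPolynomial.X i) : S)) := by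
      refine Algebra.IsAlgebraic.isTranscendenceBasis_of_lift_le_trdeg_of_finite k _ ?_
      rw [Cardinal.mk_fin, Cardinal.lift_natCast]
      have h3 : ((N + 1 : ℕ) : Cardinal) ≤ Algebra.trdeg k S := by
        rcases lt_or_ge (Algebra.trdeg k S) Cardinal.aleph0 with h3 | h3
        · rw [← Cardinal.cast_toNat_of_lt_aleph0 h3, h2, h]
        · exact Cardinal.natCast_lt_aleph0.le.trans h3
      simpa using h3
    refine le_bot_iff.mp fun F hF => ?_
    have h5 := h4.1
    rw [algebraicIndependent_iff] at h5
    refine h5 F ?_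
    have h6 : aeval (fun i => (Ideal.Quotient.mk (vanishingIdeal X) (MvPolynomial.X i) : S)) =
      Ideal.Quotient.mkₐ k (vanishingIdeal X) := by ext; simp
    rw [h6]
    exact Ideal.Quotient.eq_zero_iff_mem.mpr hF
  ext x
  refine iff_of_true ?_ trivial
  have h2 := hX.mk_mem (v := x.rep) (fun F hF => by
    rw [h1, Ideal.mem_bot] at hF
    rw [hF, map_zero]) x.rep_nonzero
  rwa [x.mk_rep] at h2

/-- If all entries were constant, there would be a single tangent space. By Euler's relation it
contains the cone, so non-degeneracy makes it the whole space, and the dimension of `X` is that of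
the ambient space. -/
theorem IsFrameChart.exists_notMem_range [IsAlgClosed k] [IsDomain B] (h : IsFrameChart X G π c K)
    (hX : IsProjectiveVariety X) (hnd : IsNondegenerate X) (hne : X ≠ Set.univ) :
    ∃ i j, K i j ∉ (algebraMap k B).range := by
  by_contra hcon
  push Not at hcon
  choose κ hκ using hcon
  have hχ : ∀ (χ : B →ₐ[k] k) i j, χ (K i j) = κ i j := fun χ i j => by
    rw [← hκ, AlgHom.commutes]
    rfl
  have hT : ∀ χ : B →ₐ[k] k, coneTangent X (chartPoint π χ) = Submodule.span k (Set.range κ) := by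
    intro χ
    rw [h.coneTangent_eq]
    simp only [hχ]
  obtain ⟨χ₀, -⟩ := h.exists_map_ne_zero (one_ne_zero : (1 : B) ≠ 0)
  have htop : Submodule.span k (Set.range κ) = ⊤ := by
    by_contra hlt
    obtain ⟨f, hf, hfT⟩ := Submodule.exists_le_ker_of_lt_top _ (lt_top_iff_ne_top.mpr hlt)
    refine hf ?_
    have hfv : ∀ v, f v = ∑ i, f (Pi.single i 1) * v i := fun v => by
      conv_lhs => rw [pi_eq_sum_univ' v]
      simp [mul_comm]
    have hF : ∑ i, C (f (Pi.single i 1)) * MvPolynomial.X i ∈ vanishingIdeal X := by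
      rw [← h.map_eq_zero_iff]
      refine h.eq_zero_of_forall fun χ => ?_
      rw [← eval_chartPoint, map_sum]
      simp only [map_mul, eval_C, eval_X]
      rw [← hfv]
      exact hfT (hT χ ▸ self_mem_coneTangent (h.chartPoint_mem_cone χ))
    have h0 := hnd (fun i => f (Pi.single i 1)) fun x hx => by
      simpa using hF x hx 1
    ext i
    simpa using congrFun h0 i
  refine hne (eq_univ_of_dim_eq hX ?_)
  have h1 := h.finrank_coneTangent χ₀
  rw [hT, htop, finrank_top, Module.finrank_fin_fun] at h1
  omega

end FrameChartExistence

/-! ### Polynomial families whose derivatives span the linear forms -/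

section Polynomials

open MvPolynomial

variable {k : Type*} [Field k]

/-- The linear forms are combinations of the partial derivatives of the `q j`, and the `q j`
are linearly independent modulo polynomials of degree at most one. -/
structure IsSpanningFamily {ι : Type*} [Fintype ι] {m : ℕ} (q : Fin m → MvPolynomial ι k) :
    Prop where
  X_mem : ∀ l, X l ∈ Submodule.span k (Set.range fun lj : ι × Fin m => pderiv lj.1 (q lj.2))
  eq_zero : ∀ (a : ι → k) (b : Fin m → k) (d : k),
    ∑ l, a l • X l + ∑ j, b j • q j = C d → a = 0 ∧ b = 0

theorem IsSpanningFamily.rename {ι ι' : Type*} [Fintype ι] [Fintype ι'] {m : ℕ}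
    {q : Fin m → MvPolynomial ι k} (hq : IsSpanningFamily q) (e : ι ≃ ι') :
    IsSpanningFamily fun j => MvPolynomial.rename e (q j) := by
  constructor
  · intro l
    have h1 := Submodule.mem_map_of_mem (f := (MvPolynomial.rename (R := k) e).toLinearMap)
      (hq.X_mem (e.symm l))
    rw [Submodule.map_span, ← Set.range_comp] at h1
    simp only [AlgHom.toLinearMap_apply, rename_X, Equiv.apply_symm_apply] at h1
    refine Submodule.span_mono ?_ h1
    rintro _ ⟨⟨l', j⟩, rfl⟩
    exact ⟨(e l', j), by
      simp only [Function.comp_apply, AlgHom.toLinearMap_apply]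
      rw [pderiv_rename e.injective]⟩
  · intro a b d h
    have h1 := congrArg (MvPolynomial.rename e.symm) h
    simp only [map_add, map_sum, map_smul, rename_X, rename_C, rename_rename,
      Equiv.symm_comp_self, rename_id_apply] at h1
    rw [← Equiv.sum_comp e] at h1
    simp only [Equiv.symm_apply_apply] at h1
    obtain ⟨h2, h3⟩ := hq.eq_zero (a ∘ e) b d h1
    exact ⟨funext fun l => by simpa using congrFun h2 (e.symm l), h3⟩

/-- Derivatives at the origin isolate the linear coefficients. On the curve described by `ψ` the `q
j` become distinct powers of degree at least two, which isolates the others. -/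
theorem eq_zero_of_algHom_polynomial {ι : Type*} [Fintype ι] {m : ℕ} {q : Fin m → MvPolynomial ι k}
    (hq : ∀ l j, eval 0 (pderiv l (q j)) = 0) (ψ : MvPolynomial ι k →ₐ[k] Polynomial k)
    (hψ : ∀ j, ψ (q j) = Polynomial.X ^ ((j : ℕ) + 2)) (a : ι → k) (b : Fin m → k) (d : k)
    (h : ∑ l, a l • X l + ∑ j, b j • q j = C d) : a = 0 ∧ b = 0 := by
  classical
  have ha : a = 0 := by
    funext l
    have h1 := congrArg (fun F => eval 0 (pderiv l F)) h
    have hq' : ∀ l j, constantCoeff (pderiv l (q j)) = 0 := fun l j => by simpa using hq l j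
    simpa [hq', pderiv_X, Pi.single_apply, apply_ite, Finset.sum_ite_eq, smul_eval] using h1
  refine ⟨ha, funext fun j => ?_⟩
  have h1 := congrArg (fun F => (ψ F).coeff ((j : ℕ) + 2)) h
  have hC : ψ (C d) = Polynomial.C d := by rw [← algebraMap_eq, AlgHom.commutes]; rfl
  simp only [ha, Pi.zero_apply, zero_smul, Finset.sum_const_zero, zero_add, map_sum, map_smul, hψ,
    hC, Polynomial.finsetSum_coeff, Polynomial.coeff_smul, Polynomial.coeff_X_pow,
    Polynomial.coeff_C, smul_eq_mul] at h1
  simp only [add_left_inj, Fin.val_inj, mul_ite, mul_one, mul_zero, Finset.sum_ite_eq,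
    Finset.mem_univ, if_true] at h1
  rwa [if_neg (by omega)] at h1

/-- The first two polynomials provide the derivatives; powers of one variable fill up the family to
`m` members. For `m = 1` only `Q₀` is present, so derivatives of `Q₁` may be used only if `2 ≤ m`.
-/
theorem exists_isSpanningFamily {ι : Type*} [Fintype ι] {m : ℕ} (hm : 1 ≤ m) (o : ι)
    (Q₀ Q₁ : MvPolynomial ι k) (h₀ : ∀ l, eval 0 (pderiv l Q₀) = 0)
    (h₁ : ∀ l, eval 0 (pderiv l Q₁) = 0) (ψ : MvPolynomial ι k →ₐ[k] Polynomial k)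
    (hψo : ψ (X o) = Polynomial.X) (hψ₀ : ψ Q₀ = Polynomial.X ^ 2)
    (hψ₁ : ψ Q₁ = Polynomial.X ^ 3)
    (hspan : ∀ l, (∃ l' c, X l = C c * pderiv l' Q₀) ∨ (2 ≤ m ∧ ∃ l' c, X l = C c * pderiv l' Q₁)) :
    ∃ q : Fin m → MvPolynomial ι k, IsSpanningFamily q := by
  classical
  let q : Fin m → MvPolynomial ι k := fun j =>
    if (j : ℕ) = 0 then Q₀ else if (j : ℕ) = 1 then Q₁ else X o ^ ((j : ℕ) + 2)
  refine ⟨q, ⟨fun l => ?_, eq_zero_of_algHom_polynomial (fun l j => ?_) ψ fun j => ?_⟩⟩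
  · rcases hspan l with ⟨l', c, h⟩ | ⟨hm2, l', c, h⟩
    · rw [h, C_mul']
      exact Submodule.smul_mem _ _ (Submodule.subset_span ⟨(l', ⟨0, hm⟩), by simp [q]⟩)
    · rw [h, C_mul']
      exact Submodule.smul_mem _ _ (Submodule.subset_span ⟨(l', ⟨1, hm2⟩), by simp [q]⟩)
  · simp only [q]
    split_ifs
    · exact h₀ l
    · exact h₁ l
    · simp [Derivation.leibniz_pow]
  · simp only [q]
    split_ifs with h h
    · rw [hψ₀, h]
    · rw [hψ₁, h]
    · rw [map_pow, hψo]

/-- The sum of squares has the multiples `2 X l` of the variables as its derivatives; the cube is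
only a filler. -/
theorem exists_isSpanningFamily_of_two_ne_zero {ι : Type*} [Fintype ι] [Nonempty ι] {m : ℕ}
    (hm : 1 ≤ m) (h2 : (2 : k) ≠ 0) : ∃ q : Fin m → MvPolynomial ι k, IsSpanningFamily q := by
  classical
  obtain ⟨o⟩ := ‹Nonempty ι›
  have hd : ∀ l, pderiv l (∑ i, X i ^ 2 : MvPolynomial ι k) = C 2 * X l := fun l => by
    rw [map_ofNat]
    simp [Derivation.leibniz_pow, pderiv_X, Pi.single_apply]
  refine exists_isSpanningFamily hm o (∑ i, X i ^ 2) (X o ^ 3) (fun l => ?_) (fun l => ?_)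
    (aeval (Pi.single o Polynomial.X)) ?_ ?_ ?_ fun l => Or.inl ⟨l, 2⁻¹, ?_⟩
  · simp [hd]
  · simp [Derivation.leibniz_pow]
  · simp
  · simp [Pi.single_apply, ite_pow]
  · simp
  · rw [hd, ← mul_assoc, ← C_mul, inv_mul_cancel₀ h2, C_1, one_mul]

/-- The hyperbolic form `∑ x_i y_i` has the variables themselves as derivatives, in every
characteristic. On the test curve `x_o = y_o = T` and the other variables are zero. -/
theorem exists_isSpanningFamily_sum {κ : Type*} [Fintype κ] [Nonempty κ] {m : ℕ}
    (hm : 1 ≤ m) : ∃ q : Fin m → MvPolynomial (κ ⊕ κ) k, IsSpanningFamily q := by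
  classical
  obtain ⟨o⟩ := ‹Nonempty κ›
  have hd : ∀ l, pderiv (Sum.inl l) (∑ i, X (Sum.inl i) * X (Sum.inr i) :
      MvPolynomial (κ ⊕ κ) k) = X (Sum.inr l) := fun l => by
    simp [Derivation.leibniz, pderiv_X, Pi.single_apply]
  have hd' : ∀ l, pderiv (Sum.inr l) (∑ i, X (Sum.inl i) * X (Sum.inr i) :
      MvPolynomial (κ ⊕ κ) k) = X (Sum.inl l) := fun l => by
    simp [Derivation.leibniz, pderiv_X, Pi.single_apply]
  refine exists_isSpanningFamily hm (Sum.inl o) (∑ i, X (Sum.inl i) * X (Sum.inr i))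
    (X (Sum.inl o) ^ 3) ?_ (fun l => ?_)
    (aeval (Sum.elim (Pi.single o Polynomial.X) (Pi.single o Polynomial.X))) ?_ ?_ ?_
    fun l => Or.inl ?_
  · rintro (l | l)
    · simp [hd]
    · simp [hd']
  · simp [Derivation.leibniz_pow]
  · simp
  · simp [Pi.single_apply, sq]
  · simp
  · rcases l with l | l
    · exact ⟨Sum.inr l, 1, by rw [hd', C_1, one_mul]⟩
    · exact ⟨Sum.inl l, 1, by rw [hd, C_1, one_mul]⟩

/-- The hyperbolic form misses the additional variable `z`, which is recovered as the derivative of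
a second quadric `x_o z`. The test curve has `z = T ^ 2`, so that this quadric becomes `T ^ 3`. -/
theorem exists_isSpanningFamily_sum_unit {κ : Type*} [Fintype κ] [Nonempty κ] {m : ℕ}
    (hm : 2 ≤ m) : ∃ q : Fin m → MvPolynomial ((κ ⊕ κ) ⊕ Unit) k, IsSpanningFamily q := by
  classical
  obtain ⟨o⟩ := ‹Nonempty κ›
  let Q₀ : MvPolynomial ((κ ⊕ κ) ⊕ Unit) k :=
    ∑ i, X (Sum.inl (Sum.inl i)) * X (Sum.inl (Sum.inr i))
  have hd : ∀ l, pderiv (Sum.inl (Sum.inl l)) Q₀ = X (Sum.inl (Sum.inr l)) := fun l => by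
    simp [Q₀, Derivation.leibniz, pderiv_X, Pi.single_apply]
  have hd' : ∀ l, pderiv (Sum.inl (Sum.inr l)) Q₀ = X (Sum.inl (Sum.inl l)) := fun l => by
    simp [Q₀, Derivation.leibniz, pderiv_X, Pi.single_apply]
  refine exists_isSpanningFamily (by omega) (Sum.inl (Sum.inl o)) Q₀
    (X (Sum.inl (Sum.inl o)) * X (Sum.inr ())) ?_ (fun l => ?_)
    (aeval (Sum.elim (Sum.elim (Pi.single o Polynomial.X) (Pi.single o Polynomial.X))
      fun _ => Polynomial.X ^ 2)) ?_ ?_ ?_ ?_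
  · rintro ((l | l) | l)
    · simp [hd]
    · simp [hd']
    · simp [Q₀, Derivation.leibniz]
  · simp [Derivation.leibniz]
  · simp
  · simp [Q₀, Pi.single_apply, sq]
  · simp [pow_succ']
  · rintro ((l | l) | l)
    · exact Or.inl ⟨Sum.inl (Sum.inr l), 1, by rw [hd', C_1, one_mul]⟩
    · exact Or.inl ⟨Sum.inl (Sum.inl l), 1, by rw [hd, C_1, one_mul]⟩
    · refine Or.inr ⟨hm, Sum.inl (Sum.inl o), 1, ?_⟩
      simp [Derivation.leibniz, pderiv_X]

theorem exists_isSpanningFamily_fin (p : ℕ) [Fact p.Prime] [CharP k p] {r m : ℕ} (hr : r ≠ 0)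
    (hpr : ¬ (p = 2 ∧ r = 1)) (hm : 1 ≤ m) (hm2 : p = 2 → Odd r → 2 ≤ m) :
    ∃ q : Fin m → MvPolynomial (Fin r) k, IsSpanningFamily q := by
  by_cases hp : p = 2
  · rcases Nat.even_or_odd' r with ⟨h, rfl | rfl⟩
    · have : Nonempty (Fin h) := ⟨⟨0, by omega⟩⟩
      obtain ⟨q, hq⟩ := exists_isSpanningFamily_sum (k := k) (κ := Fin h) hm
      exact ⟨_, hq.rename (finSumFinEquiv.trans (finCongr (by omega)))⟩
    -- For odd `r = 2 h + 1`, the excluded case `p = 2`, `r = 1` is exactly `h = 0`.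
    · have : Nonempty (Fin h) := ⟨⟨0, by omega⟩⟩
      obtain ⟨q, hq⟩ := exists_isSpanningFamily_sum_unit (k := k) (κ := Fin h)
        (hm2 hp ⟨h, rfl⟩)
      exact ⟨_, hq.rename (Fintype.equivFinOfCardEq (by simp; omega))⟩
  · have : Nonempty (Fin r) := ⟨⟨0, by omega⟩⟩
    refine exists_isSpanningFamily_of_two_ne_zero hm fun h => hp ?_
    have h1 : ((2 : ℕ) : k) = 0 := by exact_mod_cast h
    rw [CharP.cast_eq_zero_iff k p] at h1
    exact (Nat.prime_dvd_prime_iff_eq Fact.out Nat.prime_two).mp h1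

end Polynomials

/-! ### Independent powers of a non-constant function -/

section Powers

variable {k : Type*} [Field k]

/-- An algebraic element of a domain over an algebraically closed field is a scalar, so `b` is
transcendental, and so is `b ^ p`. -/
theorem linearIndependent_pow_of_notMem_range [IsAlgClosed k] {B : Type*} [CommRing B] [IsDomain B]
    [Algebra k B] {b : B} (hb : b ∉ (algebraMap k B).range) {p : ℕ} (hp : 0 < p) :
    LinearIndependent k fun n : ℕ => (b ^ p) ^ n := by
  have h1 : Transcendental k b := by
    intro halg
    obtain ⟨a, ha⟩ := IsAlgClosed.exists_root (minpoly k b)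
      (minpoly.degree_pos halg.isIntegral).ne'
    have hirr := minpoly.irreducible halg.isIntegral
    have h2 := Polynomial.degree_eq_one_of_irreducible_of_root hirr ha
    exact hb (minpoly.mem_range_of_degree_eq_one k b h2)
  have h2 := (Polynomial.basisMonomials k).linearIndependent.map'
    (Polynomial.aeval (b ^ p)).toLinearMap
    (LinearMap.ker_eq_bot.mpr (transcendental_iff_injective.mp (h1.pow hp)))
  have h3 : (fun n : ℕ => (b ^ p) ^ n) =
      (Polynomial.aeval (b ^ p)).toLinearMap ∘ Polynomial.basisMonomials k := by
    funext n
    simp [Polynomial.aeval_monomial]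
  rw [h3]
  exact h2

/-- Modulo the finite-dimensional span of `x`, the infinite independent family `u` still has
infinite rank, so `m` of its members can be chosen independent there. -/
theorem exists_linearIndependent_pow {V : Type*} [AddCommGroup V] [Module k V] {u : ℕ → V}
    (hu : LinearIndependent k u) {N : ℕ} {x : Fin N → V} (hx : LinearIndependent k x) (m : ℕ) :
    ∃ n : Fin m → ℕ, ∀ (a : Fin N → k) (b : Fin m → k),
      ∑ i, a i • x i + ∑ j, b j • u (n j) = 0 → a = 0 ∧ b = 0 := by
  let W := Submodule.span k (Set.range x)
  have hW : FiniteDimensional k W := FiniteDimensional.span_of_finite k (Set.finite_range x)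
  obtain ⟨κ, f, hf, hspan, hli⟩ := exists_linearIndependent' k (W.mkQ ∘ u)
  have hκ : Infinite κ := by
    by_contra hfin
    rw [not_infinite_iff_finite] at hfin
    have h1 : (Submodule.span k (Set.range (W.mkQ ∘ u))).FG := by
      rw [← hspan]
      exact Submodule.fg_span (Set.finite_range _)
    have h2 : (Submodule.span k (Set.range u) ⊔ W).FG := by
      refine Submodule.fg_of_fg_map_of_fg_inf_ker W.mkQ ?_ ?_
      · rw [Submodule.map_sup, Submodule.map_span, ← Set.range_comp]
        have h3 : W.map W.mkQ = ⊥ := by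
          exact W.mkQ_map_self
        rwa [h3, sup_bot_eq]
      · rw [Submodule.ker_mkQ, inf_eq_right.mpr le_sup_right]
        exact Module.Finite.iff_fg.mp hW
    have h4 : FiniteDimensional k (Submodule.span k (Set.range u)) := by
      have := Module.Finite.iff_fg.mpr h2
      exact Submodule.finiteDimensional_of_le (le_sup_left (b := W))
    have h5 := (linearIndependent_span hu).finite
    exact not_finite ℕ
  let n : Fin m ↪ κ := (Fin.valEmbedding).trans (Infinite.natEmbedding κ)
  have hli' := hli.comp n n.injective
  refine ⟨fun j => f (n j), fun a b h => ?_⟩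
  have hb : b = 0 := by
    have h1 := congrArg W.mkQ h
    rw [map_add, map_zero] at h1
    have h2 : W.mkQ (∑ i, a i • x i) = 0 := by
      rw [Submodule.mkQ_apply, Submodule.Quotient.mk_eq_zero]
      exact sum_mem fun i _ => W.smul_mem _ (Submodule.subset_span ⟨i, rfl⟩)
    rw [h2, zero_add, map_sum] at h1
    simp only [map_smul] at h1
    exact funext (Fintype.linearIndependent_iff.mp hli' b h1)
  refine ⟨?_, hb⟩
  simp only [hb, Pi.zero_apply, zero_smul, Finset.sum_const_zero, add_zero] at h
  exact funext (Fintype.linearIndependent_iff.mp hx a h)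

end Powers

/-! ### Homomorphisms and point derivations on polynomial rings over a chart -/

section PolynomialExtension

open MvPolynomial

variable {k : Type*} [Field k] {B : Type*} [CommRing B] [Algebra k B] {ι : Type*}

/-- The restriction of a homomorphism from a polynomial ring to the coefficients. -/
noncomputable def coeffHom {T : Type*} [CommRing T] [Algebra k T]
    (χ : MvPolynomial ι B →ₐ[k] T) : B →ₐ[k] T :=
  χ.comp (IsScalarTower.toAlgHom k B (MvPolynomial ι B))

theorem coeffHom_apply {T : Type*} [CommRing T] [Algebra k T] (χ : MvPolynomial ι B →ₐ[k] T)
    (b : B) : coeffHom χ b = χ (C b) := rfl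

/-- The homomorphism from a polynomial ring given by its values on coefficients and variables. -/
noncomputable def extendHom {T : Type*} [CommRing T] [Algebra k T] (χ : B →ₐ[k] T) (s : ι → T) :
    MvPolynomial ι B →ₐ[k] T :=
  { eval₂Hom (χ : B →+* T) s with
    commutes' := fun a => by
      change eval₂ _ _ (C (algebraMap k B a)) = _
      rw [eval₂_C]
      exact χ.commutes a }

theorem extendHom_C {T : Type*} [CommRing T] [Algebra k T] (χ : B →ₐ[k] T) (s : ι → T) (b : B) :
    extendHom χ s (C b) = χ b := eval₂_C _ _ _

theorem extendHom_X {T : Type*} [CommRing T] [Algebra k T] (χ : B →ₐ[k] T) (s : ι → T) (l : ι) :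
    extendHom χ s (X l) = s l := eval₂_X _ _ _

theorem algHom_polynomial_ext {T : Type*} [CommRing T] [Algebra k T]
    {χ χ' : MvPolynomial ι B →ₐ[k] T} (hC : ∀ b, χ (C b) = χ' (C b))
    (hX : ∀ l, χ (X l) = χ' (X l)) : χ = χ' := by
  have h1 : (χ : MvPolynomial ι B →+* T) = χ' := MvPolynomial.ringHom_ext hC hX
  exact AlgHom.ext fun b => DFunLike.congr_fun h1 b

theorem IsPointDerivation.coeff {χ : MvPolynomial ι B →ₐ[k] k} {D : MvPolynomial ι B →ₗ[k] k}
    (hD : IsPointDerivation χ D) : IsPointDerivation (coeffHom χ)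
      (D ∘ₗ (IsScalarTower.toAlgHom k B (MvPolynomial ι B)).toLinearMap) := fun a b => by
  have h1 := hD (C a) (C b)
  rw [← C_mul] at h1
  exact h1

/-- Coefficients and variables move independently: a dual-number point of a polynomial ring is given
by one of the coefficient ring and arbitrary values of the variables. -/
theorem exists_pointDerivation_polynomial {χ : MvPolynomial ι B →ₐ[k] k} {D₁ : B →ₗ[k] k}
    (hD₁ : IsPointDerivation (coeffHom χ) D₁) (u : ι → k) :
    ∃ D : MvPolynomial ι B →ₗ[k] k, IsPointDerivation χ D ∧ (∀ b, D (C b) = D₁ b) ∧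
      ∀ l, D (X l) = u l := by
  let χ' := extendHom hD₁.toAlgHom
    fun l => (TrivSqZeroExt.inl (χ (X l)) + TrivSqZeroExt.inr (u l) : DualNumber k)
  have hfst : ∀ b, (χ' b).fst = χ b := by
    have h1 : (TrivSqZeroExt.fstHom k k k).comp χ' = χ := by
      refine algHom_polynomial_ext (fun b => ?_) (fun l => ?_)
      · simp [χ', extendHom_C, hD₁.toAlgHom_apply, coeffHom_apply]
      · simp [χ', extendHom_X]
    exact DFunLike.congr_fun h1
  refine ⟨_, isPointDerivation_snd χ' hfst, fun b => ?_, fun l => ?_⟩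
  · simp [χ', extendHom_C, hD₁.toAlgHom_apply]
  · simp [χ', extendHom_X]

theorem IsPointDerivation.map_pow {χ : B →ₐ[k] k} {D : B →ₗ[k] k} (hD : IsPointDerivation χ D)
    (a : B) (n : ℕ) : D (a ^ (n + 1)) = (n + 1 : ℕ) * χ a ^ n * D a := by
  induction n with
  | zero => simp
  | succ n ih =>
    rw [pow_succ, hD, ih, _root_.map_pow]
    push_cast
    ring

theorem IsPointDerivation.map_pow_char {χ : B →ₐ[k] k} {D : B →ₗ[k] k}
    (hD : IsPointDerivation χ D) (p : ℕ) [hp : Fact p.Prime] [CharP k p] (a : B) :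
    D (a ^ p) = 0 := by
  obtain ⟨n, rfl⟩ := Nat.exists_eq_succ_of_ne_zero hp.out.ne_zero
  rw [Nat.succ_eq_add_one, hD.map_pow, ← Nat.succ_eq_add_one, CharP.cast_eq_zero, zero_mul,
    zero_mul]

/-- The substitution of `θ` and of the variables in a polynomial. -/
noncomputable def substHom (θ : B) : MvPolynomial (Option ι) k →ₐ[k] MvPolynomial ι B :=
  aeval fun o => o.elim (C θ) X

theorem map_substHom {T : Type*} [CommRing T] [Algebra k T] (χ : MvPolynomial ι B →ₐ[k] T) (θ : B)
    (F : MvPolynomial (Option ι) k) :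
    χ (substHom θ F) = aeval (fun o => o.elim (χ (C θ)) fun l => χ (X l) : Option ι → T) F := by
  rw [substHom, comp_aeval_apply]
  congr 2
  funext o
  cases o <;> rfl

theorem IsPointDerivation.map_substHom [Fintype ι] {χ : MvPolynomial ι B →ₐ[k] k}
    {D : MvPolynomial ι B →ₗ[k] k} (hD : IsPointDerivation χ D) {θ : B} (hθ : D (C θ) = 0)
    (F : MvPolynomial (Option ι) k) :
    D (substHom θ F) = ∑ l, χ (substHom θ (pderiv (some l) F)) * D (X l) := by
  rw [hD.apply_map, dirDeriv, Fintype.sum_option]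
  simp [substHom, hθ, eval_chartPoint]

end PolynomialExtension

/-! ### The variety `X` as the closure of a graph -/

section Construction

open MvPolynomial

variable {k : Type*} [Field k] {B : Type*} [CommRing B] [Algebra k B] {N₁ N r m : ℕ}

/-- The homogeneous coordinates `(x, x₀ s, x₀ q(θ, s))`. -/
noncomputable def graphCoord (π : MvPolynomial (Fin (N₁ + 1)) k →ₐ[k] B) (θ : B)
    (q : Fin m → MvPolynomial (Option (Fin r)) k) :
    Fin (N₁ + 1) ⊕ (Fin r ⊕ Fin m) → MvPolynomial (Fin r) B :=
  Sum.elim (fun i => C (π (X i))) (Sum.elim (fun l => C (π (X 0)) * X l)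
    fun j => C (π (X 0)) * substHom θ (q j))

/-- The parametrization of the graph of `q`. -/
noncomputable def graphHom (ε : Fin (N₁ + 1) ⊕ (Fin r ⊕ Fin m) ≃ Fin (N + 1))
    (π : MvPolynomial (Fin (N₁ + 1)) k →ₐ[k] B) (θ : B)
    (q : Fin m → MvPolynomial (Option (Fin r)) k) :
    MvPolynomial (Fin (N + 1)) k →ₐ[k] MvPolynomial (Fin r) B :=
  aeval fun j => graphCoord π θ q (ε.symm j)

variable (ε : Fin (N₁ + 1) ⊕ (Fin r ⊕ Fin m) ≃ Fin (N + 1))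
  (π : MvPolynomial (Fin (N₁ + 1)) k →ₐ[k] B) (θ : B)
  (q : Fin m → MvPolynomial (Option (Fin r)) k)

theorem graphHom_X (t : Fin (N₁ + 1) ⊕ (Fin r ⊕ Fin m)) :
    graphHom ε π θ q (X (ε t)) = graphCoord π θ q t := by
  rw [graphHom, aeval_X, Equiv.symm_apply_apply]

theorem graphHom_rename (F : MvPolynomial (Fin (N₁ + 1)) k) :
    graphHom ε π θ q (rename (fun i => ε (Sum.inl i)) F) = C (π F) := by
  have h1 : (graphHom ε π θ q).comp (rename fun i => ε (Sum.inl i)) =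
      (IsScalarTower.toAlgHom k B (MvPolynomial (Fin r) B)).comp π := by
    ext1 i
    rw [AlgHom.comp_apply, rename_X, graphHom_X]
    rfl
  exact DFunLike.congr_fun h1 F

theorem chartPoint_graphHom (χ : MvPolynomial (Fin r) B →ₐ[k] k)
    (t : Fin (N₁ + 1) ⊕ (Fin r ⊕ Fin m)) :
    chartPoint (graphHom ε π θ q) χ (ε t) = χ (graphCoord π θ q t) := by
  rw [chartPoint, graphHom_X]

theorem exists_algHom_ne_zero [IsAlgClosed k] {R : Type*} [CommRing R] [IsDomain R] [Algebra k R]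
    [Algebra.FiniteType k R] {b : R} (hb : b ≠ 0) : ∃ χ : R →ₐ[k] k, χ b ≠ 0 := by
  have hdom : IsDomain (Localization.Away b) := IsLocalization.isDomain_localization
    (powers_le_nonZeroDivisors_of_noZeroDivisors hb)
  obtain ⟨χ, -⟩ := exists_algHom_of_ne_top (k := k) (⊥ : Ideal (Localization.Away b)) bot_ne_top
  refine ⟨χ.comp (IsScalarTower.toAlgHom k R _), ?_⟩
  exact ((IsLocalization.Away.algebraMap_isUnit (S := Localization.Away b) b).map χ).ne_zero

variable {π θ} {X₁ : Set (PSpace k (Fin (N₁ + 1)))} {δ : MvPolynomial (Fin (N₁ + 1)) k}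

/-- The graph of `q` is an open subset of the cone over a projective variety. -/
theorem exists_isAffineChart_graphHom [IsAlgClosed k] [IsDomain B]
    (h : IsAffineChart X₁ (δ * X 0) π) (hθ : ∀ (χ χ' : B →ₐ[k] k) (a : k), a ≠ 0 →
      chartPoint π χ' = a • chartPoint π χ → χ' θ = χ θ) :
    ∃ X : Set (PSpace k (Fin (N + 1))), IsProjectiveVariety X ∧
      IsAffineChart X (rename (fun i => ε (Sum.inl i)) (δ * MvPolynomial.X 0))
        (graphHom ε π θ q) := by
  have hft : Algebra.FiniteType k B := h.finiteType
  have hftR : Algebra.FiniteType k (MvPolynomial (Fin r) B) :=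
    Algebra.FiniteType.trans (S := B) inferInstance inferInstance
  set φ := graphHom ε π θ q
  obtain ⟨d, hd, hhom⟩ := h.isHomogeneous
  have hunit : IsUnit (φ (rename (fun i => ε (Sum.inl i)) (δ * MvPolynomial.X 0))) := by
    rw [graphHom_rename]
    exact h.isUnit.map C
  -- The target is a finitely generated domain, so an element that vanishes at all its `k`-points is
  -- zero. The kernel of the parametrization is thus the ideal of its image.
  have hJ : ∀ F, F ∈ RingHom.ker φ ↔ ∀ v ∈ Set.range (chartPoint φ), eval v F = 0 := by
    intro F
    rw [RingHom.mem_ker, Set.forall_mem_range]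
    simp only [eval_chartPoint]
    refine ⟨fun h0 χ => by rw [h0, map_zero], fun h0 => ?_⟩
    by_contra hne
    obtain ⟨χ, hχ⟩ := exists_algHom_ne_zero (k := k) hne
    exact hχ (h0 χ)
  have h0 : (0 : Fin (N + 1) → k) ∉ Set.range (chartPoint φ) := by
    rintro ⟨χ, hχ⟩
    refine h.chartPoint_ne_zero (coeffHom χ) (funext fun i => ?_)
    have h1 := chartPoint_graphHom ε π θ q χ (Sum.inl i)
    rw [hχ] at h1
    exact h1.symm
  -- Scale `x` by `a` and keep `s`: since `θ` is invariant, all the coordinates `x`, `x₀ s` and `x₀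
  -- q(θ, s)` are multiplied by `a`.
  have hW : ∀ a : k, a ≠ 0 → ∀ v ∈ Set.range (chartPoint φ), a • v ∈ Set.range (chartPoint φ) := by
    rintro a ha _ ⟨χ, rfl⟩
    obtain ⟨χ₁, hχ₁⟩ := h.exists_chartPoint_eq
      (smul_mem_cone (h.chartPoint_mem_cone (coeffHom χ)) a)
      ((eval_smul_ne_zero_iff hhom ha _).mpr (h.eval_chartPoint_ne_zero (coeffHom χ)))
    let χ' := extendHom χ₁ fun l => χ (MvPolynomial.X l)
    have hx : ∀ i, χ₁ (π (MvPolynomial.X i)) = a * χ (C (π (MvPolynomial.X i))) :=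
      fun i => congrFun hχ₁ i
    have hs : ∀ F, χ' (substHom θ F) = χ (substHom θ F) := fun F => by
      rw [map_substHom, map_substHom]
      congr 2
      funext o
      cases o with
      | none => exact (extendHom_C _ _ _).trans (hθ (coeffHom χ) χ₁ a ha hχ₁)
      | some l => exact extendHom_X _ _ _
    refine ⟨χ', funext fun j => ?_⟩
    obtain ⟨t, rfl⟩ := ε.surjective j
    rw [Pi.smul_apply, chartPoint_graphHom, chartPoint_graphHom]
    rcases t with i | l | j
    · exact (extendHom_C _ _ _).trans (hx i)
    · simp only [graphCoord, Sum.elim_inr, Sum.elim_inl, map_mul, smul_eq_mul, χ', extendHom_C,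
        extendHom_X, hx]
      ring
    · simp only [graphCoord, Sum.elim_inr, map_mul, smul_eq_mul, hs]
      rw [show χ' (C (π (MvPolynomial.X 0))) = _ from (extendHom_C _ _ _).trans (hx 0)]
      ring
  have hprime : (RingHom.ker φ).IsPrime := RingHom.ker_isPrime _
  obtain ⟨h1, h2⟩ := isProjectiveVariety_of_isPrime _ h0 hW (RingHom.ker φ) hJ
  refine ⟨_, h2, ⟨d, hd, hhom.rename_isHomogeneous⟩, fun F => by rw [h1, RingHom.mem_ker], hunit,
    fun b => ?_⟩
  set G := rename (fun i => ε (Sum.inl i)) (δ * MvPolynomial.X 0) with hG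
  induction b using MvPolynomial.induction_on with
  | C b =>
    obtain ⟨e, F, hF⟩ := h.exists_eq b
    refine ⟨e, rename (fun i => ε (Sum.inl i)) F, ?_⟩
    rw [hG, graphHom_rename, graphHom_rename, ← hF, C_mul, C_pow]
  | add b b' hb hb' =>
    obtain ⟨e, F, hF⟩ := hb
    obtain ⟨e', F', hF'⟩ := hb'
    refine ⟨e + e', G ^ e' * F + G ^ e * F', ?_⟩
    rw [map_add, map_mul, map_mul, ← hF, ← hF', map_pow, map_pow]
    ring
  | mul_X b l hb =>
    obtain ⟨e, F, hF⟩ := hb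
    -- The variable `s_l` is recovered from the coordinate `x₀ s_l`: multiplied by `δ`, it becomes
    -- `s_l` times the inverted element `δ x₀`.
    refine ⟨e + 1, F * rename (fun i => ε (Sum.inl i)) δ *
      MvPolynomial.X (ε (Sum.inr (Sum.inl l))), ?_⟩
    rw [map_mul, map_mul, ← hF, graphHom_X, graphHom_rename ε π θ q δ, pow_succ]
    have hφG : φ G = C (π δ) * C (π (MvPolynomial.X 0)) := by
      rw [hG, graphHom_rename, map_mul, C_mul]
    simp only [graphCoord, Sum.elim_inr, Sum.elim_inl]
    linear_combination φ G ^ e * b * MvPolynomial.X l * hφG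

end Construction

/-! ### Tangent spaces of the graph -/

section GraphFrame

open MvPolynomial

variable {k : Type*} [Field k] {B : Type*} [CommRing B] [Algebra k B] {N₁ N r m : ℕ}

/-- A frame of the tangent spaces of the graph of `q`. -/
noncomputable def graphFrame {n : ℕ} (θ : B) (q : Fin m → MvPolynomial (Option (Fin r)) k)
    (K : Matrix (Fin n) (Fin (N₁ + 1)) B) :
    Fin n ⊕ Fin r → Fin (N₁ + 1) ⊕ (Fin r ⊕ Fin m) → MvPolynomial (Fin r) B :=
  Sum.elim
    (fun i => Sum.elim (fun j => C (K i j)) (Sum.elim (fun _ => 0) fun j => C (K i 0) *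
      (substHom θ (q j) - ∑ l, X l * substHom θ (pderiv (some l) (q j)))))
    (fun l => Sum.elim (fun _ => 0) (Sum.elim (Pi.single l 1) fun j =>
      substHom θ (pderiv (some l) (q j))))

variable {ε : Fin (N₁ + 1) ⊕ (Fin r ⊕ Fin m) ≃ Fin (N + 1)}
  {π : MvPolynomial (Fin (N₁ + 1)) k →ₐ[k] B} {θ : B}
  {q : Fin m → MvPolynomial (Option (Fin r)) k}

theorem IsPointDerivation.map_graphCoord_var {χ : MvPolynomial (Fin r) B →ₐ[k] k}
    {D : MvPolynomial (Fin r) B →ₗ[k] k} (hD : IsPointDerivation χ D) (l : Fin r) :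
    D (graphCoord π θ q (Sum.inr (Sum.inl l))) =
      χ (C (π (X 0))) * D (X l) + χ (X l) * D (C (π (X 0))) := hD _ _

theorem IsPointDerivation.map_graphCoord_graph {χ : MvPolynomial (Fin r) B →ₐ[k] k}
    {D : MvPolynomial (Fin r) B →ₗ[k] k} (hD : IsPointDerivation χ D) (hθ : D (C θ) = 0)
    (j : Fin m) : D (graphCoord π θ q (Sum.inr (Sum.inr j))) =
      χ (C (π (X 0))) * (∑ l, χ (substHom θ (pderiv (some l) (q j))) * D (X l)) +
        χ (substHom θ (q j)) * D (C (π (X 0))) := by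
  rw [← hD.map_substHom hθ]
  exact hD _ _

/-- Differentiate the parametrization. Since `D θ = 0`, the derivative of `x₀ q_j` is `q_j D x₀ + x₀
∑ ∂_l q_j D s_l`; eliminating `x₀ D s_l = D (x₀ s_l) - s_l D x₀` gives `(q_j - ∑ s_l ∂_l q_j) D x₀ +
∑ ∂_l q_j D (x₀ s_l)`. The values of `D` on `x` are a combination of the rows of `K₁`, and the `D
(x₀ s_l)` are free, which yields the two kinds of rows. -/
theorem coneTangent_graph {X₁ : Set (PSpace k (Fin (N₁ + 1)))}
    {δ : MvPolynomial (Fin (N₁ + 1)) k} {c₁ : Fin (dim X₁ + 1) ↪o Fin (N₁ + 1)}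
    {K₁ : Matrix (Fin (dim X₁ + 1)) (Fin (N₁ + 1)) B}
    (h₁ : IsFrameChart X₁ (δ * X 0) π c₁ K₁)
    (hθ : ∀ (χ : B →ₐ[k] k) (D : B →ₗ[k] k), IsPointDerivation χ D → D θ = 0)
    {X : Set (PSpace k (Fin (N + 1)))} {G : MvPolynomial (Fin (N + 1)) k}
    (h : IsAffineChart X G (graphHom ε π θ q)) (χ : MvPolynomial (Fin r) B →ₐ[k] k) :
    coneTangent X (chartPoint (graphHom ε π θ q) χ) =
      Submodule.span k (Set.range fun (i : Fin (dim X₁ + 1) ⊕ Fin r) (j : Fin (N + 1)) =>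
        χ (graphFrame θ q K₁ i (ε.symm j))) := by
  have hx0 : χ (C (π (MvPolynomial.X 0))) ≠ 0 := by
    have h0 := h₁.isUnit
    rw [map_mul] at h0
    exact ((isUnit_of_mul_isUnit_right h0).map (coeffHom χ)).ne_zero
  have hθ' : ∀ D, IsPointDerivation χ D → D (C θ) = 0 := fun D hD => hθ _ _ hD.coeff
  ext t
  rw [h.mem_coneTangent_iff, Submodule.mem_span_range_iff_exists_fun]
  simp only [graphHom, aeval_X]
  constructor
  · rintro ⟨D, hD, hDt⟩
    have ht₁ := h₁.mem_coneTangent_iff.mpr ⟨_, hD.coeff, fun i => rfl⟩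
    rw [h₁.coneTangent_eq, Submodule.mem_span_range_iff_exists_fun] at ht₁
    obtain ⟨a, ha⟩ := ht₁
    have ha' : ∀ i, ∑ i', a i' * χ (C (K₁ i' i)) = D (C (π (MvPolynomial.X i))) := fun i => by
      have h2 := congrFun ha i
      simpa [Finset.sum_apply, coeffHom_apply] using h2
    refine ⟨Sum.elim a fun l => D (graphCoord π θ q (Sum.inr (Sum.inl l))), funext fun j => ?_⟩
    rw [← hDt]
    obtain ⟨s, rfl⟩ := ε.surjective j
    simp only [Fintype.sum_sum_type, Finset.sum_apply, Pi.smul_apply, smul_eq_mul,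
      Equiv.symm_apply_apply, Sum.elim_inl, Sum.elim_inr, graphFrame]
    rcases s with i | l | j
    · simp [graphCoord, ha']
    · simp [Pi.single_apply, apply_ite]
    · simp only [Sum.elim_inr, hD.map_graphCoord_graph (hθ' D hD), hD.map_graphCoord_var, map_mul,
        map_sub, map_sum, ← mul_assoc, ← Finset.sum_mul, ha']
      simp only [Finset.mul_sum, add_mul, mul_sub, Finset.sum_add_distrib]
      have h3 : ∑ l, χ (MvPolynomial.X l) * D (C (π (MvPolynomial.X 0))) *
          χ (substHom θ (pderiv (some l) (q j))) = ∑ l, D (C (π (MvPolynomial.X 0))) *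
          (χ (MvPolynomial.X l) * χ (substHom θ (pderiv (some l) (q j)))) :=
        Finset.sum_congr rfl fun l _ => by ring
      have h4 : ∑ l, χ (C (π (MvPolynomial.X 0))) * D (MvPolynomial.X l) *
          χ (substHom θ (pderiv (some l) (q j))) = ∑ l, χ (C (π (MvPolynomial.X 0))) *
          (χ (substHom θ (pderiv (some l) (q j))) * D (MvPolynomial.X l)) :=
        Finset.sum_congr rfl fun l _ => by ring
      linear_combination h3 + h4
  · rintro ⟨a, rfl⟩
    have ht₁ : (∑ i, a (Sum.inl i) • fun j => coeffHom χ (K₁ i j)) ∈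
        coneTangent X₁ (chartPoint π (coeffHom χ)) := by
      rw [h₁.coneTangent_eq, Submodule.mem_span_range_iff_exists_fun]
      exact ⟨_, rfl⟩
    obtain ⟨D₁, hD₁, hDt₁⟩ := h₁.mem_coneTangent_iff.mp ht₁
    -- The values on the variables are the solutions of `D (x₀ s_l) = a (Sum.inr l)`.
    obtain ⟨D, hD, hDC, hDX⟩ := exists_pointDerivation_polynomial hD₁ fun l =>
      (a (Sum.inr l) - χ (MvPolynomial.X l) * D₁ (π (MvPolynomial.X 0))) /
        χ (C (π (MvPolynomial.X 0)))
    have ha' : ∀ i, ∑ i', a (Sum.inl i') * χ (C (K₁ i' i)) = D (C (π (MvPolynomial.X i))) :=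
      fun i => by
        rw [hDC, hDt₁]
        simp [Finset.sum_apply, coeffHom_apply]
    have hvar : ∀ l, D (graphCoord π θ q (Sum.inr (Sum.inl l))) = a (Sum.inr l) := fun l => by
      rw [hD.map_graphCoord_var, hDX, hDC]
      field_simp
      ring
    refine ⟨D, hD, fun j => ?_⟩
    obtain ⟨s, rfl⟩ := ε.surjective j
    simp only [Fintype.sum_sum_type, Finset.sum_apply, Pi.smul_apply, smul_eq_mul,
      Equiv.symm_apply_apply, Sum.elim_inl, Sum.elim_inr, graphFrame]
    rcases s with i | l | j
    · simp [graphCoord, ha']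
    · rw [hvar]
      simp [Pi.single_apply, apply_ite]
    · simp only [← hvar]
      simp only [Sum.elim_inr, hD.map_graphCoord_graph (hθ' D hD), hD.map_graphCoord_var, map_mul,
        map_sub, map_sum, ← mul_assoc, ← Finset.sum_mul, ha']
      simp only [Finset.mul_sum, add_mul, mul_sub, Finset.sum_add_distrib]
      have h3 : ∑ l, χ (MvPolynomial.X l) * D (C (π (MvPolynomial.X 0))) *
          χ (substHom θ (pderiv (some l) (q j))) = ∑ l, D (C (π (MvPolynomial.X 0))) *
          (χ (MvPolynomial.X l) * χ (substHom θ (pderiv (some l) (q j)))) :=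
        Finset.sum_congr rfl fun l _ => by ring
      have h4 : ∑ l, χ (C (π (MvPolynomial.X 0))) * D (MvPolynomial.X l) *
          χ (substHom θ (pderiv (some l) (q j))) = ∑ l, χ (C (π (MvPolynomial.X 0))) *
          (χ (substHom θ (pderiv (some l) (q j))) * D (MvPolynomial.X l)) :=
        Finset.sum_congr rfl fun l _ => by ring
      linear_combination -h3 - h4

end GraphFrame

/-! ### The normalized frame of the graph and its minors -/

section GraphChart

open MvPolynomial

/-- The coordinates of the ambient space of a graph, in their order. -/
def graphEquiv {N₁ N r m : ℕ} (hN : N₁ + 1 + (r + m) = N + 1) :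
    Fin (N₁ + 1) ⊕ (Fin r ⊕ Fin m) ≃ Fin (N + 1) :=
  ((Equiv.sumCongr (Equiv.refl _) finSumFinEquiv).trans finSumFinEquiv).trans (finCongr hN)

/-- The rows of the frame of a graph, in their order. -/
def rowEquiv {n r d : ℕ} (hd : n + r = d) : Fin n ⊕ Fin r ≃ Fin d :=
  finSumFinEquiv.trans (finCongr hd)

/-- The extension of a choice of columns by the columns of the variables. -/
def extendEmbedding {N₁ N r m n d : ℕ} (hN : N₁ + 1 + (r + m) = N + 1) (hd : n + r = d)
    (s : Fin n ↪o Fin (N₁ + 1)) : Fin d ↪o Fin (N + 1) :=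
  OrderEmbedding.ofStrictMono
    (fun i => graphEquiv hN (Sum.map s Sum.inl ((rowEquiv hd).symm i))) (by
      intro i j hij
      obtain ⟨i, rfl⟩ := (rowEquiv hd).surjective i
      obtain ⟨j, rfl⟩ := (rowEquiv hd).surjective j
      simp only [Equiv.symm_apply_apply]
      rcases i with i | i <;> rcases j with j | j <;>
        simp only [rowEquiv, graphEquiv, Equiv.trans_apply, finSumFinEquiv_apply_left,
          finSumFinEquiv_apply_right, finCongr_apply, Fin.lt_def, Fin.val_cast, Fin.val_castAdd,
          Fin.val_natAdd, Sum.map_inl, Sum.map_inr, Equiv.sumCongr_apply,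
          Equiv.refl_apply] at hij ⊢
      · exact s.strictMono hij
      · omega
      · omega
      · omega)

theorem extendEmbedding_apply {N₁ N r m n d : ℕ} (hN : N₁ + 1 + (r + m) = N + 1) (hd : n + r = d)
    (s : Fin n ↪o Fin (N₁ + 1)) (i : Fin n ⊕ Fin r) :
    extendEmbedding (m := m) hN hd s (rowEquiv hd i) = graphEquiv hN (Sum.map s Sum.inl i) := by
  change graphEquiv hN (Sum.map s Sum.inl ((rowEquiv hd).symm (rowEquiv hd i))) = _
  rw [Equiv.symm_apply_apply]

variable {k : Type*} [Field k] {B : Type*} [CommRing B] [Algebra k B] {N₁ N r m : ℕ}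

theorem graphFrame_map_submatrix {n : ℕ} (θ : B) (q : Fin m → MvPolynomial (Option (Fin r)) k)
    (K : Matrix (Fin n) (Fin (N₁ + 1)) B) (s : Fin n → Fin (N₁ + 1)) :
    (Matrix.of fun i j => graphFrame θ q K i (Sum.map s Sum.inl j) :
      Matrix (Fin n ⊕ Fin r) (Fin n ⊕ Fin r) (MvPolynomial (Fin r) B)) =
      Matrix.fromBlocks ((K.submatrix id s).map C) 0 0 1 := by
  ext i j : 1
  rcases i with i | i <;> rcases j with j | j <;>
    simp [graphFrame, Matrix.one_apply, Pi.single_apply, eq_comm]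

/-- The frame of the tangent spaces of a graph as a matrix. -/
noncomputable def graphMatrix {n d : ℕ} (hN : N₁ + 1 + (r + m) = N + 1) (hd : n + r = d) (θ : B)
    (q : Fin m → MvPolynomial (Option (Fin r)) k) (K : Matrix (Fin n) (Fin (N₁ + 1)) B) :
    Matrix (Fin d) (Fin (N + 1)) (MvPolynomial (Fin r) B) :=
  Matrix.of fun i j => graphFrame θ q K ((rowEquiv hd).symm i) ((graphEquiv hN).symm j)

theorem graphMatrix_submatrix {n d : ℕ} (hN : N₁ + 1 + (r + m) = N + 1) (hd : n + r = d) (θ : B)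
    (q : Fin m → MvPolynomial (Option (Fin r)) k) (K : Matrix (Fin n) (Fin (N₁ + 1)) B)
    (s : Fin n ↪o Fin (N₁ + 1)) :
    (graphMatrix hN hd θ q K).submatrix id (extendEmbedding hN hd s) =
      (Matrix.fromBlocks ((K.submatrix id s).map C) 0 0 1).submatrix (rowEquiv hd).symm
        (rowEquiv hd).symm := by
  rw [← graphFrame_map_submatrix θ q]
  ext i j : 1
  obtain ⟨j, rfl⟩ := (rowEquiv hd).surjective j
  simp [graphMatrix, extendEmbedding_apply]

/-- On the columns `s` together with those of the variables, the frame is block diagonal with an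
identity block. Hence the Plücker coordinates for `X₁` occur among those for `X`, and the map
between the Gauss images can be a coordinate projection. -/
theorem det_graphMatrix_submatrix {n d : ℕ} (hN : N₁ + 1 + (r + m) = N + 1) (hd : n + r = d)
    (θ : B) (q : Fin m → MvPolynomial (Option (Fin r)) k) (K : Matrix (Fin n) (Fin (N₁ + 1)) B)
    (s : Fin n ↪o Fin (N₁ + 1)) :
    ((graphMatrix hN hd θ q K).submatrix id (extendEmbedding hN hd s)).det =
      C (K.submatrix id s).det := by
  rw [graphMatrix_submatrix, Matrix.det_submatrix_equiv_self, Matrix.det_fromBlocks_zero₂₁,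
    Matrix.det_one, mul_one, RingHom.map_det]
  rfl

variable {π : MvPolynomial (Fin (N₁ + 1)) k →ₐ[k] B} {θ : B}
  {q : Fin m → MvPolynomial (Option (Fin r)) k} {X₁ : Set (PSpace k (Fin (N₁ + 1)))}
  {δ : MvPolynomial (Fin (N₁ + 1)) k} {c₁ : Fin (dim X₁ + 1) ↪o Fin (N₁ + 1)}
  {K₁ : Matrix (Fin (dim X₁ + 1)) (Fin (N₁ + 1)) B} {hN : N₁ + 1 + (r + m) = N + 1}
  {X : Set (PSpace k (Fin (N + 1)))} {G : MvPolynomial (Fin (N + 1)) k}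

/-- The dimension is read off from a tangent space at a point where it is minimal: the rows of the
frame are independent because of the identity block. -/
theorem dim_graph [IsAlgClosed k] [IsDomain B] (h₁ : IsFrameChart X₁ (δ * MvPolynomial.X 0) π c₁ K₁)
    (hθ : ∀ (χ : B →ₐ[k] k) (D : B →ₗ[k] k), IsPointDerivation χ D → D θ = 0)
    (hX : IsProjectiveVariety X) (h : IsAffineChart X G (graphHom (graphEquiv hN) π θ q)) :
    dim X₁ + 1 + r = dim X + 1 := by
  obtain ⟨H, d, -, hHX, hH⟩ := hX.exists_finrank_coneTangent_eq
  obtain ⟨χ, hχ⟩ := h.exists_map_ne_zero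
    (b := graphHom (graphEquiv hN) π θ q H) (by rwa [ne_eq, h.map_eq_zero_iff])
  rw [← eval_chartPoint] at hχ
  rw [← hH _ (h.chartPoint_mem_cone χ) hχ, coneTangent_graph h₁ hθ h, finrank_span_eq_card,
    Fintype.card_sum, Fintype.card_fin, Fintype.card_fin]
  rw [Fintype.linearIndependent_iff]
  intro a ha i
  have h1 := congrFun ha (graphEquiv hN (Sum.map c₁ Sum.inl i))
  have h2 : ∀ i j, graphFrame θ q K₁ i (Sum.map c₁ Sum.inl j) =
      (1 : Matrix _ _ (MvPolynomial (Fin r) B)) i j := fun i j => by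
    have h3 := congrFun (congrFun (graphFrame_map_submatrix θ q K₁ c₁) i) j
    rw [h₁.submatrix_eq, Matrix.map_one _ C_0 C_1, Matrix.fromBlocks_one] at h3
    exact h3
  simp only [Finset.sum_apply, Pi.smul_apply, smul_eq_mul, Equiv.symm_apply_apply, h2,
    Matrix.one_apply] at h1
  simpa [apply_ite] using h1

theorem isFrameChart_graph (h₁ : IsFrameChart X₁ (δ * MvPolynomial.X 0) π c₁ K₁)
    (hθ : ∀ (χ : B →ₐ[k] k) (D : B →ₗ[k] k), IsPointDerivation χ D → D θ = 0)
    (h : IsAffineChart X G (graphHom (graphEquiv hN) π θ q)) (hd : dim X₁ + 1 + r = dim X + 1) :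
    IsFrameChart X G (graphHom (graphEquiv hN) π θ q) (extendEmbedding hN hd c₁)
      (graphMatrix hN hd θ q K₁) := by
  refine ⟨h, ?_, fun χ => ?_⟩
  · rw [graphMatrix_submatrix, h₁.submatrix_eq, Matrix.map_one _ C_0 C_1, Matrix.fromBlocks_one,
      Matrix.submatrix_one_equiv]
  · rw [coneTangent_graph h₁ hθ h]
    congr 1
    exact ((rowEquiv hd).symm.surjective.range_comp _).symm

end GraphChart

/-! ### Fibres of the Gauss map of the graph -/

section GraphFibre

open MvPolynomial

variable {k : Type*} [Field k] {B : Type*} [CommRing B] [Algebra k B] {N₁ N r m n d : ℕ}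
  {q : Fin m → MvPolynomial (Option (Fin r)) k}

theorem substHom_mem {E : Subalgebra k (MvPolynomial (Fin r) B)} {θ : B} (hθ : C θ ∈ E)
    (hX : ∀ l, X l ∈ E) (F : MvPolynomial (Option (Fin r)) k) : substHom θ F ∈ E := by
  have h1 : substHom θ F = E.val (aeval (fun o => o.elim ⟨C θ, hθ⟩ fun l => ⟨X l, hX l⟩ :
      Option (Fin r) → E) F) := by
    rw [comp_aeval_apply, substHom]
    congr 2
    funext o
    cases o <;> rfl
  rw [h1]
  exact Subtype.property _

/-- The entries of the frame of a graph generate the same subalgebra as the entries of the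
original frame and the variables. -/
theorem forall_graphMatrix_mem_iff (hN : N₁ + 1 + (r + m) = N + 1) (hd : n + r = d)
    (hq : ∀ l, X (some l) ∈ Submodule.span k
      (Set.range fun lj : Fin r × Fin m => pderiv (some lj.1) (q lj.2)))
    (K : Matrix (Fin n) (Fin (N₁ + 1)) B) (i₀ j₀) (p : ℕ)
    (E : Subalgebra k (MvPolynomial (Fin r) B)) :
    (∀ i j, graphMatrix hN hd (K i₀ j₀ ^ p) q K i j ∈ E) ↔
      (∀ i j, C (K i j) ∈ E) ∧ ∀ l, X l ∈ E := by
  have h0 : (∀ i j, graphMatrix hN hd (K i₀ j₀ ^ p) q K i j ∈ E) ↔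
      ∀ i j, graphFrame (K i₀ j₀ ^ p) q K i j ∈ E := by
    rw [← (rowEquiv hd).forall_congr_right]
    refine forall_congr' fun i => ?_
    rw [← (graphEquiv hN).forall_congr_right]
    simp [graphMatrix]
  rw [h0]
  constructor
  · intro h
    refine ⟨fun i j => h (Sum.inl i) (Sum.inl j), fun l => ?_⟩
    -- The rows of the variables contain the partial derivatives of the `q j`, and by `hq` every
    -- variable is a linear combination of these.
    have h1 : (Submodule.span k (Set.range fun lj : Fin r × Fin m =>
        pderiv (some lj.1) (q lj.2))) ≤
        (Subalgebra.toSubmodule E).comap (substHom (K i₀ j₀ ^ p)).toLinearMap := by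
      rw [Submodule.span_le]
      rintro _ ⟨⟨l, j⟩, rfl⟩
      exact h (Sum.inr l) (Sum.inr (Sum.inr j))
    have h2 := h1 (hq l)
    simpa [substHom] using h2
  · rintro ⟨hK, hX⟩
    have hθ : C (K i₀ j₀ ^ p) ∈ E := by
      rw [C_pow]
      exact E.pow_mem (hK _ _) p
    have hs := substHom_mem hθ hX
    rintro (i | l) (j | l' | j)
    · exact hK _ _
    · exact E.zero_mem
    · exact E.mul_mem (hK _ _) (E.sub_mem (hs _) (E.sum_mem fun l _ => E.mul_mem (hX l) (hs _)))
    · exact E.zero_mem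
    · simp only [graphFrame, Sum.elim_inr, Sum.elim_inl, Pi.single_apply]
      split_ifs
      · exact E.one_mem
      · exact E.zero_mem
    · exact hs _

/-- The matrix of the linear embedding that maps a fibre of the Gauss map onto a fibre of the
Gauss map of the graph. -/
noncomputable def fibreMatrix (hN : N₁ + 1 + (r + m) = N + 1) (θ : B)
    (q : Fin m → MvPolynomial (Option (Fin r)) k) (χ : MvPolynomial (Fin r) B →ₐ[k] k) :
    Matrix (Fin (N + 1)) (Fin (N₁ + 1)) k :=
  Matrix.of fun j => Sum.elim (fun i => Pi.single i 1)
    (Sum.elim (fun l => Pi.single 0 (χ (X l))) fun j => Pi.single 0 (χ (substHom θ (q j))))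
    ((graphEquiv hN).symm j)

theorem fibreMatrix_mulVec (hN : N₁ + 1 + (r + m) = N + 1) (θ : B)
    (χ : MvPolynomial (Fin r) B →ₐ[k] k) (t : Fin (N₁ + 1) → k)
    (s : Fin (N₁ + 1) ⊕ (Fin r ⊕ Fin m)) :
    (fibreMatrix hN θ q χ).mulVec t (graphEquiv hN s) =
      Sum.elim t (Sum.elim (fun l => χ (X l) * t 0) fun j => χ (substHom θ (q j)) * t 0) s := by
  rcases s with i | l | j <;> simp [fibreMatrix, Matrix.mulVec]

theorem fibreMatrix_mulVec_injective (hN : N₁ + 1 + (r + m) = N + 1) (θ : B)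
    (χ : MvPolynomial (Fin r) B →ₐ[k] k) :
    Function.Injective (fibreMatrix hN θ q χ).mulVec := by
  intro t t' h
  funext i
  have h1 := congrFun h (graphEquiv hN (Sum.inl i))
  rwa [fibreMatrix_mulVec, fibreMatrix_mulVec] at h1

variable {π : MvPolynomial (Fin (N₁ + 1)) k →ₐ[k] B}

/-- The elements killed by a point derivation form a subalgebra, so the derivation kills the large
frame if and only if it kills the entries of `K` and the variables. It then also kills `θ`, and its
values on the graph coordinates are obtained from those on `x` by the linear map `fibreMatrix`. -/
theorem constantTangent_graph (hN : N₁ + 1 + (r + m) = N + 1) (hd : n + r = d)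
    (hq : ∀ l, X (some l) ∈ Submodule.span k
      (Set.range fun lj : Fin r × Fin m => pderiv (some lj.1) (q lj.2)))
    (K : Matrix (Fin n) (Fin (N₁ + 1)) B) (i₀ j₀) (p : ℕ) (χ : MvPolynomial (Fin r) B →ₐ[k] k) :
    constantTangent (graphHom (graphEquiv hN) π (K i₀ j₀ ^ p) q) χ
        (fun ij : Fin d × Fin (N + 1) => graphMatrix hN hd (K i₀ j₀ ^ p) q K ij.1 ij.2) =
      (constantTangent π (coeffHom χ) fun ij : Fin n × Fin (N₁ + 1) => K ij.1 ij.2).map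
        (fibreMatrix hN (K i₀ j₀ ^ p) q χ).mulVecLin := by
  set θ := K i₀ j₀ ^ p with hθ
  have hE : ∀ (D : MvPolynomial (Fin r) B →ₗ[k] k), IsPointDerivation χ D →
      ∃ E : Subalgebra k (MvPolynomial (Fin r) B), ∀ f, f ∈ E ↔ D f = 0 := fun D hD =>
    ⟨AlgHom.equalizer hD.toAlgHom ((Algebra.ofId k (DualNumber k)).comp χ), fun f => by
      rw [AlgHom.mem_equalizer, hD.toAlgHom_apply, AlgHom.comp_apply, Algebra.ofId_apply,
        TrivSqZeroExt.algebraMap_eq_inl', Algebra.algebraMap_self, RingHom.id_apply, add_eq_left]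
      exact TrivSqZeroExt.inr_injective.eq_iff' (TrivSqZeroExt.inr_zero _)⟩
  have hD' : ∀ (D : MvPolynomial (Fin r) B →ₗ[k] k), IsPointDerivation χ D →
      ((∀ i j, D (graphMatrix hN hd θ q K i j) = 0) ↔
        (∀ i j, D (C (K i j)) = 0) ∧ ∀ l, D (X l) = 0) := by
    intro D hD
    obtain ⟨E, hE⟩ := hE D hD
    simp only [← hE]
    exact forall_graphMatrix_mem_iff hN hd hq K i₀ j₀ p E
  have hcoord : ∀ (D : MvPolynomial (Fin r) B →ₗ[k] k), IsPointDerivation χ D →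
      (∀ i j, D (C (K i j)) = 0) → (∀ l, D (X l) = 0) → ∀ j,
        D (graphHom (graphEquiv hN) π θ q (X j)) =
          (fibreMatrix hN θ q χ).mulVec (fun i => D (C (π (X i)))) j := by
    intro D hD hDK hDX j
    obtain ⟨s, rfl⟩ := (graphEquiv hN).surjective j
    have hDθ : D (C θ) = 0 := by
      obtain ⟨E, hE⟩ := hE D hD
      rw [← hE, hθ, C_pow]
      exact E.pow_mem ((hE _).mpr (hDK _ _)) p
    rw [graphHom_X, fibreMatrix_mulVec]
    rcases s with i | l | j
    · rfl
    · rw [hD.map_graphCoord_var, hDX, mul_zero, zero_add]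
      rfl
    · rw [hD.map_graphCoord_graph hDθ]
      simp [hDX]
  ext t
  constructor
  · rintro ⟨D, hD, hDt, hDK⟩
    obtain ⟨h1, h2⟩ := (hD' D hD).mp fun i j => hDK (i, j)
    refine ⟨fun i => D (C (π (X i))), ⟨_, hD.coeff, fun i => rfl, fun ij => h1 _ _⟩, ?_⟩
    funext j
    rw [← hDt, hcoord D hD h1 h2]
    rfl
  · rintro ⟨t₁, ⟨D₁, hD₁, hDt₁, hDK₁⟩, rfl⟩
    obtain ⟨D, hD, hDC, hDX⟩ := exists_pointDerivation_polynomial hD₁ 0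
    have h1 : ∀ i j, D (C (K i j)) = 0 := fun i j => (hDC _).trans (hDK₁ (i, j))
    refine ⟨D, hD, fun j => ?_, fun ij => (hD' D hD).mpr ⟨h1, hDX⟩ _ _⟩
    rw [hcoord D hD h1 hDX]
    simp only [hDC, hDt₁]
    rfl

theorem finrank_constantTangent_graph (hN : N₁ + 1 + (r + m) = N + 1) (hd : n + r = d)
    (hq : ∀ l, X (some l) ∈ Submodule.span k
      (Set.range fun lj : Fin r × Fin m => pderiv (some lj.1) (q lj.2)))
    (K : Matrix (Fin n) (Fin (N₁ + 1)) B) (i₀ j₀) (p : ℕ) (χ : MvPolynomial (Fin r) B →ₐ[k] k) :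
    Module.finrank k (constantTangent (graphHom (graphEquiv hN) π (K i₀ j₀ ^ p) q) χ
        fun ij : Fin d × Fin (N + 1) => graphMatrix hN hd (K i₀ j₀ ^ p) q K ij.1 ij.2) =
      Module.finrank k
        (constantTangent π (coeffHom χ) fun ij : Fin n × Fin (N₁ + 1) => K ij.1 ij.2) := by
  rw [constantTangent_graph hN hd hq]
  exact (Submodule.equivMapOfInjective _
    (fibreMatrix_mulVec_injective hN (K i₀ j₀ ^ p) χ) _).finrank_eq.symm

/-- The homomorphism `ψ`, which fixes the variables at their values under `χ` and reduces `B` modulo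
the fibre ideal `𝔫₁`, has kernel exactly `𝔫`. Both inclusions compare subalgebras on which two
homomorphisms agree: the entries of the large frame lie in such a subalgebra if and only if the
entries of `K` and the variables do. Under `ψ` the parametrization becomes the linear substitution
by `fibreMatrix`. -/
theorem graphHom_mem_span_iff (hN : N₁ + 1 + (r + m) = N + 1) (hd : n + r = d)
    (hq : ∀ l, X (some l) ∈ Submodule.span k
      (Set.range fun lj : Fin r × Fin m => pderiv (some lj.1) (q lj.2)))
    (K : Matrix (Fin n) (Fin (N₁ + 1)) B) (i₀ j₀) (p : ℕ) (χ : MvPolynomial (Fin r) B →ₐ[k] k)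
    (F : MvPolynomial (Fin (N + 1)) k) :
    graphHom (graphEquiv hN) π (K i₀ j₀ ^ p) q F ∈ Ideal.span (Set.range
        fun ij : Fin d × Fin (N + 1) => graphMatrix hN hd (K i₀ j₀ ^ p) q K ij.1 ij.2 -
          algebraMap k _ (χ (graphMatrix hN hd (K i₀ j₀ ^ p) q K ij.1 ij.2))) ↔
      π (aeval (fun j => ∑ i, C (fibreMatrix hN (K i₀ j₀ ^ p) q χ j i) * X i) F) ∈
        Ideal.span (Set.range fun ij : Fin n × Fin (N₁ + 1) =>
          K ij.1 ij.2 - algebraMap k B (χ (C (K ij.1 ij.2)))) := by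
  set θ := K i₀ j₀ ^ p with hθ
  set 𝔫 := Ideal.span (Set.range fun ij : Fin d × Fin (N + 1) =>
    graphMatrix hN hd θ q K ij.1 ij.2 - algebraMap k _ (χ (graphMatrix hN hd θ q K ij.1 ij.2)))
  set 𝔫₁ := Ideal.span (Set.range fun ij : Fin n × Fin (N₁ + 1) =>
    K ij.1 ij.2 - algebraMap k B (χ (C (K ij.1 ij.2))))
  let ψ : MvPolynomial (Fin r) B →ₐ[k] B ⧸ 𝔫₁ :=
    extendHom (Ideal.Quotient.mkₐ k 𝔫₁) fun l => algebraMap k _ (χ (X l))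
  let E := AlgHom.equalizer ψ ((Algebra.ofId k (B ⧸ 𝔫₁)).comp χ)
  have hEK : ∀ i j, C (K i j) ∈ E := fun i j => by
    rw [AlgHom.mem_equalizer, extendHom_C]
    exact Ideal.Quotient.eq.mpr (Ideal.subset_span ⟨(i, j), rfl⟩)
  have hEX : ∀ l, X l ∈ E := fun l => by
    rw [AlgHom.mem_equalizer, extendHom_X]
    rfl
  have hE := (forall_graphMatrix_mem_iff hN hd hq K i₀ j₀ p E).mpr ⟨hEK, hEX⟩
  let E' := AlgHom.equalizer (Ideal.Quotient.mkₐ k 𝔫)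
    ((Algebra.ofId k (MvPolynomial (Fin r) B ⧸ 𝔫)).comp χ)
  obtain ⟨hE'K, hE'X⟩ := (forall_graphMatrix_mem_iff hN hd hq K i₀ j₀ p E').mp fun i j =>
    Ideal.Quotient.eq.mpr (Ideal.subset_span ⟨(i, j), rfl⟩)
  have hker : ∀ f, f ∈ 𝔫 ↔ ψ f = 0 := by
    intro f
    constructor
    · intro hf
      have h1 : 𝔫 ≤ RingHom.ker ψ := by
        refine Ideal.span_le.mpr ?_
        rintro _ ⟨⟨i, j⟩, rfl⟩
        rw [SetLike.mem_coe, RingHom.mem_ker, map_sub, AlgHom.commutes, sub_eq_zero]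
        exact hE i j
      exact h1 hf
    · intro hf
      let ρ : B ⧸ 𝔫₁ →ₐ[k] MvPolynomial (Fin r) B ⧸ 𝔫 :=
        Ideal.Quotient.liftₐ 𝔫₁ (coeffHom (Ideal.Quotient.mkₐ k 𝔫)) (by
          have h1 : 𝔫₁ ≤ RingHom.ker (coeffHom (Ideal.Quotient.mkₐ k 𝔫)) := by
            refine Ideal.span_le.mpr ?_
            rintro _ ⟨⟨i, j⟩, rfl⟩
            rw [SetLike.mem_coe, RingHom.mem_ker, map_sub, AlgHom.commutes, sub_eq_zero]
            exact hE'K i j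
          exact fun b hb => h1 hb)
      have h2 : ρ.comp ψ = Ideal.Quotient.mkₐ k 𝔫 := by
        refine algHom_polynomial_ext (fun b => ?_) (fun l => ?_)
        · rw [AlgHom.comp_apply, extendHom_C]
          rfl
        · rw [AlgHom.comp_apply, extendHom_X, AlgHom.commutes]
          exact (hE'X l).symm
      have h3 := DFunLike.congr_fun h2 f
      rw [AlgHom.comp_apply, hf, map_zero] at h3
      exact Ideal.Quotient.eq_zero_iff_mem.mp h3.symm
  have hEθ : C θ ∈ E := by
    rw [hθ, C_pow]
    exact E.pow_mem (hEK _ _) p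
  have hψ : ψ (graphHom (graphEquiv hN) π θ q F) = Ideal.Quotient.mkₐ k 𝔫₁
      (π (aeval (fun j => ∑ i, C (fibreMatrix hN θ q χ j i) * X i) F)) := by
    rw [graphHom, comp_aeval_apply, comp_aeval_apply, comp_aeval_apply]
    congr 2
    funext j
    obtain ⟨s, rfl⟩ := (graphEquiv hN).surjective j
    rw [Equiv.symm_apply_apply]
    have h0 : ψ (C (π (X 0))) = Ideal.Quotient.mkₐ k 𝔫₁ (π (X 0)) := extendHom_C _ _ _
    have hC : ∀ a : k, Ideal.Quotient.mkₐ k 𝔫₁ (π (C a)) = algebraMap k _ a := fun a => by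
      rw [← algebraMap_eq, AlgHom.commutes, AlgHom.commutes]
    have hs : ∀ F, ψ (substHom θ F) = algebraMap k _ (χ (substHom θ F)) := fun F =>
      substHom_mem hEθ hEX F
    have hl : ∀ l, ψ (X l) = algebraMap k _ (χ (X l)) := hEX
    rcases s with i | l | j
    · have h1 : ψ (C (π (X i))) = Ideal.Quotient.mkₐ k 𝔫₁ (π (X i)) := extendHom_C _ _ _
      simp only [graphCoord, Sum.elim_inl, fibreMatrix, Matrix.of_apply, Equiv.symm_apply_apply,
        Pi.single_apply, apply_ite C, C_1, C_0, ite_mul, one_mul, zero_mul, Finset.sum_ite_eq',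
        Finset.mem_univ, if_true]
      exact h1
    · simp only [graphCoord, Sum.elim_inl, Sum.elim_inr, fibreMatrix, Matrix.of_apply,
        Equiv.symm_apply_apply, Pi.single_apply, apply_ite C, C_0, ite_mul, zero_mul,
        Finset.sum_ite_eq', Finset.mem_univ, if_true]
      rw [map_mul, map_mul, map_mul, h0, hl, hC, mul_comm]
    · simp only [graphCoord, Sum.elim_inr, fibreMatrix, Matrix.of_apply,
        Equiv.symm_apply_apply, Pi.single_apply, apply_ite C, C_0, ite_mul, zero_mul,
        Finset.sum_ite_eq', Finset.mem_univ, if_true]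
      rw [map_mul, map_mul, map_mul, h0, hs, hC, mul_comm]
  rw [hker, hψ]
  exact Ideal.Quotient.eq_zero_iff_mem

end GraphFibre

/-! ### Non-degeneracy of the graph -/

section Nondegenerate

open MvPolynomial

variable {k : Type*} [Field k] {B : Type*} [CommRing B] [Algebra k B] {N₁ N r m : ℕ}

theorem IsAffineChart.linearIndependent_iff [Infinite k] {X : Set (PSpace k (Fin (N + 1)))}
    {G : MvPolynomial (Fin (N + 1)) k} {π : MvPolynomial (Fin (N + 1)) k →ₐ[k] B}
    (h : IsAffineChart X G π) :
    LinearIndependent k (fun i => π (MvPolynomial.X i)) ↔ IsNondegenerate X := by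
  have h1 : ∀ c : Fin (N + 1) → k, ∑ i, c i • π (MvPolynomial.X i) = 0 ↔
      ∀ x ∈ X, ∑ i, c i * x.rep i = 0 := by
    intro c
    have hF : (∑ i, c i • MvPolynomial.X i : MvPolynomial (Fin (N + 1)) k).IsHomogeneous 1 :=
      IsHomogeneous.sum _ _ _ fun i _ => by
        rw [smul_eq_C_mul]
        exact (isHomogeneous_X k i).C_mul (c i)
    have h2 : ∀ v : Fin (N + 1) → k, eval v (∑ i, c i • MvPolynomial.X i) = ∑ i, c i * v i := by
      intro v
      simp [smul_eval]
    have h3 : ∑ i, c i • π (MvPolynomial.X i) = π (∑ i, c i • MvPolynomial.X i) := by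
      simp
    rw [h3, h.map_eq_zero_iff]
    constructor
    · intro h4 x hx
      rw [← h2, ← one_smul k x.rep]
      exact h4 x hx 1
    · intro h4
      refine (mem_vanishingIdeal_of_isHomogeneous hF).mpr fun x hx => ?_
      rw [h2]
      exact h4 x hx
  rw [Fintype.linearIndependent_iff]
  simp only [h1]
  exact forall_congr' fun c => forall_congr' fun _ => funext_iff.symm

theorem linearIndependent_graphHom_iff (hN : N₁ + 1 + (r + m) = N + 1)
    {π : MvPolynomial (Fin (N₁ + 1)) k →ₐ[k] B} {θ : B}
    {q : Fin m → MvPolynomial (Option (Fin r)) k} :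
    LinearIndependent k (fun j => graphHom (graphEquiv hN) π θ q (X j)) ↔
      LinearIndependent k (graphCoord π θ q) := by
  have h1 : (fun j => graphHom (graphEquiv hN) π θ q (X j)) ∘ graphEquiv hN = graphCoord π θ q :=
    funext fun t => by rw [Function.comp_apply, graphHom_X]
  rw [← h1, linearIndependent_equiv]

theorem substHom_rename (θ : B) {ι : Type*} (F : MvPolynomial ι k) :
    substHom θ (rename some F) = map (algebraMap k B) F := by
  rw [substHom, aeval_rename]
  induction F using MvPolynomial.induction_on with
  | C a =>
    rw [map_C]
    exact AlgHom.commutes _ a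
  | add F F' hF hF' => rw [map_add, map_add, hF, hF']
  | mul_X F l hF =>
    rw [map_mul, map_mul, hF, aeval_X, map_X]
    rfl

theorem C_smul_of_algebra {ι : Type*} (a : k) (b : B) :
    (C (a • b) : MvPolynomial ι B) = a • C b :=
  map_smul (IsScalarTower.toAlgHom k B (MvPolynomial ι B)) a b

/-- A linear relation among the coordinates has the form `b + x₀ F(s) = 0` with `b` in `B`. As `x₀`
is a unit, `F` is constant; then its coefficients vanish by the choice of `q`, and the relation is
one among the coordinates of `X₁`. -/
theorem linearIndependent_graphCoord_rename [Nontrivial B]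
    {π : MvPolynomial (Fin (N₁ + 1)) k →ₐ[k] B} (hx : LinearIndependent k fun i => π (X i))
    (hu : IsUnit (π (X 0))) (θ : B) {q : Fin m → MvPolynomial (Fin r) k}
    (hq : IsSpanningFamily q) :
    LinearIndependent k (graphCoord π θ fun j => rename some (q j)) := by
  rw [Fintype.linearIndependent_iff]
  intro g hg
  simp only [Fintype.sum_sum_type, graphCoord, Sum.elim_inl, Sum.elim_inr, substHom_rename] at hg
  set F : MvPolynomial (Fin r) k :=
    ∑ l, g (Sum.inr (Sum.inl l)) • X l + ∑ j, g (Sum.inr (Sum.inr j)) • q j with hF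
  have hs : ∀ (a : k) (f : MvPolynomial (Fin r) k), map (algebraMap k B) (a • f) =
      a • map (algebraMap k B) f := fun a f => by
    ext e
    simp [coeff_map, Algebra.smul_def]
  have h1 : C (∑ i, g (Sum.inl i) • π (X i)) + C (π (X 0)) * map (algebraMap k B) F = 0 := by
    rw [← hg, hF]
    simp only [map_sum, map_add, hs, C_smul_of_algebra, map_X, mul_add, Finset.mul_sum, mul_smul_comm]
  have h2 : F = C (coeff 0 F) := by
    ext e
    rw [coeff_C]
    split_ifs with he
    · rw [he]
    · have h3 := congrArg (coeff e) h1
      rw [coeff_add, coeff_C, if_neg he, zero_add, coeff_C_mul, coeff_map, coeff_zero,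
        hu.mul_right_eq_zero, map_eq_zero] at h3
      exact h3
  obtain ⟨h3, h4⟩ := hq.eq_zero _ _ _ h2
  have h5 : F = 0 := by
    rw [hF]
    simp [funext_iff.mp h3, funext_iff.mp h4]
  rw [h5, map_zero, mul_zero, add_zero, C_eq_zero] at h1
  rintro (i | l | j)
  · exact Fintype.linearIndependent_iff.mp hx _ h1 i
  · exact congrFun h3 l
  · exact congrFun h4 j

theorem linearIndependent_graphCoord_pow {π : MvPolynomial (Fin (N₁ + 1)) k →ₐ[k] B} {θ : B}
    {n : Fin m → ℕ} (hn : ∀ (a : Fin (N₁ + 1) → k) (b : Fin m → k),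
      ∑ i, a i • π (X i) + ∑ j, b j • (π (X 0) * θ ^ n j) = 0 → a = 0 ∧ b = 0) :
    LinearIndependent k (graphCoord π θ fun j => (X none ^ n j :
      MvPolynomial (Option (Fin 0)) k)) := by
  rw [Fintype.linearIndependent_iff]
  intro g hg
  have h0 : substHom (ι := Fin 0) θ (X none : MvPolynomial (Option (Fin 0)) k) = C θ := by
    simp [substHom]
  have h1 : ∀ j, substHom (ι := Fin 0) θ (X none ^ n j : MvPolynomial (Option (Fin 0)) k) =
      C (θ ^ n j) := fun j => by rw [map_pow, h0, C_pow]
  simp only [Fintype.sum_sum_type, graphCoord, Sum.elim_inl, Sum.elim_inr, Finset.univ_eq_empty,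
    Finset.sum_empty, zero_add, h1, ← C_mul, ← C_smul_of_algebra, ← map_sum, ← C_add,
    C_eq_zero] at hg
  obtain ⟨h3, h4⟩ := hn _ _ hg
  rintro (i | l | j)
  · exact congrFun h3 i
  · exact l.elim0
  · exact congrFun h4 j

/-- The graph of a suitable family is non-degenerate and has the expected Gauss map. -/
theorem exists_linearIndependent_graphCoord [IsAlgClosed k] [IsDomain B] (p : ℕ) [Fact p.Prime]
    [CharP k p] {n : ℕ} {π : MvPolynomial (Fin (N₁ + 1)) k →ₐ[k] B}
    (hx : LinearIndependent k fun i => π (X i)) (hu : IsUnit (π (X 0)))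
    (K : Matrix (Fin (n + 1)) (Fin (N₁ + 1)) B)
    (hK : r = 0 → ∃ i j, K i j ∉ (algebraMap k B).range)
    (hpr : ¬(p = 2 ∧ r = 1)) (hm : 1 ≤ m) (hm2 : p = 2 → Odd r → 2 ≤ m) :
    ∃ (i₀ : Fin (n + 1)) (j₀ : Fin (N₁ + 1)) (q : Fin m → MvPolynomial (Option (Fin r)) k),
      (∀ l, X (some l) ∈ Submodule.span k
        (Set.range fun lj : Fin r × Fin m => pderiv (some lj.1) (q lj.2))) ∧
      LinearIndependent k (graphCoord π (K i₀ j₀ ^ p) q) := by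
  by_cases hr : r = 0
  · subst hr
    -- Without variables the condition on derivatives is empty, and the new coordinates must come
    -- from `θ`, which therefore has to be non-constant.
    obtain ⟨i, j, hij⟩ := hK rfl
    have h1 := linearIndependent_pow_of_notMem_range hij (Fact.out : p.Prime).pos
    have h2 : LinearIndependent k fun n : ℕ => π (X 0) * (K i j ^ p) ^ n :=
      h1.map' (LinearMap.mulLeft k (π (X 0)))
        (LinearMap.ker_eq_bot.mpr fun a b hab => hu.mul_left_cancel hab)
    obtain ⟨e, he⟩ := exists_linearIndependent_pow h2 hx m
    exact ⟨i, j, _, fun l => l.elim0, linearIndependent_graphCoord_pow he⟩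
  · obtain ⟨q, hq⟩ := exists_isSpanningFamily_fin (k := k) p hr hpr hm hm2
    -- These `q j` do not involve `θ`, so any entry of `K` will do.
    refine ⟨0, 0, fun j => rename some (q j), fun l => ?_,
      linearIndependent_graphCoord_rename hx hu _ hq⟩
    have h1 := Submodule.mem_map_of_mem (f := (rename (R := k) some).toLinearMap) (hq.X_mem l)
    rw [Submodule.map_span, ← Set.range_comp] at h1
    simp only [AlgHom.toLinearMap_apply, rename_X] at h1
    refine Submodule.span_mono ?_ h1
    rintro _ ⟨lj, rfl⟩
    exact ⟨lj, pderiv_rename (Option.some_injective _) _ _⟩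

end Nondegenerate

/-! ### The coordinate projection between the images -/

section Projection

open MvPolynomial

theorem eval_rep_mk_comp_ne_zero_iff {k : Type*} [Field k] {τ τ₁ : Type*} {e : τ₁ → τ} {F : MvPolynomial τ₁ k} {d : ℕ} (hF : F.IsHomogeneous d)
    (y : PSpace k τ) (hy : (fun s => y.rep (e s)) ≠ 0) :
    eval (Projectivization.mk k (fun s => y.rep (e s)) hy).rep F ≠ 0 ↔
      eval y.rep (rename e F) ≠ 0 := by
  rw [eval_rep_mk_ne_zero_iff hF, eval_rename]
  rfl

variable {k : Type*} [Field k] [IsAlgClosed k] {σ σ₁ τ τ₁ : Type*} [Finite σ] [Finite σ₁]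
  {B B₁ : Type*} [CommRing B] [CommRing B₁] [IsDomain B] [IsDomain B₁] [Algebra k B] [Algebra k B₁]
  {X : Set (PSpace k σ)} {X₁ : Set (PSpace k σ₁)} {G : MvPolynomial σ k} {G₁ : MvPolynomial σ₁ k}
  {π : MvPolynomial σ k →ₐ[k] B} {π₁ : MvPolynomial σ₁ k →ₐ[k] B₁} {U : Set (PSpace k σ)}
  {U₁ : Set (PSpace k σ₁)} {f : U → PSpace k τ} {f₁ : U₁ → PSpace k τ₁} {g : τ → B} {g₁ : τ₁ → B₁}
  {a : τ} {a₁ : τ₁} {e : τ₁ → τ} {i : B₁ →ₐ[k] B}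

theorem IsMapChart.exists_mem_range_of_aeval_ne_zero (h : IsMapChart X G π f g a)
    {F : MvPolynomial τ k} {d : ℕ} (hF : F.IsHomogeneous d) (hgF : aeval g F ≠ 0) :
    ∃ y ∈ Set.range f, eval y.rep F ≠ 0 := by
  obtain ⟨χ, hχ⟩ := h.exists_map_ne_zero hgF
  obtain ⟨hv, hu, h0, hf⟩ := h.map_mk χ
  refine ⟨_, Set.mem_range_self ⟨_, hu⟩, ?_⟩
  rw [hf, eval_rep_mk_ne_zero_iff hF, ← aeval_eq_eval]
  rwa [comp_aeval_apply] at hχ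

theorem IsMapChart.aeval_ne_zero_of_mem_closure (h : IsMapChart X G π f g a) (hUX : U ⊆ X)
    (hrep : ∀ x : U, ∃ P, IsLocalRep f x P) {y : PSpace k τ} (hy : y ∈ closure (Set.range f))
    {F : MvPolynomial τ k} {d : ℕ} (hF : F.IsHomogeneous d) (hyF : eval y.rep F ≠ 0) :
    aeval g F ≠ 0 := fun h0 => hyF (h.eval_rep_eq_zero_of_mem_closure hUX hrep hy hF h0)

/-- If the functions that describe `f₁` are some of those that describe `f`, then a coordinate
projection maps the image of `f` dominantly to that of `f₁`, and this projection is compatible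
with the descriptions of the fibres. -/
theorem exists_rationalMap_closure_range (h : IsMapChart X G π f g a)
    (h₁ : IsMapChart X₁ G₁ π₁ f₁ g₁ a₁) (hX : IsProjectiveVariety X) (hX₁ : IsProjectiveVariety X₁)
    (hUX : U ⊆ X) (hUX₁ : U₁ ⊆ X₁) (hrep : ∀ x : U, ∃ P, IsLocalRep f x P)
    (hrep₁ : ∀ x : U₁, ∃ P, IsLocalRep f₁ x P) (hg : ∀ s, g (e s) = i (g₁ s)) (ha : e a₁ = a)
    (hi : Function.Injective i) :
    ∃ μ : RationalMap (closure (Set.range f)) (closure (Set.range f₁)), μ.IsDominant ∧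
      ∃ O : Set (PSpace k τ), IsOpen O ∧ (O ∩ closure (Set.range f)).Nonempty ∧
        ∀ y ∈ O ∩ closure (Set.range f), ∃ (hy : y ∈ μ.dom) (χ : B →ₐ[k] k),
          (∀ F, F ∈ fiberIdeal X f y ↔
            π F ∈ Ideal.span (Set.range fun c => g c - algebraMap k B (χ (g c)))) ∧
          ∀ F, F ∈ fiberIdeal X₁ f₁ (μ.toFun ⟨y, hy⟩) ↔
            π₁ F ∈ Ideal.span (Set.range fun c => g₁ c - algebraMap k B₁ (χ (i (g₁ c)))) := by
  subst ha
  have haeval : ∀ F : MvPolynomial τ₁ k, aeval g (rename e F) = i (aeval g₁ F) := fun F => by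
    rw [aeval_rename, comp_aeval_apply]
    congr 2
    funext s
    exact hg s
  have hX1 : (MvPolynomial.X (e a₁) : MvPolynomial τ k).IsHomogeneous 1 := isHomogeneous_X _ _
  let D : Set (PSpace k τ) :=
    {y | eval y.rep (MvPolynomial.X (e a₁)) ≠ 0} ∩ closure (Set.range f)
  have hne : ∀ y : D, (fun s => (y : PSpace k τ).rep (e s)) ≠ 0 := fun y h0 => by
    have h2 := y.2.1
    rw [Set.mem_ofPred_eq, eval_X] at h2
    exact h2 (congrFun h0 a₁)
  have hdom : D.Nonempty := by
    obtain ⟨y, hy, hya⟩ := h.exists_mem_range_of_aeval_ne_zero hX1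
      (by rw [aeval_X, h.apply_eq_one]; exact one_ne_zero)
    exact ⟨y, hya, subset_closure hy⟩
  let μ : RationalMap (closure (Set.range f)) (closure (Set.range f₁)) :=
    { dom := D
      dom_open := ⟨_, isOpen_setOf_eval_ne_zero hX1, rfl⟩
      dom_nonempty := hdom
      toFun := fun y => Projectivization.mk k (fun s => (y : PSpace k τ).rep (e s)) (hne y)
      mem := fun y => by
        rw [mem_closure_iff_eval]
        intro F d hF hyF
        rw [eval_rep_mk_comp_ne_zero_iff hF] at hyF
        have h2 := h.aeval_ne_zero_of_mem_closure hUX hrep y.2.2 hF.rename_isHomogeneous hyF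
        rw [haeval] at h2
        exact h₁.exists_mem_range_of_aeval_ne_zero hF fun h3 => h2 (by rw [h3, map_zero])
      regular := fun y => ⟨fun s => MvPolynomial.X (e s), ⟨1, fun s => isHomogeneous_X _ _⟩,
        by simpa only [eval_X] using hne y, fun u hu => by simp only [eval_X]⟩ }
  refine ⟨μ, fun y₁ hy₁ => ?_, ?_⟩
  · rw [mem_closure_iff_eval]
    intro F d hF hyF
    have h2 := h₁.aeval_ne_zero_of_mem_closure hUX₁ hrep₁ hy₁ hF hyF
    have h3 : aeval g (rename e F * MvPolynomial.X (e a₁)) ≠ 0 := by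
      rw [map_mul, haeval, aeval_X, h.apply_eq_one, mul_one]
      exact (map_ne_zero_iff i hi).mpr h2
    obtain ⟨y, hy, hyF⟩ := h.exists_mem_range_of_aeval_ne_zero
      (hF.rename_isHomogeneous.mul hX1) h3
    rw [map_mul] at hyF
    refine ⟨_, ⟨⟨y, right_ne_zero_of_mul hyF, subset_closure hy⟩, rfl⟩, ?_⟩
    exact (eval_rep_mk_comp_ne_zero_iff hF y _).mpr (left_ne_zero_of_mul hyF)
  · obtain ⟨H, d, hH, hgH, hfib⟩ := h.exists_forall_mem_fiberIdeal_iff hX hUX hrep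
    obtain ⟨H₁, d₁, hH₁, hgH₁, hfib₁⟩ := h₁.exists_forall_mem_fiberIdeal_iff hX₁ hUX₁ hrep₁
    -- Three open conditions: the fibre over `y` and the fibre over its projection are computed in
    -- the charts, and the projection is defined at `y`.
    have hhom := (hH.mul (hH₁.rename_isHomogeneous (f := e))).mul hX1
    refine ⟨_, isOpen_setOf_eval_ne_zero hhom, ?_, ?_⟩
    · obtain ⟨y, hy, hyF⟩ := h.exists_mem_range_of_aeval_ne_zero hhom (by
        rw [map_mul, map_mul, haeval, aeval_X, h.apply_eq_one, mul_one]
        exact mul_ne_zero hgH ((map_ne_zero_iff i hi).mpr hgH₁))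
      exact ⟨y, hyF, subset_closure hy⟩
    · rintro y ⟨hyO, hyf⟩
      rw [Set.mem_ofPred_eq, map_mul, map_mul] at hyO
      have hya := right_ne_zero_of_mul hyO
      have hyH₁ := right_ne_zero_of_mul (left_ne_zero_of_mul hyO)
      refine ⟨⟨hya, hyf⟩, ?_⟩
      obtain ⟨χ, ⟨h2, hχ⟩, hF⟩ := hfib y hyf (left_ne_zero_of_mul (left_ne_zero_of_mul hyO))
      obtain ⟨χ₁, ⟨h3, hχ₁⟩, hF₁⟩ := hfib₁ _ (μ.mem ⟨y, hya, hyf⟩)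
        ((eval_rep_mk_comp_ne_zero_iff hH₁ y _).mpr hyH₁)
      -- Both sides are the coordinates of the projected point, normalized to be `1` at `a₁`.
      have h4 : ∀ c, χ₁ (g₁ c) = χ (i (g₁ c)) := by
        intro c
        have h5 := mk_eq_mk_of_apply_eq_one (a := a₁) (w := fun c => χ₁ (g₁ c))
          (by rw [h₁.apply_eq_one, map_one]) hχ₁ c
        have h6 := mk_eq_mk_of_apply_eq_one (a := e a₁) (hv := y.rep_nonzero)
          (w := fun c => χ (g c)) (by rw [h.apply_eq_one, map_one]) (y.mk_rep.trans hχ) (e c)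
        rw [eval_X] at hya
        rw [← hg]
        exact mul_left_cancel₀ hya (h5.symm.trans h6)
      refine ⟨χ, hF, fun F => ?_⟩
      rw [hF₁]
      simp only [h4]

end Projection

/-! ### The Gauss map of the graph, and the main theorem -/

section GraphGauss

open MvPolynomial

variable {k : Type*} [Field k] [IsAlgClosed k] {B : Type*} [CommRing B] [Algebra k B] [IsDomain B]
  {N₁ N r m p : ℕ} [Fact p.Prime] [CharP k p] {X₁ : Set (PSpace k (Fin (N₁ + 1)))}
  {π : MvPolynomial (Fin (N₁ + 1)) k →ₐ[k] B} {δ : MvPolynomial (Fin (N₁ + 1)) k}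
  {c₁ : Fin (dim X₁ + 1) ↪o Fin (N₁ + 1)} {K : Matrix (Fin (dim X₁ + 1)) (Fin (N₁ + 1)) B}
  {i₀ : Fin (dim X₁ + 1)} {j₀ : Fin (N₁ + 1)} {q : Fin m → MvPolynomial (Option (Fin r)) k}
  {hN : N₁ + 1 + (r + m) = N + 1} {X : Set (PSpace k (Fin (N + 1)))}
  {G : MvPolynomial (Fin (N + 1)) k}

theorem hasRank_graph (h₁ : IsFrameChart X₁ (δ * MvPolynomial.X 0) π c₁ K)
    (hX : IsProjectiveVariety X)
    (hq : ∀ l, MvPolynomial.X (some l) ∈ Submodule.span k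
      (Set.range fun lj : Fin r × Fin m => pderiv (some lj.1) (q lj.2)))
    (h : IsAffineChart X G (graphHom (graphEquiv hN) π (K i₀ j₀ ^ p) q))
    {ρ d : ℕ} {H : MvPolynomial (Fin (N₁ + 1)) k} (hH : H.IsHomogeneous d)
    (hHX : H ∉ vanishingIdeal X₁) (hρ : ∀ χ : B →ₐ[k] k, eval (chartPoint π χ) H ≠ 0 →
      Module.finrank k (constantTangent π χ fun ij : Fin (dim X₁ + 1) × Fin (N₁ + 1) =>
        K ij.1 ij.2) + ρ = dim X₁ + 1) :
    HasRank X (gaussMap X) (ρ + r) := by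
  have hθ : ∀ (χ : B →ₐ[k] k) (D : B →ₗ[k] k), IsPointDerivation χ D → D (K i₀ j₀ ^ p) = 0 :=
    fun χ D hD => hD.map_pow_char p _
  have hd := dim_graph h₁ hθ hX h
  refine (isFrameChart_graph h₁ hθ h hd).hasRank hX
    (hH.rename_isHomogeneous (f := fun i => graphEquiv hN (Sum.inl i))) ?_ fun χ hχ => ?_
  · rw [← h.map_eq_zero_iff, graphHom_rename, C_eq_zero, h₁.map_eq_zero_iff]
    exact hHX
  · rw [eval_chartPoint, graphHom_rename, ← coeffHom_apply, ← eval_chartPoint] at hχ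
    rw [finrank_constantTangent_graph hN hd hq, ← hd, ← add_assoc, hρ _ hχ]

theorem exists_rationalMap_graph (h₁ : IsFrameChart X₁ (δ * MvPolynomial.X 0) π c₁ K)
    (hX₁ : IsProjectiveVariety X₁) (hX : IsProjectiveVariety X)
    (hq : ∀ l, MvPolynomial.X (some l) ∈ Submodule.span k
      (Set.range fun lj : Fin r × Fin m => pderiv (some lj.1) (q lj.2)))
    (h : IsAffineChart X G (graphHom (graphEquiv hN) π (K i₀ j₀ ^ p) q)) :
    ∃ μ : RationalMap (gaussImage X) (gaussImage X₁), μ.IsDominant ∧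
      ∃ O : Set (PSpace k (Fin (dim X + 1) ↪o Fin (N + 1))),
        IsOpen O ∧ (O ∩ gaussImage X).Nonempty ∧
        ∀ y ∈ O ∩ gaussImage X, ∃ hy : y ∈ μ.dom,
          ProjEquiv (fiberIdeal X₁ (gaussMap X₁) (μ.toFun ⟨y, hy⟩))
            (fiberIdeal X (gaussMap X) y) := by
  have hθ : ∀ (χ : B →ₐ[k] k) (D : B →ₗ[k] k), IsPointDerivation χ D → D (K i₀ j₀ ^ p) = 0 :=
    fun χ D hD => hD.map_pow_char p _
  have hd := dim_graph h₁ hθ hX h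
  have hK := isFrameChart_graph h₁ hθ h hd
  obtain ⟨μ, hμ, O, hO, hne, hfib⟩ := exists_rationalMap_closure_range (hK.isMapChart hX)
    (h₁.isMapChart hX₁) hX hX₁ (fun x hx => hx.1) (fun x hx => hx.1)
    hX.exists_isLocalRep_gaussMap hX₁.exists_isLocalRep_gaussMap
    (e := extendEmbedding hN hd) (i := IsScalarTower.toAlgHom k B (MvPolynomial (Fin r) B))
    (fun s => det_graphMatrix_submatrix hN hd _ q K s) rfl (C_injective _ _)
  refine ⟨μ, hμ, O, hO, hne, fun y hy => ?_⟩
  obtain ⟨hyμ, χ, hF, hF₁⟩ := hfib y hy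
  refine ⟨hyμ, fibreMatrix hN (K i₀ j₀ ^ p) q χ, fibreMatrix_mulVec_injective hN _ χ, ?_⟩
  ext F
  rw [hF, span_minors_sub_eq hK.submatrix_eq, graphHom_mem_span_iff hN hd hq, Ideal.mem_comap, hF₁]
  have h2 := span_minors_sub_eq h₁.submatrix_eq (coeffHom χ)
  simp only [coeffHom_apply] at h2
  rw [← h2]
  rfl

end GraphGauss
end GaussMaps

theorem mainTheorem5 {k : Type*} [Field k] [IsAlgClosed k] (p : ℕ) [Fact p.Prime] [CharP k p]
    (N₁ N r : ℕ) (X₁ : Set (GaussMaps.PSpace k (Fin (N₁ + 1))))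
    (hX₁ : GaussMaps.IsProjectiveVariety X₁) (hX₁nd : GaussMaps.IsNondegenerate X₁)
    (hpr : ¬ (p = 2 ∧ r = 1))
    (hN : N₁ + (r + 1) ≤ N)
    (hN2 : p = 2 → Odd r → N₁ + (r + 2) ≤ N)
    (hr : r = 0 → X₁ ≠ Set.univ) :
    ∃ (X : Set (GaussMaps.PSpace k (Fin (N + 1))))
      (μ : GaussMaps.RationalMap (GaussMaps.gaussImage X) (GaussMaps.gaussImage X₁)),
      GaussMaps.IsProjectiveVariety X ∧ GaussMaps.IsNondegenerate X ∧ μ.IsDominant ∧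
      (∃ ρ : ℕ, GaussMaps.HasRank X₁ (GaussMaps.gaussMap X₁) ρ ∧
        GaussMaps.HasRank X (GaussMaps.gaussMap X) (ρ + r)) ∧
      ∃ O : Set (GaussMaps.PSpace k (Fin (GaussMaps.dim X + 1) ↪o Fin (N + 1))),
        IsOpen O ∧ (O ∩ GaussMaps.gaussImage X).Nonempty ∧
        ∀ y ∈ O ∩ GaussMaps.gaussImage X, ∃ hy : y ∈ μ.dom,
          GaussMaps.ProjEquiv
            (GaussMaps.fiberIdeal X₁ (GaussMaps.gaussMap X₁) (μ.toFun ⟨y, hy⟩))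
            (GaussMaps.fiberIdeal X (GaussMaps.gaussMap X) y) := by
  open GaussMaps MvPolynomial in
  have hL := isHomogeneous_X k (0 : Fin (N₁ + 1))
  -- Non-degeneracy excludes the hyperplane `X 0 = 0`, so `x₀` can be inverted in the chart.
  have hL₁ : (X 0 : MvPolynomial (Fin (N₁ + 1)) k) ∉ vanishingIdeal X₁ := by
    intro h0
    have h1 := hX₁nd (Pi.single 0 1) fun x hx => by
      have h2 := h0 x hx 1
      rw [one_smul, eval_X] at h2
      simp [Pi.single_apply, h2]
    simpa using congrFun h1 0
  obtain ⟨c₁, K₀, δ, e, K, hδ, hK₀, hδX, h₁, hK⟩ := hX₁.exists_isFrameChart hL hL₁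
  have hdom := hX₁.isDomain_away hδX
  have hu := h₁.isUnit
  rw [map_mul (awayHom X₁ (δ * X 0))] at hu
  obtain ⟨ρ, H, d, hH, hHX, hρ⟩ := h₁.exists_finrank_constantTangent hδ hK₀
    (isUnit_of_mul_isUnit_left hu) hK
  -- The number `m` of polynomials is what remains of the new coordinates after the `r` variables;
  -- the bounds on `N` make it at least `1`, and at least `2` if `p = 2` and `r` is odd.
  obtain ⟨i₀, j₀, q, hq, hli⟩ := exists_linearIndependent_graphCoord (r := r)
    (m := N - N₁ - r) p (h₁.linearIndependent_iff.mpr hX₁nd) (isUnit_of_mul_isUnit_right hu) K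
    (fun h0 => h₁.exists_notMem_range hX₁ hX₁nd (hr h0)) hpr (by omega)
    (fun h2 hodd => by have := hN2 h2 hodd; omega)
  have hN' : N₁ + 1 + (r + (N - N₁ - r)) = N + 1 := by omega
  obtain ⟨X, hX, h⟩ := exists_isAffineChart_graphHom (graphEquiv hN') q h₁.toIsAffineChart
    (θ := K i₀ j₀ ^ p) fun χ χ' a ha hχ => by
      rw [map_pow, map_pow, h₁.apply_eq_of_smul ha hχ]
  obtain ⟨μ, hμ, hO⟩ := exists_rationalMap_graph h₁ hX₁ hX hq h
  exact ⟨X, μ, hX, h.linearIndependent_iff.mp (linearIndependent_graphHom_iff hN' |>.mpr hli), hμ,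
    ⟨ρ, h₁.hasRank hX₁ hH hHX hρ, hasRank_graph h₁ hX hq h hH hHX hρ⟩, hO⟩
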